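/- Let $M$ be a compact (Hausdorff, without boundary, not necessarily connected) smooth manifold of dimension at least $4$. A smooth $2$-form $\omega$ on $M$ is called locally conformally symplectic (lcs) if it is non-degenerate and $M$ has an open covering $\{U_i\}$ with smooth positive functions $f_i$ on $U_i$ such that $f_i\,\omega|_{U_i}$ is symplectic on $U_i$ for every $i$; its Lee form is the (unique) closed $1$-form $\theta$ with $d\omega=\theta\wedge\omega$. Two lcs forms $\omega,\omega'$ are conformally equivalent if $\omega=f\omega'$ for some smooth positive function $f$ on $M$. Let $\omega_t$, $t\in[0,1]$, be a smooth family of lcs forms on $M$ whose Lee forms $\theta_t$ all have the same de Rham cohomology class. Suppose that there is a smooth family of $1$-forms $\alpha_t$, $t\in[0,1]$, such that $\omega_t=d\alpha_t-\theta_t\wedge\alpha_t$ for all $t\in[0,1]$. Then there is an isotopy $\phi_t$ of $M$, $t\in[0,1]$ (that is, a family of diffeomorphisms of $M$, depending smoothly on $t$, with $\phi_0=\mathrm{id}_M$), such that $\phi_t^*\omega_t$ is conformally equivalent to $\omega_0$ for every $t\in[0,1]$. -/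

import Mathlib

open Set
open scoped Manifold ContDiff Topology

namespace LCS

section Linear

variable {E : Type*} [NormedAddCommGroup E] [NormedSpace ℝ E]

/-- The wedge product of a `1`-covector with an alternating `k`-form, with the normalisation
`(θ ∧ β)(v₀, …, v_k) = ∑ i, (-1) ^ i * θ(v_i) * β(v₀, …, v̂_i, …, v_k)`
(see `wedgeOne_apply`), which is the one that goes with Mathlib's `extDeriv`. -/
noncomputable def wedgeOne {k : ℕ} (θ : E [⋀^Fin 1]→L[ℝ] ℝ) (β : E [⋀^Fin k]→L[ℝ] ℝ) :
    E [⋀^Fin (k + 1)]→L[ℝ] ℝ :=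
  ContinuousAlternatingMap.alternatizeUncurryFin
    (((ContinuousAlternatingMap.ofSubsingleton ℝ E ℝ (0 : Fin 1)).symm θ).smulRight β)

theorem wedgeOne_apply {k : ℕ} (θ : E [⋀^Fin 1]→L[ℝ] ℝ) (β : E [⋀^Fin k]→L[ℝ] ℝ)
    (v : Fin (k + 1) → E) :
    wedgeOne θ β v = ∑ i : Fin (k + 1), (-1 : ℝ) ^ (i : ℕ) * (θ ![v i] * β (i.removeNth v)) := by
  rw [wedgeOne, ContinuousAlternatingMap.alternatizeUncurryFin_apply]
  refine Finset.sum_congr rfl fun i _ => ?_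
  have h : (fun _ : Fin 1 => v i) = ![v i] := by
    funext j; fin_cases j; rfl
  have h' : (ContinuousAlternatingMap.ofSubsingleton ℝ E ℝ (0 : Fin 1)).symm θ (v i)
      = θ ![v i] := by rw [← h]; rfl
  rw [ContinuousLinearMap.smulRight_apply, h', ContinuousAlternatingMap.smul_apply, smul_eq_mul]
  simp

end Linear

section Forms

variable {E : Type*} [NormedAddCommGroup E] [NormedSpace ℝ E]
variable {M : Type*} [TopologicalSpace M] [ChartedSpace E M]

variable (E M) in
/-- A (not necessarily smooth) differential `k`-form on a manifold `M` modelled on `E`: an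
alternating `k`-linear form on each tangent space. -/
abbrev Form (k : ℕ) : Type _ :=
  (x : M) → TangentSpace 𝓘(ℝ, E) x [⋀^Fin k]→L[ℝ] ℝ

/-- The wedge product of a `1`-form with a `k`-form. -/
noncomputable def wedge {k : ℕ} (θ : Form E M 1) (β : Form E M k) : Form E M (k + 1) :=
  fun x => wedgeOne (E := E) (θ x) (β x)

/-- The coordinate expression of a form in the preferred chart around `x₀`: its pullback by the
inverse of the chart. Only its values on the target of the chart are meaningful. -/
noncomputable def inChart {k : ℕ} (x₀ : M) (w : Form E M k) (y : E) : E [⋀^Fin k]→L[ℝ] ℝ :=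
  (w ((extChartAt 𝓘(ℝ, E) x₀).symm y)).compContinuousLinearMap
    (mfderiv 𝓘(ℝ, E) 𝓘(ℝ, E) (extChartAt 𝓘(ℝ, E) x₀).symm y)

/-- A form is smooth on an open set `U` if its coordinate expressions are. -/
def SmoothFormOn {k : ℕ} (w : Form E M k) (U : Set M) : Prop :=
  ∀ x₀ : M, ContDiffOn ℝ ∞ (inChart x₀ w)
    ((extChartAt 𝓘(ℝ, E) x₀).target ∩ (extChartAt 𝓘(ℝ, E) x₀).symm ⁻¹' U)

/-- A smooth family of `k`-forms, `t ∈ [0, 1]`: the coordinate expressions are smooth functions of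
the parameter and the coordinates jointly (one-sided in `t` at the end points). -/
def SmoothFamily {k : ℕ} (w : ℝ → Form E M k) : Prop :=
  ∀ x₀ : M, ContDiffOn ℝ ∞ (fun p : ℝ × E => inChart x₀ (w p.1) p.2)
    (Icc (0 : ℝ) 1 ×ˢ (extChartAt 𝓘(ℝ, E) x₀).target)

/-- The exterior derivative of a form: at the point `x` it is computed in the preferred chart around
`x`. For forms that are smooth near `x` any other smooth chart gives the same result. -/
noncomputable def extD {k : ℕ} (w : Form E M k) : Form E M (k + 1) := fun x =>
  (extDeriv (inChart x w) (extChartAt 𝓘(ℝ, E) x x)).compContinuousLinearMap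
    (mfderiv 𝓘(ℝ, E) 𝓘(ℝ, E) (extChartAt 𝓘(ℝ, E) x) x)

/-- The differential of a function, as a `1`-form. -/
noncomputable def differential (h : M → ℝ) : Form E M 1 := fun x =>
  ContinuousAlternatingMap.ofSubsingleton ℝ (TangentSpace 𝓘(ℝ, E) x) ℝ (0 : Fin 1)
    (mfderiv 𝓘(ℝ, E) 𝓘(ℝ, ℝ) h x)

/-- Two closed smooth `1`-forms have the same de Rham cohomology class: their difference is the
differential of a smooth function. -/
def SameDeRhamClass (θ θ' : Form E M 1) : Prop :=
  ∃ h : M → ℝ, ContMDiff 𝓘(ℝ, E) 𝓘(ℝ, ℝ) ∞ h ∧ ∀ x, θ x - θ' x = differential h x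

/-- The pullback of a form by a map. -/
noncomputable def pullback {k : ℕ} (φ : M → M) (w : Form E M k) : Form E M k := fun x =>
  (w (φ x)).compContinuousLinearMap (mfderiv 𝓘(ℝ, E) 𝓘(ℝ, E) φ x)

/-- A `2`-form is non-degenerate at a point. -/
def NondegenerateAt (w : Form E M 2) (x : M) : Prop :=
  ∀ u : TangentSpace 𝓘(ℝ, E) x, (∀ v : TangentSpace 𝓘(ℝ, E) x, w x ![u, v] = 0) → u = 0

/-- `w` restricts to a symplectic form on the open set `U`. -/
structure IsSymplecticOn (w : Form E M 2) (U : Set M) : Prop where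
  smooth : SmoothFormOn w U
  nondegenerate : ∀ x ∈ U, NondegenerateAt w x
  closed : ∀ x ∈ U, extD w x = 0

/-- Locally conformally symplectic forms: smooth non-degenerate `2`-forms that become symplectic on
the sets of an open covering after multiplication by smooth positive functions on these sets. -/
structure IsLCS (w : Form E M 2) : Prop where
  smooth : SmoothFormOn w univ
  nondegenerate : ∀ x, NondegenerateAt w x
  locally_conformal : ∀ x : M, ∃ U : Set M, IsOpen U ∧ x ∈ U ∧ ∃ f : M → ℝ,
    ContMDiffOn 𝓘(ℝ, E) 𝓘(ℝ, ℝ) ∞ f U ∧ (∀ y ∈ U, 0 < f y) ∧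
      IsSymplecticOn (fun y => f y • w y) U

/-- `θ` is a Lee form of `w`: a closed smooth `1`-form with `dw = θ ∧ w`. -/
structure IsLeeForm (θ : Form E M 1) (w : Form E M 2) : Prop where
  smooth : SmoothFormOn θ univ
  closed : ∀ x, extD θ x = 0
  extD_eq : ∀ x, extD w x = wedge θ w x

/-- Conformal equivalence of `2`-forms. -/
def ConformallyEquivalent (w w' : Form E M 2) : Prop :=
  ∃ f : M → ℝ, ContMDiff 𝓘(ℝ, E) 𝓘(ℝ, ℝ) ∞ f ∧ (∀ x, 0 < f x) ∧ ∀ x, w x = f x • w' x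

/-- An isotopy of `M`: diffeomorphisms `φ t`, `t ∈ [0, 1]`, that depend smoothly on `t` and start
at the identity. -/
structure IsIsotopy (φ : ℝ → (M ≃ₘ^∞⟮𝓘(ℝ, E), 𝓘(ℝ, E)⟯ M)) : Prop where
  smooth : ContMDiffOn (𝓘(ℝ, ℝ).prod 𝓘(ℝ, E)) 𝓘(ℝ, E) ∞
    (fun p : ℝ × M => φ p.1 p.2) (Icc (0 : ℝ) 1 ×ˢ univ)
  map_zero : ∀ x, φ 0 x = x

end Forms

end LCS

/-! This is Moser's method. Since the class of θ_t is constant, ∂ₜθ_t = dg_t for a smooth family of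
functions g_t. Non-degeneracy of ω_t defines a vector field X_t by i(X_t)ω_t = g_t α_t - ∂ₜα_t. From
ω = dα - θ ∧ α, dω = θ ∧ ω and Cartan's formula, ∂ₜω + L_X ω = (dg - ∂ₜθ) ∧ α + g (dα - θ ∧ α) +
θ(X) ω = (g + θ(X)) ω. So, along the flow φ_t of X_t, the pullback φ_t^*ω_t solves a linear scalar
equation and equals exp(∫₀ᵗ (g_s + θ_s(X_s)) ∘ φ_s ds) ω_0. The identity is `moser_identity`, its
integration `bilChart_pullback_eq_exp`.

Three points of regularity take up the rest.

The θ_t are not given as a smooth family. In dimension at least 4 a covector ϑ can be recovered from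
ϑ ∧ B, smoothly in the data, when B is non-degenerate; applied to dω = θ ∧ ω this gives joint
smoothness (`contDiffOn_linChart_lee`).

The functions h_t with dh_t = θ_t - θ_0 are chosen separately for each t. Subtracting from h_t its
value at a base point of each connected component makes them jointly smooth
(`exists_smooth_primitive`), and g = ∂ₜh.

The field X_t is defined only for t in [0, 1], and its flow must be smooth up to the end points
(`exists_isotopy_of_vectorField`). M is embedded in a vector space, X is extended for each m to a
bounded Lipschitz C^m field there, and uniqueness of integral curves shows that all these ambient
flows preserve M and agree on it. Smoothness of ambient flows comes from the implicit function
theorem in C([0, 1], V). -/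

namespace LCS

/-! ### Postcomposition with a C^n map on spaces of continuous functions. -/

section Postcomposition

/-- Pointwise application of a continuous family of operators to a continuous family of vectors. -/
noncomputable def pointwiseApply (K V W : Type*) [TopologicalSpace K] [CompactSpace K]
    [NormedAddCommGroup V] [NormedSpace ℝ V] [NormedAddCommGroup W] [NormedSpace ℝ W] :
    C(K, V →L[ℝ] W) →L[ℝ] C(K, V) →L[ℝ] C(K, W) :=
  LinearMap.mkContinuous₂
    (LinearMap.mk₂ ℝ (fun (A : C(K, V →L[ℝ] W)) (h : C(K, V)) =>
        (⟨fun s => A s (h s), by fun_prop⟩ : C(K, W)))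
      (fun A B h => by ext s; simp) (fun c A h => by ext s; simp)
      (fun A h h' => by ext s; simp) (fun c A h => by ext s; simp)) 1
    (fun A h => by
      rw [one_mul, ContinuousMap.norm_le _ (by positivity)]
      intro s
      exact (A s).le_of_opNorm_le_of_le (A.norm_coe_le_norm s) (h.norm_coe_le_norm s))

universe u

/-- The mean value inequality holds at each s separately; what makes the remainder small in the sup
norm is continuity of γ ↦ g' ∘ γ, which bounds the variation of g' uniformly in s. -/
theorem hasFDerivAt_postcomp {K : Type*} [TopologicalSpace K] [CompactSpace K]
    {V W : Type*} [NormedAddCommGroup V] [NormedSpace ℝ V] [NormedAddCommGroup W] [NormedSpace ℝ W]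
    (g : C(V, W)) (g' : C(V, V →L[ℝ] W)) (hg : ∀ x, HasFDerivAt g (g' x) x) (γ : C(K, V)) :
    HasFDerivAt (fun γ : C(K, V) => g.comp γ) (pointwiseApply K V W (g'.comp γ)) γ := by
  rw [hasFDerivAt_iff_isLittleO_nhds_zero, Asymptotics.isLittleO_iff]
  intro ε hε
  have hc : ContinuousAt (fun γ : C(K, V) => g'.comp γ) γ :=
    (ContinuousMap.continuous_postcomp g').continuousAt
  obtain ⟨δ, hδ, hδ'⟩ :=
    (Metric.continuousAt_iff (α := C(K, V)) (β := C(K, V →L[ℝ] W))).1 hc ε hε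
  filter_upwards [Metric.ball_mem_nhds (0 : C(K, V)) hδ] with h hh
  rw [mem_ball_zero_iff] at hh
  rw [ContinuousMap.norm_le _ (by positivity)]
  intro s
  -- A point of the segment is the value at s of γ + r • h, a function within δ of γ in the sup
  -- norm.
  have key : ∀ z ∈ segment ℝ (γ s) (γ s + h s), ‖g' z - g' (γ s)‖ ≤ ε := by
    intro z hz
    obtain ⟨r, hr, rfl⟩ := (segment_eq_image' ℝ (γ s) (γ s + h s)) ▸ hz
    have h1 : dist (γ + r • h) γ < δ := by
      rw [dist_eq_norm, add_sub_cancel_left, norm_smul, Real.norm_of_nonneg hr.1]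
      exact (mul_le_of_le_one_left (norm_nonneg _) hr.2).trans_lt hh
    have h2 := (ContinuousMap.norm_coe_le_norm (g'.comp (γ + r • h) - g'.comp γ) s).trans
      ((dist_eq_norm (g'.comp (γ + r • h)) (g'.comp γ)) ▸ (hδ' h1).le)
    simpa using h2
  have h3 := (convex_segment (γ s) (γ s + h s)).norm_image_sub_le_of_norm_hasFDerivWithin_le'
    (f := g) (f' := fun z => g' z) (φ := g' (γ s)) (fun z _ => (hg z).hasFDerivWithinAt) key
    (left_mem_segment ℝ _ _) (right_mem_segment ℝ _ _)
  have h4 : ‖h s‖ ≤ ‖h‖ := h.norm_coe_le_norm s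
  refine le_trans (le_of_eq ?_) (h3.trans ?_)
  · simp [pointwiseApply]
  · rw [add_sub_cancel_left]
    gcongr

/-- Induction on n: the derivative is again a postcomposition, with g', followed by a fixed
continuous linear map. V and W share a universe because W is replaced by V →L[ℝ] W in the induction.
-/
theorem contDiff_postcomp {K : Type*} [TopologicalSpace K] [CompactSpace K]
    {V : Type u} [NormedAddCommGroup V] [NormedSpace ℝ V] (n : ℕ) :
    ∀ {W : Type u} [NormedAddCommGroup W] [NormedSpace ℝ W] (g : C(V, W)), ContDiff ℝ n g →
      ContDiff ℝ n (fun γ : C(K, V) => g.comp γ) := by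
  induction n with
  | zero =>
    intro W _ _ g _
    exact contDiff_zero.2 (ContinuousMap.continuous_postcomp g)
  | succ n ih =>
    intro W _ _ g hg
    obtain ⟨g', hg', hd⟩ := (contDiff_succ_iff_hasFDerivAt (𝕜 := ℝ) (n := n)).1 (by exact_mod_cast hg)
    push_cast
    refine (contDiff_succ_iff_hasFDerivAt (𝕜 := ℝ) (n := n)).2
      ⟨fun γ => pointwiseApply K V W ((⟨g', hg'.continuous⟩ : C(V, V →L[ℝ] W)).comp γ), ?_, ?_⟩
    · exact (pointwiseApply K V W).contDiff.comp (ih ⟨g', hg'.continuous⟩ hg')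
    · intro γ
      exact hasFDerivAt_postcomp g ⟨g', hg'.continuous⟩ hd γ

end Postcomposition

end LCS

namespace LCS

/-! ### Global flows of bounded Lipschitz vector fields and their smoothness. -/

section Flow

universe u

variable {V : Type u} [NormedAddCommGroup V] [NormedSpace ℝ V]

theorem eq_of_lipschitz_ode {g : V → V} {K : NNReal} (hK : LipschitzWith K g) {c d : ℝ → V}
    (hc : ∀ t, HasDerivAt c (g (c t)) t) (hd : ∀ t, HasDerivAt d (g (d t)) t) {t₀ : ℝ}
    (h : c t₀ = d t₀) : c = d :=
  ODE_solution_unique_univ (v := fun _ => g) (s := fun _ => univ) (fun _ => hK.lipschitzOnWith)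
    (fun t => ⟨hc t, mem_univ _⟩) (fun t => ⟨hd t, mem_univ _⟩) h

theorem exists_global_integral_curve [CompleteSpace V] {g : V → V} {K L : NNReal}
    (hK : LipschitzWith K g) (hL : ∀ x, ‖g x‖ ≤ L) (x : V) :
    ∃ c : ℝ → V, c 0 = x ∧ ∀ t, HasDerivAt c (g (c t)) t := by
  have hloc : ∀ a : ℝ, ∃ c : ℝ → V, 0 < a → c 0 = x ∧ ∀ t ∈ Ioo (-a) a, HasDerivAt c (g (c t)) t := by
    intro a
    by_cases ha : 0 < a
    swap
    · exact ⟨0, fun h => absurd h ha⟩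
    have h0 : (0 : ℝ) ∈ Icc (-a) a := ⟨by linarith, ha.le⟩
    -- A solution moves by at most L * a in time a, so the bound L allows an arbitrarily long
    -- interval.
    have hPL : IsPicardLindelof (fun _ => g) (tmin := -a) (tmax := a) ⟨0, h0⟩ x (L * a.toNNReal) 0 L K :=
      { lipschitzOnWith := fun _ _ => hK.lipschitzOnWith
        continuousOn := fun _ _ => continuousOn_const
        norm_le := fun _ _ _ _ => hL _
        mul_max_le := by simp [ha.le] }
    obtain ⟨c, hc0, hc⟩ := hPL.exists_eq_forall_mem_Icc_hasDerivWithinAt₀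
    exact ⟨c, fun _ => ⟨hc0, fun t ht =>
      (hc t (Ioo_subset_Icc_self ht)).hasDerivAt (Icc_mem_nhds ht.1 ht.2)⟩⟩
  choose c hc using hloc
  have huniq : ∀ a b t : ℝ, 0 < a → a ≤ b → t ∈ Ioo (-a) a → c a t = c b t := by
    intro a b t ha hab ht
    exact ODE_solution_unique_of_mem_Ioo (v := fun _ => g) (s := fun _ => univ) (t₀ := 0)
      (fun _ _ => hK.lipschitzOnWith) ⟨by linarith, ha⟩
      (fun t ht => ⟨(hc a ha).2 t ht, mem_univ _⟩)
      (fun t ht => ⟨(hc b (ha.trans_le hab)).2 t ⟨by linarith [ht.1], by linarith [ht.2]⟩,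
        mem_univ _⟩)
      (by rw [(hc a ha).1, (hc b (ha.trans_le hab)).1]) ht
  -- The solutions on (-a, a) agree on overlaps, so any a > |t| gives the same value at t.
  refine ⟨fun t => c (|t| + 1) t, by simpa using (hc (|0| + 1) (by simp)).1, fun t => ?_⟩
  have hev : (fun s => c (|s| + 1) s) =ᶠ[𝓝 t] c (|t| + 2) := by
    filter_upwards [Ioo_mem_nhds (show t - 1 < t by linarith) (show t < t + 1 by linarith)] with s hs
    have h1 : |s| ≤ |t| + 1 := by
      have : |s - t| ≤ 1 := abs_le.2 ⟨by linarith [hs.1], by linarith [hs.2]⟩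
      linarith [abs_sub_abs_le_abs_sub s t]
    exact huniq _ _ _ (by positivity) (by linarith) (abs_lt.1 (by linarith))
  have h2 := (hc (|t| + 2) (by positivity)).2 t (abs_lt.1 (by linarith))
  rw [← hev.eq_of_nhds] at h2
  exact h2.congr_of_eventuallyEq hev

/-- Integration from the left end point, as an operator on `C([0, 1], V)`. -/
noncomputable def volterra (V : Type u) [NormedAddCommGroup V] [NormedSpace ℝ V] [CompleteSpace V] :
    C(Icc (0 : ℝ) 1, V) →L[ℝ] C(Icc (0 : ℝ) 1, V) :=
  have hi : ∀ (γ : C(Icc (0 : ℝ) 1, V)) (a b : ℝ),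
      IntervalIntegrable (fun x => γ (projIcc 0 1 zero_le_one x)) MeasureTheory.volume a b :=
    fun γ a b => (γ.continuous.comp continuous_projIcc).intervalIntegrable a b
  LinearMap.mkContinuous
    { toFun := fun γ => ⟨fun s => ∫ x in (0 : ℝ)..s, γ (projIcc 0 1 zero_le_one x),
        (intervalIntegral.continuous_primitive (hi γ) 0).comp continuous_subtype_val⟩
      map_add' := fun γ δ => by
        ext s
        exact intervalIntegral.integral_add (hi γ 0 s) (hi δ 0 s)
      map_smul' := fun c γ => by
        ext s
        exact intervalIntegral.integral_smul c _ } 1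
    (fun γ => by
      rw [one_mul, ContinuousMap.norm_le _ (by positivity)]
      intro s
      refine (intervalIntegral.norm_integral_le_of_norm_le_const
        (fun x _ => γ.norm_coe_le_norm _)).trans ?_
      rw [sub_zero, abs_of_nonneg s.2.1]
      exact mul_le_of_le_one_right (norm_nonneg _) s.2.2)

theorem volterra_apply [CompleteSpace V] (γ : C(Icc (0 : ℝ) 1, V)) (s : Icc (0 : ℝ) 1) :
    volterra V γ s = ∫ x in (0 : ℝ)..s, γ (projIcc 0 1 zero_le_one x) := rfl

theorem norm_volterra_le [CompleteSpace V] : ‖volterra V‖ ≤ 1 :=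
  ContinuousLinearMap.opNorm_le_bound _ zero_le_one fun γ => by
    rw [one_mul, ContinuousMap.norm_le _ (by positivity)]
    intro s
    rw [volterra_apply]
    refine (intervalIntegral.norm_integral_le_of_norm_le_const
      (fun x _ => γ.norm_coe_le_norm _)).trans ?_
    rw [sub_zero, abs_of_nonneg s.2.1]
    exact mul_le_of_le_one_right (norm_nonneg _) s.2.2

/-- The rescaled orbit s ↦ Φ (t s) x on [0, 1] is a zero of the integral equation γ = x + t ∫ g ∘ γ,
which depends in a C^n way on (t, x, γ). For |t| K < 1 the integral term is a contraction in γ, so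
the implicit function theorem applies and its solution is the orbit. -/
theorem contDiffAt_flow_of_small [CompleteSpace V] {n : ℕ} (hn : n ≠ 0) {g : V → V}
    (hg : ContDiff ℝ n g) {K : NNReal} (hK : LipschitzWith K g) {Φ : ℝ → V → V}
    (h0 : ∀ x, Φ 0 x = x) (hΦ : ∀ x t, HasDerivAt (fun t => Φ t x) (g (Φ t x)) t)
    {t₀ : ℝ} (ht₀ : |t₀| * K < 1) (x₀ : V) :
    ContDiffAt ℝ n (fun p : ℝ × V => Φ p.1 p.2) (t₀, x₀) := by
  let G : C(V, V) := ⟨g, hg.continuous⟩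
  let N : C(Icc (0 : ℝ) 1, V) → C(Icc (0 : ℝ) 1, V) := fun γ => G.comp γ
  have hN : ContDiff ℝ n N := contDiff_postcomp n G hg
  have hNK : LipschitzWith K N := by
    refine LipschitzWith.of_dist_le_mul fun γ δ => ?_
    rw [ContinuousMap.dist_le (by positivity)]
    intro s
    exact (hK.dist_le_mul _ _).trans (by gcongr; exact ContinuousMap.dist_apply_le_dist s)
  let con : V →L[ℝ] C(Icc (0 : ℝ) 1, V) := ContinuousLinearMap.const ℝ (Icc (0 : ℝ) 1)
  let F : (ℝ × V) × C(Icc (0 : ℝ) 1, V) → C(Icc (0 : ℝ) 1, V) := fun q => q.2 - con q.1.2 - q.1.1 • volterra V (N q.2)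
  have hF : ContDiff ℝ n F := by
    have h1 : ContDiff ℝ n (fun q : (ℝ × V) × C(Icc (0 : ℝ) 1, V) => con q.1.2) :=
      con.contDiff.comp (contDiff_snd.comp contDiff_fst)
    have h2 : ContDiff ℝ n (fun q : (ℝ × V) × C(Icc (0 : ℝ) 1, V) => volterra V (N q.2)) :=
      (volterra V).contDiff.comp (hN.comp contDiff_snd)
    exact (contDiff_snd.sub h1).sub ((contDiff_fst.comp contDiff_fst).smul h2)
  have hcont : ∀ x, Continuous fun t => Φ t x := fun x =>
    continuous_iff_continuousAt.2 fun t => (hΦ x t).continuousAt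
  let S : ℝ × V → C(Icc (0 : ℝ) 1, V) := fun p => ⟨fun s => Φ (p.1 * s) p.2, by
    exact (hcont p.2).comp (by fun_prop)⟩
  have hS : ∀ p, F (p, S p) = 0 := by
    intro p
    ext s
    have hder : ∀ r ∈ uIcc (0 : ℝ) s, HasDerivAt (fun r => Φ (p.1 * r) p.2)
        (p.1 • g (Φ (p.1 * r) p.2)) r := by
      intro r _
      have := (hΦ p.2 (p.1 * r)).scomp r ((hasDerivAt_id r).const_mul p.1)
      simpa [Function.comp_def] using this
    have hint := intervalIntegral.integral_eq_sub_of_hasDerivAt hder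
      (((hg.continuous.comp ((hcont p.2).comp (by fun_prop))).const_smul p.1).intervalIntegrable _ _)
    have h3 : volterra V (N (S p)) s = ∫ r in (0 : ℝ)..s, g (Φ (p.1 * r) p.2) := by
      rw [volterra_apply]
      refine intervalIntegral.integral_congr fun r hr => ?_
      rw [uIcc_of_le s.2.1] at hr
      simp only [N, S, G, ContinuousMap.comp_apply, ContinuousMap.coe_mk]
      rw [projIcc_of_mem zero_le_one ⟨hr.1, hr.2.trans s.2.2⟩]
    rw [intervalIntegral.integral_smul] at hint
    rw [mul_zero, h0] at hint
    change Φ (p.1 * s) p.2 - p.2 - p.1 • volterra V (N (S p)) s = 0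
    rw [h3, hint, sub_self]
  have huniq : ∀ (p : ℝ × V) (γ δ : C(Icc (0 : ℝ) 1, V)), |p.1| * K < 1 → F (p, γ) = 0 → F (p, δ) = 0 → γ = δ := by
    intro p γ δ hp hγ hδ
    have h1 : γ - δ = p.1 • volterra V (N γ - N δ) := by
      have : F (p, γ) - F (p, δ) = γ - δ - p.1 • volterra V (N γ - N δ) := by
        simp only [F, map_sub, smul_sub]; abel
      rw [hγ, hδ, sub_zero] at this
      exact (sub_eq_zero.1 this.symm)
    have h2 : ‖γ - δ‖ ≤ |p.1| * K * ‖γ - δ‖ := by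
      calc ‖γ - δ‖ = |p.1| * ‖volterra V (N γ - N δ)‖ := by
            conv_lhs => rw [h1]
            rw [norm_smul, Real.norm_eq_abs]
        _ ≤ |p.1| * (1 * (K * ‖γ - δ‖)) := by
            gcongr
            refine (volterra V).le_of_opNorm_le_of_le norm_volterra_le ?_
            simpa only [dist_eq_norm] using hNK.dist_le_mul γ δ
        _ = |p.1| * K * ‖γ - δ‖ := by ring
    have h3 : ‖γ - δ‖ = 0 := by
      by_contra hne
      have : 0 < ‖γ - δ‖ := lt_of_le_of_ne (norm_nonneg _) (Ne.symm hne)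
      nlinarith
    exact sub_eq_zero.1 (norm_eq_zero.1 h3)
  let u : (ℝ × V) × C(Icc (0 : ℝ) 1, V) := ((t₀, x₀), S (t₀, x₀))
  have hFu : ContDiffAt ℝ n F u := hF.contDiffAt
  have hn' : (n : WithTop ℕ∞) ≠ 0 := by exact_mod_cast hn
  let A : C(Icc (0 : ℝ) 1, V) →L[ℝ] C(Icc (0 : ℝ) 1, V) := fderiv ℝ (fun γ => t₀ • volterra V (N γ)) u.2
  have hA : ‖A‖ < 1 := by
    have hlip : LipschitzWith (‖t₀‖₊ * (1 * K)) (fun γ => t₀ • volterra V (N γ)) :=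
      (lipschitzWith_smul t₀).comp
        (((volterra V).lipschitz.weaken norm_volterra_le).comp hNK)
    refine (norm_fderiv_le_of_lipschitz ℝ hlip).trans_lt ?_
    simpa using ht₀
  have hder : fderiv ℝ F u ∘L .inr ℝ (ℝ × V) C(Icc (0 : ℝ) 1, V) = 1 - A := by
    have h1 : HasFDerivAt (fun γ : C(Icc (0 : ℝ) 1, V) => F ((t₀, x₀), γ)) (fderiv ℝ F u ∘L .inr ℝ (ℝ × V) C(Icc (0 : ℝ) 1, V)) u.2 :=
      HasFDerivAt.comp (g := F) u.2 ((hF.differentiable hn').differentiableAt.hasFDerivAt)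
        (hasFDerivAt_prodMk_right _ _)
    have h2 : HasFDerivAt (fun γ : C(Icc (0 : ℝ) 1, V) => F ((t₀, x₀), γ)) (1 - A) u.2 := by
      have hd : DifferentiableAt ℝ (fun γ => t₀ • volterra V (N γ)) u.2 :=
        ((((volterra V).contDiff.comp hN).const_smul t₀).differentiable hn').differentiableAt
      exact ((hasFDerivAt_id u.2).sub_const (con x₀)).sub hd.hasFDerivAt
    exact h1.unique h2
  have hinv : (fderiv ℝ F u ∘L .inr ℝ (ℝ × V) C(Icc (0 : ℝ) 1, V)).IsInvertible := by
    rw [hder]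
    exact ⟨ContinuousLinearEquiv.unitsEquiv ℝ C(Icc (0 : ℝ) 1, V) (Units.oneSub A hA), rfl⟩
  have hev := hFu.eventually_apply_implicitFunction hn' hinv
  have hsm : ∀ᶠ p : ℝ × V in 𝓝 (t₀, x₀), |p.1| * (K : ℝ) < 1 :=
    (show Continuous fun p : ℝ × V => |p.1| * (K : ℝ) by fun_prop).continuousAt.eventually_lt
      continuousAt_const ht₀
  -- Continuity of `S` in p is not known beforehand; global uniqueness of zeros for |p.1| K < 1
  -- replaces it.
  have heq : S =ᶠ[𝓝 (t₀, x₀)] hFu.implicitFunction hn' hinv := by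
    filter_upwards [hev, hsm] with p hp hp'
    exact huniq p _ _ hp' (hS p) (hp.trans (hS _))
  have hSc : ContDiffAt ℝ n S (t₀, x₀) :=
    (hFu.contDiffAt_implicitFunction hn' hinv).congr_of_eventuallyEq heq
  have := (ContinuousMap.evalCLM ℝ (⟨1, zero_le_one, le_rfl⟩ : Icc (0 : ℝ) 1)).contDiff.contDiffAt.comp
    (t₀, x₀) hSc
  refine this.congr_of_eventuallyEq (Filter.Eventually.of_forall fun p => ?_)
  simp [S]

/-- A bounded Lipschitz vector field of class `C^n` has a global flow of class `C^n`. -/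
theorem exists_contDiff_flow [CompleteSpace V] {n : ℕ} (hn : n ≠ 0) {g : V → V}
    (hg : ContDiff ℝ n g) {K L : NNReal} (hK : LipschitzWith K g) (hL : ∀ x, ‖g x‖ ≤ L) :
    ∃ Φ : ℝ → V → V, ContDiff ℝ n (fun p : ℝ × V => Φ p.1 p.2) ∧ (∀ x, Φ 0 x = x) ∧
      ∀ x t, HasDerivAt (fun t => Φ t x) (g (Φ t x)) t := by
  choose Φ' h0 hΦ using exists_global_integral_curve hK hL
  let Φ : ℝ → V → V := fun t x => Φ' x t
  have hadd : ∀ s t x, Φ (s + t) x = Φ s (Φ t x) := by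
    intro s t x
    have h1 : ∀ s, HasDerivAt (fun s => Φ (s + t) x) (g (Φ (s + t) x)) s := fun s =>
      (hΦ x (s + t)).comp_add_const s t
    have := eq_of_lipschitz_ode hK h1 (hΦ (Φ t x)) (t₀ := 0) (by simp [Φ, h0])
    exact congrFun this s
  have hiter : ∀ (m : ℕ) (t : ℝ) (x : V), Φ (m * t) x = (Φ t)^[m] x := by
    intro m t
    induction m with
    | zero => intro x; simp [Φ, h0]
    | succ m ih =>
      intro x
      rw [Function.iterate_succ_apply, ← ih, ← hadd]
      congr 1; push_cast; ring
  refine ⟨Φ, contDiff_iff_contDiffAt.2 ?_, h0, hΦ⟩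
  rintro ⟨t₀, x₀⟩
  obtain ⟨m, hm⟩ := exists_nat_gt (|t₀| * K)
  have hm0 : (0 : ℝ) < m := lt_of_le_of_lt (by positivity) hm
  -- By the group law, time t is m steps of time t / m, each short enough. The time is kept as a
  -- first component so that the steps compose.
  have hcomp : ∀ j : ℕ, ContDiffAt ℝ n (fun p : ℝ × V => (p.1, (Φ (p.1 / m))^[j] p.2)) (t₀, x₀) := by
    intro j
    induction j with
    | zero => exact contDiffAt_id
    | succ j ih =>
      have h1 : ContDiffAt ℝ n (fun p : ℝ × V => Φ p.1 p.2) (t₀ / m, (Φ (t₀ / m))^[j] x₀) := by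
        refine contDiffAt_flow_of_small hn hg hK h0 hΦ ?_ _
        rw [abs_div, abs_of_pos hm0, div_mul_eq_mul_div, div_lt_one hm0]
        exact hm
      have h2 : ContDiffAt ℝ n (fun p : ℝ × V => (p.1 / m, (Φ (p.1 / m))^[j] p.2)) (t₀, x₀) :=
        (contDiffAt_fst.div_const _).prodMk (contDiffAt_snd.comp (t₀, x₀) ih)
      simp only [Function.iterate_succ_apply']
      exact contDiffAt_fst.prodMk
        (ContDiffAt.comp (g := fun p : ℝ × V => Φ p.1 p.2) (t₀, x₀) h1 h2)
  refine (contDiffAt_snd.comp (t₀, x₀) (hcomp m)).congr_of_eventuallyEq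
    (Filter.Eventually.of_forall fun p => ?_)
  simp only [Function.comp_apply]
  rw [← hiter, mul_div_cancel₀ _ hm0.ne']

end Flow

end LCS

namespace LCS

/-! ### Extension of functions on [0, 1] × O past the end points of the interval. -/

section Extension

universe u

/-- Lagrange interpolation at the m + 1 nodes -1 / (j + 1) is exact on X ^ k for k ≤ m; evaluation
at 1 gives these moment conditions. They make the t-derivatives of the weighted reflections match at
t = 0 up to order m. -/
theorem exists_reflection_weights (m : ℕ) : ∃ a : Fin (m + 1) → ℝ, ∀ k ≤ m,
    ∑ j, a j * (-(1 / ((j : ℝ) + 1))) ^ k = 1 := by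
  let μ : Fin (m + 1) → ℝ := fun j => -(1 / ((j : ℝ) + 1))
  have hμ : Function.Injective μ := by
    intro i j hij
    have h1 : (i : ℝ) + 1 = j + 1 := by
      have := neg_injective hij
      simpa using this
    exact Fin.ext (by exact_mod_cast add_right_cancel h1)
  refine ⟨fun j => (Lagrange.basis Finset.univ μ j).eval 1, fun k hk => ?_⟩
  have h := Lagrange.eq_interpolate (s := Finset.univ) (v := μ) (f := Polynomial.X ^ k)
    hμ.injOn (by
      rw [Polynomial.degree_X_pow, Finset.card_univ, Fintype.card_fin]
      exact_mod_cast Nat.lt_succ_of_le hk)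
  have h2 := congrArg (Polynomial.eval 1) h
  rw [Lagrange.interpolate_apply, Polynomial.eval_finsetSum] at h2
  simp only [Polynomial.eval_pow, Polynomial.eval_X, one_pow, Polynomial.eval_mul,
    Polynomial.eval_C] at h2
  exact (Finset.sum_congr rfl fun j _ => mul_comm _ _).trans h2.symm

open Classical in
/-- Extension of a function of `(t, x)`, `t ≥ 0`, to negative `t` by a weighted sum of
reflections. -/
noncomputable def reflect {E W : Type*} [NormedAddCommGroup W] [NormedSpace ℝ W] {m : ℕ}
    (a : Fin m → ℝ) (F : ℝ × E → W) (p : ℝ × E) : W :=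
  if 0 ≤ p.1 then F p else ∑ j, a j • F (-(1 / ((j : ℝ) + 1)) * p.1, p.2)

theorem reflect_of_nonneg {E W : Type*} [NormedAddCommGroup W] [NormedSpace ℝ W] {m : ℕ}
    (a : Fin m → ℝ) (F : ℝ × E → W) {p : ℝ × E} (hp : 0 ≤ p.1) : reflect a F p = F p := if_pos hp

theorem reflect_of_nonpos {E W : Type*} [NormedAddCommGroup W] [NormedSpace ℝ W] {m : ℕ}
    {a : Fin m → ℝ} (ha : ∑ j, a j = 1) (F : ℝ × E → W) {p : ℝ × E} (hp : p.1 ≤ 0) :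
    reflect a F p = ∑ j, a j • F (-(1 / ((j : ℝ) + 1)) * p.1, p.2) := by
  by_cases h : 0 ≤ p.1
  · obtain ⟨t, x⟩ := p
    obtain rfl : t = 0 := le_antisymm hp h
    rw [reflect_of_nonneg a F h]
    simp only [mul_zero, ← Finset.sum_smul, ha, one_smul]
  · exact if_neg h

variable {E : Type u} [NormedAddCommGroup E] [NormedSpace ℝ E]

/-- Induction on m. The x-derivative of the extension is the extension of the x-derivative with the
same weights. The t-derivative produces a factor -1 / (j + 1), hence the weights `a'`, whose k-th
moment is the (k + 1)-st moment of a; one condition is used up at each order. -/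
theorem contDiffOn_reflect {O : Set E} (hO : IsOpen O) {N : ℕ} (m : ℕ) :
    ∀ {W : Type u} [NormedAddCommGroup W] [NormedSpace ℝ W] (a : Fin N → ℝ) (F : ℝ × E → W),
      ContDiffOn ℝ ∞ F (Icc (0 : ℝ) 1 ×ˢ O) →
      (∀ k ≤ m, ∑ j, a j * (-(1 / ((j : ℝ) + 1))) ^ k = 1) →
      ContDiffOn ℝ m (reflect a F) (Ioo (-1 : ℝ) 1 ×ˢ O) := by
  have hQ : IsOpen (Ioo (-1 : ℝ) 1 ×ˢ O) := isOpen_Ioo.prod hO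
  have hμ : ∀ (j : Fin N) (t : ℝ), t ∈ Ioo (-1 : ℝ) 1 → t ≤ 0 →
      -(1 / ((j : ℝ) + 1)) * t ∈ Icc (0 : ℝ) 1 := by
    intro j t ht ht0
    have h1 : 0 < 1 / ((j : ℝ) + 1) := by positivity
    have h2 : 1 / ((j : ℝ) + 1) ≤ 1 := by
      rw [div_le_one (by positivity)]; linarith [(Nat.cast_nonneg (j : ℕ) : (0 : ℝ) ≤ (j : ℕ))]
    constructor <;> nlinarith [ht.1]
  have hpos : ∀ p ∈ Ioo (-1 : ℝ) 1 ×ˢ O, 0 ≤ p.1 →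
      Icc (0 : ℝ) 1 ×ˢ O ∈ 𝓝[{q : ℝ × E | 0 ≤ q.1}] p := by
    intro p hp h0
    filter_upwards [self_mem_nhdsWithin, mem_nhdsWithin_of_mem_nhds (hQ.mem_nhds hp)] with q h1 h2
    exact ⟨⟨h1, h2.1.2.le⟩, h2.2⟩
  have hclosed0 : IsClosed {q : ℝ × E | 0 ≤ q.1} := isClosed_le continuous_const continuous_fst
  have hclosed1 : IsClosed {q : ℝ × E | q.1 ≤ 0} := isClosed_le continuous_fst continuous_const
  have hunion : {q : ℝ × E | 0 ≤ q.1} ∪ {q : ℝ × E | q.1 ≤ 0} = univ := by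
    ext q; simpa using le_total _ _
  induction m with
  | zero =>
    intro W _ _ a F hF ha
    have ha0 : ∑ j, a j = 1 := by simpa using ha 0 le_rfl
    rw [Nat.cast_zero, contDiffOn_zero]
    intro p hp
    apply ContinuousAt.continuousWithinAt
    rw [← continuousWithinAt_univ, ← hunion]
    refine ContinuousWithinAt.union ?_ ?_
    · by_cases h0 : 0 ≤ p.1
      · have h1 : ContinuousWithinAt F {q : ℝ × E | 0 ≤ q.1} p :=
          (hF.continuousOn p ⟨⟨h0, hp.1.2.le⟩, hp.2⟩).mono_of_mem_nhdsWithin (hpos p hp h0)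
        exact h1.congr (fun q hq => reflect_of_nonneg a F hq) (reflect_of_nonneg a F h0)
      · exact continuousWithinAt_of_notMem_closure (by rwa [hclosed0.closure_eq])
    · by_cases h0 : p.1 ≤ 0
      · have h1 : ContinuousWithinAt
            (fun p : ℝ × E => ∑ j, a j • F (-(1 / ((j : ℝ) + 1)) * p.1, p.2))
            {q : ℝ × E | q.1 ≤ 0} p := by
          refine tendsto_finsetSum _ fun j _ => ContinuousWithinAt.const_smul ?_ _
          refine ContinuousWithinAt.comp_of_preimage_mem_nhdsWithin
            (f := fun p : ℝ × E => (-(1 / ((j : ℝ) + 1)) * p.1, p.2))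
            (hF.continuousOn _ ⟨hμ j p.1 hp.1 h0, hp.2⟩)
            (Continuous.continuousWithinAt (by fun_prop)) ?_
          filter_upwards [self_mem_nhdsWithin, mem_nhdsWithin_of_mem_nhds (hQ.mem_nhds hp)]
            with q h1 h2
          exact ⟨hμ j q.1 h2.1 h1, h2.2⟩
        exact h1.congr (fun q hq => reflect_of_nonpos ha0 F hq) (reflect_of_nonpos ha0 F h0)
      · exact continuousWithinAt_of_notMem_closure (by rwa [hclosed1.closure_eq])
  | succ m ih =>
    intro W _ _ a F hF ha
    have ha0 : ∑ j, a j = 1 := by simpa using ha 0 (Nat.zero_le _)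
    have ha1 : ∑ j, a j * (-(1 / ((j : ℝ) + 1))) = 1 := by
      simpa using ha 1 (Nat.succ_le_succ (Nat.zero_le _))
    let D := Icc (0 : ℝ) 1 ×ˢ O
    have hD : UniqueDiffOn ℝ D := (uniqueDiffOn_Icc zero_lt_one).prod hO.uniqueDiffOn
    let F' : ℝ × E → ℝ × E →L[ℝ] W := fderivWithin ℝ F D
    have hF' : ContDiffOn ℝ ∞ F' D := hF.fderivWithin hD (by simp)
    have hFd : ∀ p ∈ D, HasFDerivWithinAt F (F' p) D p := fun p hp =>
      ((hF p hp).differentiableWithinAt (by simp)).hasFDerivWithinAt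
    let Ft : ℝ × E → W := fun p => F' p (1, 0)
    let Fx : ℝ × E → E →L[ℝ] W := fun p => F' p ∘L .inr ℝ ℝ E
    have hFt : ContDiffOn ℝ ∞ Ft D := hF'.clm_apply contDiffOn_const
    have hFx : ContDiffOn ℝ ∞ Fx D := hF'.clm_comp contDiffOn_const
    let a' : Fin N → ℝ := fun j => a j * (-(1 / ((j : ℝ) + 1)))
    have hs1 := ih a' Ft hFt fun k hk => by
      refine (Finset.sum_congr rfl fun j _ => ?_).trans (ha (k + 1) (Nat.succ_le_succ hk))
      simp only [a']; ring
    have hs2 := ih a Fx hFx fun k hk => ha k (hk.trans (Nat.le_succ _))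
    let G : ℝ × E → ℝ × E →L[ℝ] W := fun p =>
      (ContinuousLinearMap.fst ℝ ℝ E).smulRight (reflect a' Ft p) +
        (reflect a Fx p) ∘L ContinuousLinearMap.snd ℝ ℝ E
    have hG : ContDiffOn ℝ m G (Ioo (-1 : ℝ) 1 ×ˢ O) :=
      (contDiffOn_const.smulRight hs1).add (hs2.clm_comp contDiffOn_const)
    have hder : ∀ p ∈ Ioo (-1 : ℝ) 1 ×ˢ O, HasFDerivAt (reflect a F) (G p) p := by
      intro p hp
      -- The same candidate `G p` is shown to be a derivative on each of the closed half spaces t ≥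
      -- 0 and t ≤ 0; at t = 0 both apply.
      rw [← hasFDerivWithinAt_univ, ← hunion]
      refine HasFDerivWithinAt.union ?_ ?_
      · by_cases h0 : 0 ≤ p.1
        · have hGp : G p = F' p := by
            ext v
            · simp only [G, reflect_of_nonneg _ _ h0]
              simp [Ft, Fx, Prod.mk_zero_zero]
            · simp only [G, reflect_of_nonneg _ _ h0]; simp [Fx]
          have h1 : HasFDerivWithinAt F (F' p) {q : ℝ × E | 0 ≤ q.1} p :=
            (hFd p ⟨⟨h0, hp.1.2.le⟩, hp.2⟩).mono_of_mem_nhdsWithin (hpos p hp h0)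
          rw [hGp]
          exact h1.congr (fun q hq => reflect_of_nonneg a F hq) (reflect_of_nonneg a F h0)
        · exact HasFDerivWithinAt.of_notMem_closure (by rwa [hclosed0.closure_eq])
      · by_cases h0 : p.1 ≤ 0
        · let B : Fin N → ℝ × E →L[ℝ] ℝ × E := fun j =>
            ((-(1 / ((j : ℝ) + 1))) • ContinuousLinearMap.fst ℝ ℝ E).prod
              (ContinuousLinearMap.snd ℝ ℝ E)
          have hB : ∀ j q, B j q = (-(1 / ((j : ℝ) + 1)) * q.1, q.2) := fun j q => rfl
          have h1 : HasFDerivWithinAt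
              (fun p : ℝ × E => ∑ j, a j • F (-(1 / ((j : ℝ) + 1)) * p.1, p.2))
              (∑ j, a j • (F' (B j p) ∘L B j)) {q : ℝ × E | q.1 ≤ 0} p := by
            refine HasFDerivWithinAt.fun_sum fun j _ => HasFDerivWithinAt.const_smul ?_ _
            have h2 : HasFDerivWithinAt F (F' (B j p)) D (B j p) :=
              hFd _ ⟨hμ j p.1 hp.1 h0, hp.2⟩
            have h3 : HasFDerivWithinAt (B j) (B j) ({q : ℝ × E | q.1 ≤ 0} ∩ Ioo (-1 : ℝ) 1 ×ˢ O) p :=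
              (B j).hasFDerivWithinAt
            have h4 := h2.comp p h3 fun q hq => ⟨hμ j q.1 hq.2.1 hq.1, hq.2.2⟩
            exact h4.mono_of_mem_nhdsWithin (Filter.inter_mem self_mem_nhdsWithin
              (mem_nhdsWithin_of_mem_nhds (hQ.mem_nhds hp)))
          have hGp : G p = ∑ j, a j • (F' (B j p) ∘L B j) := by
            have e1 : reflect a' Ft p = ∑ j, a' j • Ft (B j p) :=
              reflect_of_nonpos ha1 Ft h0
            have e2 : reflect a Fx p = ∑ j, a j • Fx (B j p) := reflect_of_nonpos ha0 Fx h0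
            have e3 : ∀ j, B j (1, 0) = (-(1 / ((j : ℝ) + 1))) • ((1, 0) : ℝ × E) := fun j => by
              rw [hB]; simp
            ext v
            · simp only [G, e1, e2]
              simp only [Ft, Fx, a', ContinuousLinearMap.comp_apply, add_apply,
                ContinuousLinearMap.inl_apply, sum_apply, e3,
                smul_apply, map_smul, mul_smul]
              simp [Prod.mk_zero_zero]
            · simp only [G, e1, e2]
              simp [Fx, hB]
          rw [hGp]
          exact h1.congr (fun q hq => reflect_of_nonpos ha0 F hq) (reflect_of_nonpos ha0 F h0)
        · exact HasFDerivWithinAt.of_notMem_closure (by rwa [hclosed1.closure_eq])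
    have hfin := (contDiffOn_succ_iff_hasFDerivWithinAt_of_uniqueDiffOn (𝕜 := ℝ) (n := (m : WithTop ℕ∞))
      (f := reflect a F) hQ.uniqueDiffOn).2 ⟨by simp, G, hG, fun p hp => (hder p hp).hasFDerivWithinAt⟩
    exact_mod_cast hfin

/-- Away from t = 1, reflection in t = 0 suffices; at t = 1 it is conjugated by t ↦ 1 - t. -/
theorem exists_local_contDiff_extension {W : Type u} [NormedAddCommGroup W] [NormedSpace ℝ W]
    {O : Set E} (hO : IsOpen O) {F : ℝ × E → W} (hF : ContDiffOn ℝ ∞ F (Icc (0 : ℝ) 1 ×ˢ O))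
    (m : ℕ) {p : ℝ × E} (hp : p ∈ Icc (0 : ℝ) 1 ×ˢ O) :
    ∃ U ∈ 𝓝 p, ∃ G : ℝ × E → W, ContDiffOn ℝ m G U ∧ ∀ q ∈ U, q.1 ∈ Icc (0 : ℝ) 1 → G q = F q := by
  obtain ⟨a, ha⟩ := exists_reflection_weights m
  rcases lt_or_ge p.1 1 with h1 | h1
  · refine ⟨Ioo (-1 : ℝ) 1 ×ˢ O, (isOpen_Ioo.prod hO).mem_nhds ⟨⟨by linarith [hp.1.1], h1⟩, hp.2⟩,
      reflect a F, contDiffOn_reflect hO m a F hF ha, fun q _ hq => reflect_of_nonneg a F hq.1⟩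
  · let R : ℝ × E → ℝ × E := fun q => (1 - q.1, q.2)
    have hR : ContDiff ℝ ∞ R := (contDiff_const.sub contDiff_fst).prodMk contDiff_snd
    have hFR : ContDiffOn ℝ ∞ (F ∘ R) (Icc (0 : ℝ) 1 ×ˢ O) :=
      hF.comp hR.contDiffOn fun q hq => ⟨⟨by simp [R, hq.1.2], by simp [R, hq.1.1]⟩, hq.2⟩
    refine ⟨Ioo (0 : ℝ) 2 ×ˢ O, (isOpen_Ioo.prod hO).mem_nhds
      ⟨⟨by linarith, by linarith [hp.1.2]⟩, hp.2⟩, reflect a (F ∘ R) ∘ R, ?_, fun q _ hq => ?_⟩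
    · refine (contDiffOn_reflect hO m a (F ∘ R) hFR ha).comp (hR.of_le (by exact_mod_cast le_top)).contDiffOn fun q hq => ⟨?_, hq.2⟩
      constructor <;> simp only [R] <;> linarith [hq.1.1, hq.1.2]
    · have h2 : 0 ≤ (R q).1 := by simp [R, hq.2]
      rw [Function.comp_apply, reflect_of_nonneg _ _ h2]
      simp [R]

/-- A function that is smooth on `[0, 1] × O` agrees on `[0, 1] × C`, with `C ⊆ O` closed, with a
function of class `C^m` on the whole space. -/
theorem exists_contDiff_extension [FiniteDimensional ℝ E] {W : Type u} [NormedAddCommGroup W]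
    [NormedSpace ℝ W] {O C : Set E} (hO : IsOpen O) (hC : IsClosed C) (hCO : C ⊆ O)
    {F : ℝ × E → W} (hF : ContDiffOn ℝ ∞ F (Icc (0 : ℝ) 1 ×ˢ O)) (m : ℕ) :
    ∃ G : ℝ × E → W, ContDiff ℝ m G ∧ ∀ q ∈ Icc (0 : ℝ) 1 ×ˢ C, G q = F q := by
  -- The values allowed at each point form a convex set, so a partition of unity glues local
  -- extensions.
  let t : ℝ × E → Set W := fun q => {y | q ∈ Icc (0 : ℝ) 1 ×ˢ C → y = F q}
  have ht : ∀ q, Convex ℝ (t q) := by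
    intro q y hy z hz a b _ _ hab hq
    rw [hy hq, hz hq, ← add_smul, hab, one_smul]
  obtain ⟨g, hg⟩ := exists_contMDiffMap_forall_mem_convex_of_local (n := (m : ℕ∞))
    𝓘(ℝ, ℝ × E) ht fun q => by
      by_cases hq : q ∈ Icc (0 : ℝ) 1 ×ˢ C
      · obtain ⟨U, hU, G, hG, hGF⟩ := exists_local_contDiff_extension hO hF m ⟨hq.1, hCO hq.2⟩
        exact ⟨U, hU, G, hG.contMDiffOn, fun r hr hrC => hGF r hr hrC.1⟩
      · exact ⟨(Icc (0 : ℝ) 1 ×ˢ C)ᶜ, (isClosed_Icc.prod hC).isOpen_compl.mem_nhds hq, 0,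
          contMDiffOn_const, fun r hr hrC => absurd hrC hr⟩
  exact ⟨g, g.contMDiff.contDiff, fun q hq => hg q hq⟩

end Extension

end LCS

namespace LCS

/-! ### Derivatives of charts, and an embedding adapted to charts. -/

section Charts

universe u

variable {E : Type u} [NormedAddCommGroup E] [NormedSpace ℝ E]
variable {M : Type*} [TopologicalSpace M] [ChartedSpace E M]

/-- The derivative of the preferred chart around `c`, read as an operator of the model space. -/
noncomputable def chartD (c x : M) : E →L[ℝ] E :=
  mfderiv 𝓘(ℝ, E) 𝓘(ℝ, E) (extChartAt 𝓘(ℝ, E) c) x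

/-- The derivative of the inverse of the preferred chart around `c`. -/
noncomputable def chartSymmD (c : M) (y : E) : E →L[ℝ] E :=
  mfderiv 𝓘(ℝ, E) 𝓘(ℝ, E) (extChartAt 𝓘(ℝ, E) c).symm y

/-- The coordinate expression of a time-dependent vector field. -/
noncomputable def chartVec (c : M) (X : ℝ → M → E) (p : ℝ × E) : E :=
  chartD c ((extChartAt 𝓘(ℝ, E) c).symm p.2) (X p.1 ((extChartAt 𝓘(ℝ, E) c).symm p.2))

/-- The derivative of a vector-valued function on a manifold. -/
noncomputable def dFun {W : Type*} [NormedAddCommGroup W] [NormedSpace ℝ W] (f : M → W) (x : M) :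
    E →L[ℝ] W := mfderiv 𝓘(ℝ, E) 𝓘(ℝ, W) f x

variable [IsManifold 𝓘(ℝ, E) ∞ M]

theorem contMDiffOn_chart' (c : M) : ContMDiffOn 𝓘(ℝ, E) 𝓘(ℝ, E) ∞ (extChartAt 𝓘(ℝ, E) c)
    (extChartAt 𝓘(ℝ, E) c).source := by
  rw [extChartAt_source]; exact contMDiffOn_extChartAt

theorem contMDiffAt_chart {c x : M} (hx : x ∈ (extChartAt 𝓘(ℝ, E) c).source) :
    ContMDiffAt 𝓘(ℝ, E) 𝓘(ℝ, E) ∞ (extChartAt 𝓘(ℝ, E) c) x :=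
  (contMDiffOn_chart' c).contMDiffAt ((isOpen_extChartAt_source c).mem_nhds hx)

theorem contMDiffAt_chart_symm {c : M} {y : E} (hy : y ∈ (extChartAt 𝓘(ℝ, E) c).target) :
    ContMDiffAt 𝓘(ℝ, E) 𝓘(ℝ, E) ∞ (extChartAt 𝓘(ℝ, E) c).symm y :=
  (contMDiffOn_extChartAt_symm c).contMDiffAt ((isOpen_extChartAt_target c).mem_nhds hy)

theorem hasMFDerivAt_chart {c x : M} (hx : x ∈ (extChartAt 𝓘(ℝ, E) c).source) :
    HasMFDerivAt 𝓘(ℝ, E) 𝓘(ℝ, E) (extChartAt 𝓘(ℝ, E) c) x (chartD (E := E) c x) :=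
  ((contMDiffAt_chart hx).mdifferentiableAt (by simp)).hasMFDerivAt

theorem hasMFDerivAt_chart_symm {c : M} {y : E} (hy : y ∈ (extChartAt 𝓘(ℝ, E) c).target) :
    HasMFDerivAt 𝓘(ℝ, E) 𝓘(ℝ, E) (extChartAt 𝓘(ℝ, E) c).symm y (chartSymmD (E := E) c y) :=
  ((contMDiffAt_chart_symm hy).mdifferentiableAt (by simp)).hasMFDerivAt

theorem chartD_comp_chartSymmD {c : M} {y : E} (hy : y ∈ (extChartAt 𝓘(ℝ, E) c).target) :
    chartD c ((extChartAt 𝓘(ℝ, E) c).symm y) ∘L chartSymmD c y = .id ℝ E := by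
  have h1 := (hasMFDerivAt_chart ((extChartAt 𝓘(ℝ, E) c).map_target hy)).comp y
    (hasMFDerivAt_chart_symm hy)
  have h2 : HasMFDerivAt 𝓘(ℝ, E) 𝓘(ℝ, E) (id : E → E) y (.id ℝ E) := hasMFDerivAt_id y
  refine hasMFDerivAt_unique (h1.congr_of_eventuallyEq ?_) h2
  filter_upwards [(isOpen_extChartAt_target c).mem_nhds hy] with z hz
  exact ((extChartAt 𝓘(ℝ, E) c).right_inv hz).symm

theorem chartSymmD_comp_chartD {c x : M} (hx : x ∈ (extChartAt 𝓘(ℝ, E) c).source) :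
    chartSymmD c (extChartAt 𝓘(ℝ, E) c x) ∘L chartD c x = .id ℝ E := by
  have h1 := (hasMFDerivAt_chart_symm ((extChartAt 𝓘(ℝ, E) c).map_source hx)).comp x
    (hasMFDerivAt_chart hx)
  have h2 : HasMFDerivAt 𝓘(ℝ, E) 𝓘(ℝ, E) (id : M → M) x (.id ℝ E) := hasMFDerivAt_id x
  refine hasMFDerivAt_unique (h1.congr_of_eventuallyEq ?_) h2
  filter_upwards [(isOpen_extChartAt_source c).mem_nhds hx] with z hz
  exact ((extChartAt 𝓘(ℝ, E) c).left_inv hz).symm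

theorem chartD_chartSymmD {c : M} {y : E} (hy : y ∈ (extChartAt 𝓘(ℝ, E) c).target) (v : E) :
    chartD c ((extChartAt 𝓘(ℝ, E) c).symm y) (chartSymmD c y v) = v :=
  DFunLike.congr_fun (chartD_comp_chartSymmD hy) v

theorem chartSymmD_chartD {c x : M} (hx : x ∈ (extChartAt 𝓘(ℝ, E) c).source) (v : E) :
    chartSymmD c (extChartAt 𝓘(ℝ, E) c x) (chartD c x v) = v :=
  DFunLike.congr_fun (chartSymmD_comp_chartD hx) v

theorem chartSymmD_chartVec {c : M} (X : ℝ → M → E) {p : ℝ × E}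
    (hp : p.2 ∈ (extChartAt 𝓘(ℝ, E) c).target) :
    chartSymmD c p.2 (chartVec c X p) = X p.1 ((extChartAt 𝓘(ℝ, E) c).symm p.2) := by
  have := chartSymmD_chartD ((extChartAt 𝓘(ℝ, E) c).map_target hp)
    (X p.1 ((extChartAt 𝓘(ℝ, E) c).symm p.2))
  rwa [(extChartAt 𝓘(ℝ, E) c).right_inv hp] at this

variable {W : Type*} [NormedAddCommGroup W] [NormedSpace ℝ W]

theorem contDiffOn_comp_chart_symm {f : M → W} (hf : ContMDiff 𝓘(ℝ, E) 𝓘(ℝ, W) ∞ f) (c : M) :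
    ContDiffOn ℝ ∞ (f ∘ (extChartAt 𝓘(ℝ, E) c).symm) (extChartAt 𝓘(ℝ, E) c).target :=
  (hf.comp_contMDiffOn (contMDiffOn_extChartAt_symm c)).contDiffOn

theorem hasFDerivAt_comp_chart_symm {f : M → W} {c : M} {y : E}
    (hy : y ∈ (extChartAt 𝓘(ℝ, E) c).target)
    (hf : MDifferentiableAt 𝓘(ℝ, E) 𝓘(ℝ, W) f ((extChartAt 𝓘(ℝ, E) c).symm y)) :
    HasFDerivAt (f ∘ (extChartAt 𝓘(ℝ, E) c).symm)
      (dFun f ((extChartAt 𝓘(ℝ, E) c).symm y) ∘L chartSymmD c y) y :=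
  (hf.hasMFDerivAt.comp y (hasMFDerivAt_chart_symm hy)).hasFDerivAt

variable [FiniteDimensional ℝ E] [T2Space M] [CompactSpace M]

variable (E M) in
/-- A compact manifold embeds in a vector space in such a way that charts are locally the
restrictions of smooth maps. -/
theorem exists_embedding_chart_eq : ∃ (N : ℕ) (ι : M → Fin N → E × ℝ),
    ContMDiff 𝓘(ℝ, E) 𝓘(ℝ, Fin N → E × ℝ) ∞ ι ∧ Topology.IsClosedEmbedding ι ∧
    ∀ c x₀ : M, x₀ ∈ (extChartAt 𝓘(ℝ, E) c).source → ∃ κ : (Fin N → E × ℝ) → E,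
      ContDiffAt ℝ ∞ κ (ι x₀) ∧ ∀ᶠ x in 𝓝 x₀, κ (ι x) = extChartAt 𝓘(ℝ, E) c x := by
  obtain ⟨J, f, -⟩ := SmoothBumpCovering.exists_isSubordinate 𝓘(ℝ, E) isClosed_univ
    fun (x : M) _ => Filter.univ_mem
  have := f.fintype
  let e := Fintype.equivFin J
  -- Recording the bump function next to the cut-off chart makes the map injective: the second
  -- component says where the first one is the chart itself.
  let G : J → M → E × ℝ := fun j x => (f j x • extChartAt 𝓘(ℝ, E) (f.c j) x, f j x)
  let ι : M → Fin (Fintype.card J) → E × ℝ := fun x i => G (e.symm i) x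
  have hιG : ∀ x j, ι x (e j) = G j x := fun x j => congrArg (G · x) (e.symm_apply_apply j)
  have hι : ContMDiff 𝓘(ℝ, E) 𝓘(ℝ, Fin (Fintype.card J) → E × ℝ) ∞ ι :=
    contMDiff_pi_space.2 fun i =>
      ((f (e.symm i)).contMDiff_smul contMDiffOn_extChartAt).prodMk_space (f (e.symm i)).contMDiff
  have hinj : Function.Injective ι := by
    intro x y hxy
    have h := congrFun hxy (e (f.ind x (mem_univ _)))
    rw [hιG, hιG] at h
    obtain ⟨h₁, h₂⟩ := Prod.mk_inj.1 h
    rw [f.apply_ind x (mem_univ _)] at h₂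
    rw [← h₂, f.apply_ind x (mem_univ _), one_smul, one_smul] at h₁
    exact (extChartAt 𝓘(ℝ, E) (f.c _)).injOn (f.mem_extChartAt_ind_source x (mem_univ _))
      (f.mem_extChartAt_source_of_eq_one h₂.symm) h₁
  refine ⟨_, ι, hι, hι.continuous.isClosedEmbedding hinj, fun c x₀ hx₀ => ?_⟩
  let j := f.ind x₀ (mem_univ _)
  -- Near x₀ the bump function `f j` is 1, so a linear projection of ι is a chart there; κ is this
  -- projection followed by a change of charts.
  let L : (Fin (Fintype.card J) → E × ℝ) →L[ℝ] E :=
    ContinuousLinearMap.fst ℝ E ℝ ∘L ContinuousLinearMap.proj (e j)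
  have hL : ∀ᶠ x in 𝓝 x₀, L (ι x) = extChartAt 𝓘(ℝ, E) (f.c j) x := by
    filter_upwards [f.eventuallyEq_one x₀ (mem_univ _)] with x hx
    have hx' : f j x = 1 := hx
    change (ι x (e j)).1 = _
    rw [hιG]
    change f j x • _ = _
    rw [hx', one_smul]
  have hj : x₀ ∈ (extChartAt 𝓘(ℝ, E) (f.c j)).source := f.mem_extChartAt_ind_source x₀ (mem_univ _)
  refine ⟨fun z => extChartAt 𝓘(ℝ, E) c ((extChartAt 𝓘(ℝ, E) (f.c j)).symm (L z)), ?_, ?_⟩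
  · have h1 : L (ι x₀) ∈ (extChartAt 𝓘(ℝ, E) (f.c j)).target := by
      rw [hL.self_of_nhds]; exact (extChartAt 𝓘(ℝ, E) (f.c j)).map_source hj
    have h2 : (extChartAt 𝓘(ℝ, E) (f.c j)).symm (L (ι x₀)) = x₀ := by
      rw [hL.self_of_nhds]; exact (extChartAt 𝓘(ℝ, E) (f.c j)).left_inv hj
    rw [← contMDiffAt_iff_contDiffAt]
    have h3 : ContMDiffAt 𝓘(ℝ, Fin (Fintype.card J) → E × ℝ) 𝓘(ℝ, E) ∞
        (fun z => (extChartAt 𝓘(ℝ, E) (f.c j)).symm (L z)) (ι x₀) :=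
      (contMDiffAt_chart_symm h1).comp (ι x₀) L.contMDiff.contMDiffAt
    exact ContMDiffAt.comp (ι x₀) (g := extChartAt 𝓘(ℝ, E) c) (contMDiffAt_chart (h2.symm ▸ hx₀)) h3
  · filter_upwards [hL, (isOpen_extChartAt_source (f.c j)).mem_nhds hj] with x hx hxs
    rw [hx, (extChartAt 𝓘(ℝ, E) (f.c j)).left_inv hxs]

end Charts

end LCS

namespace LCS

/-! ### Integral curves of time-dependent fields, and extension of fields to the ambient space. -/

section IntegralCurves

/-- Uniqueness on a closed interval with one-sided derivatives at its ends, from any initial time in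
it: the interval is split at t₀ and the one-sided theorems are used on the halves. -/
theorem eqOn_Icc_of_lipschitz_ode {V : Type*} [NormedAddCommGroup V] [NormedSpace ℝ V]
    {v : ℝ → V → V} {K : NNReal} {a b t₀ : ℝ} (hv : ∀ t, LipschitzWith K (v t)) {f g : ℝ → V}
    (hf : ∀ t ∈ Icc a b, HasDerivWithinAt f (v t (f t)) (Icc a b) t)
    (hg : ∀ t ∈ Icc a b, HasDerivWithinAt g (v t (g t)) (Icc a b) t)
    (ht₀ : t₀ ∈ Icc a b) (h : f t₀ = g t₀) : EqOn f g (Icc a b) := by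
  have hfc : ContinuousOn f (Icc a b) := fun t ht => (hf t ht).continuousWithinAt
  have hgc : ContinuousOn g (Icc a b) := fun t ht => (hg t ht).continuousWithinAt
  rw [← Icc_union_Icc_eq_Icc ht₀.1 ht₀.2]
  refine EqOn.union ?_ ?_
  · have hl : ∀ t ∈ Ioc a t₀, Icc a b ∈ 𝓝[Iic t] t := fun t ht =>
      mem_nhdsWithin.2 ⟨Ioi a, isOpen_Ioi, ht.1, fun s hs => ⟨hs.1.le, hs.2.trans (ht.2.trans ht₀.2)⟩⟩
    exact ODE_solution_unique_of_mem_Icc_left (s := fun _ => univ) (fun t _ => (hv t).lipschitzOnWith)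
      (hfc.mono (Icc_subset_Icc_right ht₀.2))
      (fun t ht => (hf t ⟨ht.1.le, ht.2.trans ht₀.2⟩).mono_of_mem_nhdsWithin (hl t ht))
      (fun _ _ => mem_univ _) (hgc.mono (Icc_subset_Icc_right ht₀.2))
      (fun t ht => (hg t ⟨ht.1.le, ht.2.trans ht₀.2⟩).mono_of_mem_nhdsWithin (hl t ht))
      (fun _ _ => mem_univ _) h
  · have hr : ∀ t ∈ Ico t₀ b, Icc a b ∈ 𝓝[Ici t] t := fun t ht =>
      mem_nhdsWithin.2 ⟨Iio b, isOpen_Iio, ht.2, fun s hs => ⟨(ht₀.1.trans ht.1).trans hs.2, hs.1.le⟩⟩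
    exact ODE_solution_unique_of_mem_Icc_right (s := fun _ => univ) (fun t _ => (hv t).lipschitzOnWith)
      (hfc.mono (Icc_subset_Icc_left ht₀.1))
      (fun t ht => (hf t ⟨ht₀.1.trans ht.1, ht.2.le⟩).mono_of_mem_nhdsWithin (hr t ht))
      (fun _ _ => mem_univ _) (hgc.mono (Icc_subset_Icc_left ht₀.1))
      (fun t ht => (hg t ⟨ht₀.1.trans ht.1, ht.2.le⟩).mono_of_mem_nhdsWithin (hr t ht))
      (fun _ _ => mem_univ _) h

universe u

/-- Solutions of a time-dependent Lipschitz equation, as functions of the initial time, the current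
time and the initial value. -/
theorem exists_contDiff_evolution {V : Type u} [NormedAddCommGroup V] [NormedSpace ℝ V]
    [CompleteSpace V] {n : ℕ} (hn : n ≠ 0) {Y : ℝ × V → V} (hY : ContDiff ℝ n Y) {K L : NNReal}
    (hK : LipschitzWith K Y) (hL : ∀ p, ‖Y p‖ ≤ L) :
    ∃ Q : ℝ → ℝ → V → V, ContDiff ℝ n (fun p : ℝ × ℝ × V => Q p.1 p.2.1 p.2.2) ∧
      (∀ s z, Q s s z = z) ∧ ∀ s z t, HasDerivAt (fun t => Q s t z) (Y (t, Q s t z)) t := by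
  -- Adding time as a coordinate makes the equation autonomous; the first component of the flow is
  -- then p.1 + t.
  let g : ℝ × V → ℝ × V := fun p => (1, Y p)
  have hg : ContDiff ℝ n g := contDiff_const.prodMk hY
  have hgK : LipschitzWith (max 0 K) g := (LipschitzWith.const 1).prodMk hK
  have hgL : ∀ p, ‖g p‖ ≤ (max 1 L : NNReal) := by
    intro p
    rw [Prod.norm_def]
    push_cast
    exact max_le_max (by simp [g]) (hL p)
  obtain ⟨Φ, hΦ, h0, hd⟩ := exists_contDiff_flow hn hg hgK hgL
  have h1 : ∀ p t, (Φ t p).1 = p.1 + t := by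
    intro p t
    have hder : ∀ t, HasDerivAt (fun t => (Φ t p).1 - t) 0 t := fun t => by
      have h := ((ContinuousLinearMap.fst ℝ ℝ V).hasFDerivAt.comp_hasDerivAt t (hd p t)).sub
        (hasDerivAt_id t)
      have h' : (ContinuousLinearMap.fst ℝ ℝ V) (g (Φ t p)) - 1 = 0 := by simp [g]
      rw [h'] at h
      exact h
    have hc := is_const_of_deriv_eq_zero (fun t => (hder t).differentiableAt)
      (fun t => (hder t).deriv) t 0
    simp only [h0, sub_zero] at hc
    linarith
  refine ⟨fun s t z => (Φ (t - s) (s, z)).2, ?_, fun s z => by simp [h0], fun s z t => ?_⟩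
  · exact contDiff_snd.comp (hΦ.comp (((contDiff_fst.comp contDiff_snd).sub contDiff_fst).prodMk
      (contDiff_fst.prodMk (contDiff_snd.comp contDiff_snd))))
  · have h2 := (ContinuousLinearMap.snd ℝ ℝ V).hasFDerivAt.comp_hasDerivAt t
      ((hd (s, z) (t - s)).comp_sub_const t s)
    have h3 : (Φ (t - s) (s, z)) = (t, (Φ (t - s) (s, z)).2) :=
      Prod.ext (by rw [h1]; simp) rfl
    change HasDerivAt _ (Y (Φ (t - s) (s, z))) t at h2
    rw [h3] at h2
    exact h2

variable {E : Type u} [NormedAddCommGroup E] [NormedSpace ℝ E] [FiniteDimensional ℝ E]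
variable {M : Type*} [TopologicalSpace M] [ChartedSpace E M]

variable [IsManifold 𝓘(ℝ, E) ∞ M] [CompactSpace M]

/-- A smooth time-dependent vector field on an embedded compact manifold extends to the ambient
space. -/
theorem exists_vectorField_extension {N : ℕ} {ι : M → Fin N → E × ℝ}
    (hι : ContMDiff 𝓘(ℝ, E) 𝓘(ℝ, Fin N → E × ℝ) ∞ ι) (hemb : Topology.IsClosedEmbedding ι)
    (hchart : ∀ c x₀ : M, x₀ ∈ (extChartAt 𝓘(ℝ, E) c).source → ∃ κ : (Fin N → E × ℝ) → E,
      ContDiffAt ℝ ∞ κ (ι x₀) ∧ ∀ᶠ x in 𝓝 x₀, κ (ι x) = extChartAt 𝓘(ℝ, E) c x)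
    {X : ℝ → M → E} (hX : ∀ c, ContDiffOn ℝ ∞ (chartVec c X)
      (Icc (0 : ℝ) 1 ×ˢ (extChartAt 𝓘(ℝ, E) c).target)) {m : ℕ} (hm : m ≠ 0) :
    ∃ Y : ℝ × (Fin N → E × ℝ) → Fin N → E × ℝ, ContDiff ℝ m Y ∧
      (∃ K L : NNReal, LipschitzWith K Y ∧ ∀ p, ‖Y p‖ ≤ L) ∧
      ∀ t ∈ Icc (0 : ℝ) 1, ∀ x, Y (t, ι x) = dFun ι x (X t x) := by
  let V := Fin N → E × ℝ
  -- Prescribing the value on [0, 1] × ι(M) is a convex condition, so it is enough to extend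
  -- locally: near ι x₀ by the coordinate expression of dι(X), extended in time and composed with κ.
  let T : ℝ × V → Set V := fun q => {y | q.1 ∈ Icc (0 : ℝ) 1 → ∀ x, ι x = q.2 → y = dFun ι x (X q.1 x)}
  have hT : ∀ q, Convex ℝ (T q) := by
    intro q y hy z hz a b _ _ hab hq x hx
    rw [hy hq x hx, hz hq x hx, ← add_smul, hab, one_smul]
  obtain ⟨g, hg⟩ := exists_contMDiffMap_forall_mem_convex_of_local (n := (m : ℕ∞))
    𝓘(ℝ, ℝ × V) hT fun q => by
      by_cases hq : q ∈ Icc (0 : ℝ) 1 ×ˢ range ι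
      swap
      · exact ⟨(Icc (0 : ℝ) 1 ×ˢ range ι)ᶜ,
          (isClosed_Icc.prod hemb.isClosed_range).isOpen_compl.mem_nhds hq, 0,
          contMDiffOn_const, fun r hr hr1 x hx => absurd ⟨hr1, x, hx⟩ hr⟩
      obtain ⟨t₀, z₀⟩ := q
      obtain ⟨ht₀, x₀, rfl⟩ := hq
      have hx₀ := mem_extChartAt_source (I := 𝓘(ℝ, E)) x₀
      have htar := isOpen_extChartAt_target (I := 𝓘(ℝ, E)) x₀
      obtain ⟨κ, hκ, hκι⟩ := hchart x₀ x₀ hx₀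
      have hfι := contDiffOn_comp_chart_symm hι x₀
      have hA : ContDiffOn ℝ ∞ (fun p : ℝ × E =>
          fderiv ℝ (ι ∘ (extChartAt 𝓘(ℝ, E) x₀).symm) p.2 (chartVec x₀ X p))
          (Icc (0 : ℝ) 1 ×ˢ (extChartAt 𝓘(ℝ, E) x₀).target) :=
        ((hfι.fderiv_of_isOpen htar (by simp)).comp contDiffOn_snd fun p hp => hp.2).clm_apply (hX x₀)
      obtain ⟨U, hU, G, hG, hGA⟩ := exists_local_contDiff_extension htar hA m
        (p := (t₀, extChartAt 𝓘(ℝ, E) x₀ x₀)) ⟨ht₀, mem_extChartAt_target x₀⟩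
      have hκ0 : κ (ι x₀) = extChartAt 𝓘(ℝ, E) x₀ x₀ := hκι.self_of_nhds
      have hpair : ContDiffAt ℝ m (fun q : ℝ × V => (q.1, κ q.2)) (t₀, ι x₀) :=
        contDiffAt_fst.prodMk ((hκ.of_le (by exact_mod_cast le_top)).comp (t₀, ι x₀) contDiffAt_snd)
      have hH : ContDiffAt ℝ m (fun q : ℝ × V => G (q.1, κ q.2)) (t₀, ι x₀) :=
        ContDiffAt.comp (g := G) (t₀, ι x₀) (by rw [hκ0]; exact hG.contDiffAt hU) hpair
      -- Because ι is a topological embedding, every point of M that ι maps near ι x₀ is near x₀; no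
      -- distant sheet of M interferes.
      have hnear : ∀ᶠ z in 𝓝 (ι x₀), ∀ x, ι x = z → κ (ι x) = extChartAt 𝓘(ℝ, E) x₀ x ∧
          x ∈ (extChartAt 𝓘(ℝ, E) x₀).source := by
        have h1 := hκι.and ((isOpen_extChartAt_source (I := 𝓘(ℝ, E)) x₀).mem_nhds hx₀)
        rw [hemb.isInducing.nhds_eq_comap] at h1
        obtain ⟨Z, hZ, hZ'⟩ := h1
        filter_upwards [hZ] with z hz x hx
        exact hZ' (show ι x ∈ Z from hx ▸ hz)
      have hUev : ∀ᶠ q : ℝ × V in 𝓝 (t₀, ι x₀), (q.1, κ q.2) ∈ U :=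
        hpair.continuousAt.eventually (by
          change ∀ᶠ y in 𝓝 (t₀, κ (ι x₀)), y ∈ U
          rw [hκ0]; exact hU)
      refine ⟨_, (hH.eventually (by simp)).and (hUev.and (continuousAt_snd.eventually hnear)),
        fun q => G (q.1, κ q.2), fun q hq => hq.1.contDiffWithinAt.contMDiffWithinAt, ?_⟩
      rintro ⟨t, z⟩ ⟨-, hqU, hqn⟩ ht x rfl
      obtain ⟨h1, h2⟩ := hqn x rfl
      change G (t, κ (ι x)) = _
      rw [hGA _ hqU ht]
      simp only [h1]
      have h3 := hasFDerivAt_comp_chart_symm (f := ι) ((extChartAt 𝓘(ℝ, E) x₀).map_source h2)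
        (hι.mdifferentiable (by simp) _)
      rw [h3.fderiv, ContinuousLinearMap.comp_apply,
        chartSymmD_chartVec X (p := (t, extChartAt 𝓘(ℝ, E) x₀ x)) ((extChartAt 𝓘(ℝ, E) x₀).map_source h2),
        (extChartAt 𝓘(ℝ, E) x₀).left_inv h2]
  have hcomp : IsCompact (Icc (0 : ℝ) 1 ×ˢ range ι) :=
    isCompact_Icc.prod (isCompact_range hι.continuous)
  obtain ⟨R, hR0, hR⟩ := hcomp.isBounded.subset_closedBall_lt 0 0
  -- A cut-off equal to 1 on the compact set [0, 1] × ι(M) gives compact support, hence the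
  -- Lipschitz constant and the bound.
  let χ : ContDiffBump (0 : ℝ × V) := ⟨R, R + 1, hR0, by linarith⟩
  have hYc : ContDiff ℝ m (fun p => χ p • g p) := (χ.contDiff).smul g.contMDiff.contDiff
  have hYs : HasCompactSupport (fun p => χ p • g p) := χ.hasCompactSupport.smul_right
  obtain ⟨K, hK⟩ := hYc.lipschitzWith_of_hasCompactSupport hYs (by exact_mod_cast hm)
  obtain ⟨L, hL⟩ := hYs.exists_bound_of_continuous hYc.continuous
  refine ⟨fun p => χ p • g p, hYc, ⟨K, L.toNNReal, hK, fun p => (hL p).trans (Real.le_coe_toNNReal L)⟩,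
    fun t ht x => ?_⟩
  have h1 : χ (t, ι x) = 1 := χ.one_of_mem_closedBall (hR ⟨ht, x, rfl⟩)
  change χ (t, ι x) • g (t, ι x) = _
  rw [h1, one_smul]
  exact hg (t, ι x) ht x rfl

end IntegralCurves

end LCS

namespace LCS

/-! ### Integral curves of a tangent field stay on the embedded manifold. -/

section Isotopies

universe u

variable {E : Type u} [NormedAddCommGroup E] [NormedSpace ℝ E]
variable {M : Type*} [TopologicalSpace M] [ChartedSpace E M] [IsManifold 𝓘(ℝ, E) ∞ M]

/-- A continuous map into an embedded manifold is as regular as its composition with the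
embedding. -/
theorem contMDiffWithinAt_of_comp_embedding {V : Type*} [NormedAddCommGroup V] [NormedSpace ℝ V]
    {ι : M → V} (hemb : Topology.IsClosedEmbedding ι)
    (hchart : ∀ c x₀ : M, x₀ ∈ (extChartAt 𝓘(ℝ, E) c).source → ∃ κ : V → E,
      ContDiffAt ℝ ∞ κ (ι x₀) ∧ ∀ᶠ x in 𝓝 x₀, κ (ι x) = extChartAt 𝓘(ℝ, E) c x)
    {E' H' N' : Type*} [NormedAddCommGroup E'] [NormedSpace ℝ E'] [TopologicalSpace H']
    {I' : ModelWithCorners ℝ E' H'} [TopologicalSpace N'] [ChartedSpace H' N'] {n : ℕ}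
    {f : N' → M} {s : Set N'} {p : N'} (hf : ContMDiffWithinAt I' 𝓘(ℝ, V) n (ι ∘ f) s p) :
    ContMDiffWithinAt I' 𝓘(ℝ, E) n f s p := by
  have hfc : ContinuousWithinAt f s p :=
    (hemb.isInducing.continuousWithinAt_iff).2 hf.continuousWithinAt
  have hsrc := mem_extChartAt_source (I := 𝓘(ℝ, E)) (f p)
  obtain ⟨κ, hκ, hκι⟩ := hchart (f p) (f p) hsrc
  have h1 : ContMDiffWithinAt I' 𝓘(ℝ, E) n (fun q => κ (ι (f q))) s p :=
    (hκ.of_le (m := n) (by exact_mod_cast le_top)).contMDiffAt.comp_contMDiffWithinAt p hf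
  have h2 : κ (ι (f p)) = extChartAt 𝓘(ℝ, E) (f p) (f p) := hκι.self_of_nhds
  have h3 : ContMDiffWithinAt I' 𝓘(ℝ, E) n
      (fun q => (extChartAt 𝓘(ℝ, E) (f p)).symm (κ (ι (f q)))) s p := by
    refine ContMDiffAt.comp_contMDiffWithinAt (g := (extChartAt 𝓘(ℝ, E) (f p)).symm) p ?_ h1
    rw [h2]
    exact (contMDiffAt_chart_symm (mem_extChartAt_target (f p))).of_le (by exact_mod_cast le_top)
  refine h3.congr_of_eventuallyEq ?_ (by rw [h2, extChartAt_to_inv])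
  filter_upwards [hfc.eventually hκι,
    hfc.eventually ((isOpen_extChartAt_source (f p)).mem_nhds hsrc)] with q hq hq'
  rw [hq, (extChartAt 𝓘(ℝ, E) (f p)).left_inv hq']

variable [FiniteDimensional ℝ E]

/-- An integral curve found in a chart and pushed forward by ι solves the ambient equation, so by
uniqueness it is c near t₀. -/
theorem eventually_mem_range_of_tangent {V : Type*} [NormedAddCommGroup V] [NormedSpace ℝ V]
    {ι : M → V} (hι : ContMDiff 𝓘(ℝ, E) 𝓘(ℝ, V) ∞ ι) {X : ℝ → M → E}
    (hX : ∀ c, ContDiffOn ℝ ∞ (chartVec c X)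
      (Icc (0 : ℝ) 1 ×ˢ (extChartAt 𝓘(ℝ, E) c).target))
    {Y : ℝ × V → V} {K : NNReal} (hK : LipschitzWith K Y)
    (hYX : ∀ t ∈ Icc (0 : ℝ) 1, ∀ x, Y (t, ι x) = dFun ι x (X t x))
    {c : ℝ → V} (hc : ∀ t, HasDerivAt c (Y (t, c t)) t) {t₀ : ℝ} (ht₀ : t₀ ∈ Icc (0 : ℝ) 1)
    (hc₀ : c t₀ ∈ range ι) : ∀ᶠ t in 𝓝 t₀, t ∈ Icc (0 : ℝ) 1 → c t ∈ range ι := by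
  have : CompleteSpace E := FiniteDimensional.complete ℝ E
  obtain ⟨x₀, hx₀⟩ := hc₀
  have htar := isOpen_extChartAt_target (I := 𝓘(ℝ, E)) x₀
  -- The existence theorem needs a field on a full neighbourhood of t₀, also if t₀ is 0 or 1. The
  -- extension G has a meaning only for times in [0, 1], where alone the two curves are compared.
  obtain ⟨U, hU, G, hG, hGX⟩ := exists_local_contDiff_extension htar (hX x₀) 1
    (p := (t₀, extChartAt 𝓘(ℝ, E) x₀ x₀)) ⟨ht₀, mem_extChartAt_target x₀⟩
  obtain ⟨γ, hγ₀, ε, hε, hγ⟩ :=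
    ContDiffAt.exists_forall_mem_closedBall_exists_eq_forall_mem_Ioo_hasDerivAt₀
      (f := fun p : ℝ × E => ((1 : ℝ), G p)) (contDiffAt_const.prodMk (hG.contDiffAt hU)) t₀
  have hmem₀ : t₀ ∈ Ioo (t₀ - ε) (t₀ + ε) := ⟨by linarith, by linarith⟩
  have hfst : EqOn (fun t => (γ t).1) id (Ioo (t₀ - ε) (t₀ + ε)) :=
    ODE_solution_unique_of_mem_Ioo (v := fun _ _ => (1 : ℝ)) (s := fun _ => univ) (K := 0)
      (fun _ _ => (LipschitzWith.const 1).lipschitzOnWith) hmem₀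
      (fun t ht => ⟨(ContinuousLinearMap.fst ℝ ℝ E).hasFDerivAt.comp_hasDerivAt t (hγ t ht),
        mem_univ _⟩)
      (fun t _ => ⟨hasDerivAt_id t, mem_univ _⟩) (by simp [hγ₀])
  have hsnd : ∀ t ∈ Ioo (t₀ - ε) (t₀ + ε), HasDerivAt (fun t => (γ t).2) (G (t, (γ t).2)) t := by
    intro t ht
    have h1 := (ContinuousLinearMap.snd ℝ ℝ E).hasFDerivAt.comp_hasDerivAt t (hγ t ht)
    have h2 : γ t = (t, (γ t).2) := Prod.ext (hfst ht) rfl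
    change HasDerivAt _ (G (γ t)) t at h1
    rw [h2] at h1
    exact h1
  have hcont : ContinuousAt (fun t => (γ t).2) t₀ := (hsnd t₀ hmem₀).continuousAt
  have hγ₀' : (γ t₀).2 = extChartAt 𝓘(ℝ, E) x₀ x₀ := by rw [hγ₀]
  have hev1 : ∀ᶠ t in 𝓝 t₀, (t, (γ t).2) ∈ U :=
    (continuousAt_id.prodMk hcont).eventually (by
      change ∀ᶠ y in 𝓝 (t₀, (γ t₀).2), y ∈ U
      rw [hγ₀']; exact hU)
  have hev2 : ∀ᶠ t in 𝓝 t₀, (γ t).2 ∈ (extChartAt 𝓘(ℝ, E) x₀).target :=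
    hcont.eventually (by
      change ∀ᶠ y in 𝓝 (γ t₀).2, y ∈ (extChartAt 𝓘(ℝ, E) x₀).target
      rw [hγ₀']; exact htar.mem_nhds (mem_extChartAt_target x₀))
  obtain ⟨δ, hδ, hδ'⟩ := Metric.nhds_basis_closedBall.eventually_iff.1
    (hev1.and (hev2.and (Ioo_mem_nhds hmem₀.1 hmem₀.2)))
  have hsub : ∀ t ∈ Icc (max 0 (t₀ - δ)) (min 1 (t₀ + δ)),
      t ∈ Icc (0 : ℝ) 1 ∧ t ∈ Metric.closedBall t₀ δ := by
    intro t ht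
    rw [mem_Icc, max_le_iff, le_min_iff] at ht
    rw [Real.closedBall_eq_Icc]
    exact ⟨⟨ht.1.1, ht.2.1⟩, ht.1.2, ht.2.2⟩
  have heq : EqOn (fun t => ι ((extChartAt 𝓘(ℝ, E) x₀).symm (γ t).2)) c
      (Icc (max 0 (t₀ - δ)) (min 1 (t₀ + δ))) := by
    refine eqOn_Icc_of_lipschitz_ode (v := fun t z => Y (t, z)) (K := K * 1) (t₀ := t₀)
      (fun t => hK.comp (LipschitzWith.prodMk_left t)) (fun t ht => ?_)
      (fun t _ => (hc t).hasDerivWithinAt) ?_ ?_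
    · obtain ⟨h1, h2⟩ := hsub t ht
      obtain ⟨h3, h4, h5⟩ := hδ' h2
      have h6 := (hasFDerivAt_comp_chart_symm (f := ι) h4
        (hι.mdifferentiable (by simp) _)).comp_hasDerivAt t (hsnd t h5)
      rw [hYX t h1]
      rw [hGX _ h3 h1, ContinuousLinearMap.comp_apply, chartSymmD_chartVec X (p := (t, (γ t).2)) h4] at h6
      exact h6.hasDerivWithinAt
    · rw [mem_Icc, max_le_iff, le_min_iff]
      exact ⟨⟨ht₀.1, by linarith⟩, ht₀.2, by linarith⟩
    · simp only [hγ₀', ← hx₀]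
      rw [extChartAt_to_inv]
  filter_upwards [Metric.closedBall_mem_nhds t₀ hδ] with t ht ht01
  rw [Real.closedBall_eq_Icc] at ht
  exact ⟨_, heq ⟨max_le ht01.1 ht.1, le_min ht01.2 ht.2⟩⟩

/-- The times at which c lies in the closed set ι(M) form a clopen set. Times are clamped to [0, 1]
so that connectedness of ℝ can be used. -/
theorem mem_range_of_tangent {V : Type*} [NormedAddCommGroup V] [NormedSpace ℝ V]
    {ι : M → V} (hι : ContMDiff 𝓘(ℝ, E) 𝓘(ℝ, V) ∞ ι) (hcl : IsClosed (range ι)) {X : ℝ → M → E}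
    (hX : ∀ c, ContDiffOn ℝ ∞ (chartVec c X)
      (Icc (0 : ℝ) 1 ×ˢ (extChartAt 𝓘(ℝ, E) c).target))
    {Y : ℝ × V → V} {K : NNReal} (hK : LipschitzWith K Y)
    (hYX : ∀ t ∈ Icc (0 : ℝ) 1, ∀ x, Y (t, ι x) = dFun ι x (X t x))
    {c : ℝ → V} (hc : ∀ t, HasDerivAt c (Y (t, c t)) t) {s : ℝ} (hs : s ∈ Icc (0 : ℝ) 1)
    (hcs : c s ∈ range ι) {t : ℝ} (ht : t ∈ Icc (0 : ℝ) 1) : c t ∈ range ι := by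
  let cl : ℝ → ℝ := fun t => projIcc (0 : ℝ) 1 zero_le_one t
  have hcl' : Continuous cl := continuous_subtype_val.comp continuous_projIcc
  have hcc : Continuous c := continuous_iff_continuousAt.2 fun t => (hc t).continuousAt
  have hid : ∀ t ∈ Icc (0 : ℝ) 1, cl t = t := fun t ht => by
    simp only [cl]; rw [projIcc_of_mem zero_le_one ht]
  have hclopen : IsClopen {t : ℝ | c (cl t) ∈ range ι} := by
    refine ⟨hcl.preimage (hcc.comp hcl'), isOpen_iff_mem_nhds.2 fun t ht => ?_⟩
    have hmem : ∀ t, cl t ∈ Icc (0 : ℝ) 1 := fun t => (projIcc (0 : ℝ) 1 zero_le_one t).2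
    filter_upwards [hcl'.continuousAt.eventually
      (eventually_mem_range_of_tangent hι hX hK hYX hc (hmem t) ht)] with r hr
    exact hr (hmem r)
  have huniv := hclopen.eq_univ ⟨s, by rw [mem_ofPred_eq, hid s hs]; exact hcs⟩
  have : t ∈ {t : ℝ | c (cl t) ∈ range ι} := huniv ▸ mem_univ t
  rwa [mem_ofPred_eq, hid t ht] at this

end Isotopies

end LCS

namespace LCS

/-! ### The isotopy generated by a time-dependent vector field. -/

section Isotopies

universe u

variable {E : Type u} [NormedAddCommGroup E] [NormedSpace ℝ E] [FiniteDimensional ℝ E]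
variable {M : Type*} [TopologicalSpace M] [T2Space M] [CompactSpace M] [ChartedSpace E M]
  [IsManifold 𝓘(ℝ, E) ∞ M]

/-- A smooth time-dependent vector field on a compact manifold generates an isotopy. -/
theorem exists_isotopy_of_vectorField {X : ℝ → M → E}
    (hX : ∀ c, ContDiffOn ℝ ∞ (chartVec c X)
      (Icc (0 : ℝ) 1 ×ˢ (extChartAt 𝓘(ℝ, E) c).target)) :
    ∃ φ : ℝ → (M ≃ₘ^∞⟮𝓘(ℝ, E), 𝓘(ℝ, E)⟯ M), IsIsotopy φ ∧
      ∀ c x t, t ∈ Icc (0 : ℝ) 1 → φ t x ∈ (extChartAt 𝓘(ℝ, E) c).source →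
        HasDerivWithinAt (fun s => extChartAt 𝓘(ℝ, E) c (φ s x))
          (chartVec c X (t, extChartAt 𝓘(ℝ, E) c (φ t x))) (Icc (0 : ℝ) 1) t := by
  have : CompleteSpace E := FiniteDimensional.complete ℝ E
  obtain ⟨N, ι, hι, hemb, hchart⟩ := exists_embedding_chart_eq E M
  have h01 : (0 : ℝ) ∈ Icc (0 : ℝ) 1 := ⟨le_rfl, zero_le_one⟩
  -- Each m has its own ambient extension and evolution `Q`. The last clause says that every
  -- integral curve in M is governed by it, which is what makes the different `Q m` comparable.
  have hYex : ∀ m : ℕ, ∃ Q : ℝ → ℝ → (Fin N → E × ℝ) → (Fin N → E × ℝ),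
      ContDiff ℝ (m + 1 : ℕ) (fun p : ℝ × ℝ × (Fin N → E × ℝ) => Q p.1 p.2.1 p.2.2) ∧
      (∀ s z, Q s s z = z) ∧
      (∀ s ∈ Icc (0 : ℝ) 1, ∀ t ∈ Icc (0 : ℝ) 1, ∀ x, Q s t (ι x) ∈ range ι) ∧
      (∀ s, ∀ t ∈ Icc (0 : ℝ) 1, ∀ x y, Q s t (ι x) = ι y →
        HasDerivAt (fun t => Q s t (ι x)) (dFun ι y (X t y)) t) ∧
      ∀ γ : ℝ → M, (∀ t ∈ Icc (0 : ℝ) 1, HasDerivWithinAt (fun t => ι (γ t)) (dFun ι (γ t) (X t (γ t)))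
        (Icc (0 : ℝ) 1) t) → ∀ s ∈ Icc (0 : ℝ) 1, ∀ t ∈ Icc (0 : ℝ) 1,
          ι (γ t) = Q s t (ι (γ s)) := by
    intro m
    obtain ⟨Y, hY, ⟨K, L, hK, hL⟩, hYX⟩ :=
      exists_vectorField_extension hι hemb hchart hX (Nat.succ_ne_zero m)
    obtain ⟨Q, hQ, hQ0, hQd⟩ := exists_contDiff_evolution (Nat.succ_ne_zero m) hY hK hL
    refine ⟨Q, hQ, hQ0, fun s hs t ht x => ?_, fun s t ht x y hxy => ?_, fun γ hγ s hs t ht => ?_⟩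
    · exact mem_range_of_tangent hι hemb.isClosed_range hX hK hYX (hQd s (ι x)) hs
        ⟨x, (hQ0 s (ι x)).symm⟩ ht
    · rw [← hYX t ht, ← hxy]
      exact hQd s (ι x) t
    · refine eqOn_Icc_of_lipschitz_ode (v := fun t z => Y (t, z)) (K := K * 1) (t₀ := s)
        (f := fun t => ι (γ t)) (g := fun t => Q s t (ι (γ s)))
        (fun t => hK.comp (LipschitzWith.prodMk_left t)) (fun t ht => ?_)
        (fun t _ => (hQd s _ t).hasDerivWithinAt) hs (hQ0 s _).symm ht
      rw [hYX t ht]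
      exact hγ t ht
  choose Q hQ hQ0 hQr hQd hQu using hYex
  have hP : ∀ s t x, ∃ y, s ∈ Icc (0 : ℝ) 1 → t ∈ Icc (0 : ℝ) 1 → ι y = Q 0 s t (ι x) := by
    intro s t x
    by_cases hs : s ∈ Icc (0 : ℝ) 1
    · by_cases ht : t ∈ Icc (0 : ℝ) 1
      · obtain ⟨y, hy⟩ := hQr 0 s hs t ht x
        exact ⟨y, fun _ _ => hy⟩
      · exact ⟨x, fun _ h => absurd h ht⟩
    · exact ⟨x, fun h => absurd h hs⟩
  choose P hP using hP
  have hPd : ∀ s ∈ Icc (0 : ℝ) 1, ∀ x, ∀ t ∈ Icc (0 : ℝ) 1,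
      HasDerivWithinAt (fun t => ι (P s t x)) (dFun ι (P s t x) (X t (P s t x)))
        (Icc (0 : ℝ) 1) t := fun s hs x t ht =>
    (hQd 0 s t ht x _ (hP s t x hs ht).symm).hasDerivWithinAt.congr
      (fun r hr => hP s r x hs hr) (hP s t x hs ht)
  have hP0 : ∀ s ∈ Icc (0 : ℝ) 1, ∀ x, P s s x = x := fun s hs x =>
    hemb.injective ((hP s s x hs hs).trans (hQ0 0 s _))
  -- `P` was built from `Q 0`, but on M it coincides with every `Q m`; hence it is C^m for all m.
  have hPQ : ∀ m, ∀ s ∈ Icc (0 : ℝ) 1, ∀ t ∈ Icc (0 : ℝ) 1, ∀ x,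
      ι (P s t x) = Q m s t (ι x) := fun m s hs t ht x => by
    have := hQu m (fun t => P s t x) (hPd s hs x) s hs t ht
    rwa [hP0 s hs] at this
  have hinv : ∀ s ∈ Icc (0 : ℝ) 1, ∀ t ∈ Icc (0 : ℝ) 1, ∀ x, P t s (P s t x) = x := by
    intro s hs t ht x
    apply hemb.injective
    rw [hPQ 0 t ht s hs, ← hQu 0 (fun t => P s t x) (hPd s hs x) t ht s hs, hP0 s hs]
  have hsmooth : ∀ s ∈ Icc (0 : ℝ) 1, ∀ t ∈ Icc (0 : ℝ) 1, ContMDiff 𝓘(ℝ, E) 𝓘(ℝ, E) ∞ (P s t) := by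
    intro s hs t ht
    rw [contMDiff_infty]
    intro m x
    rw [← contMDiffWithinAt_univ]
    refine contMDiffWithinAt_of_comp_embedding hemb hchart ?_
    rw [contMDiffWithinAt_univ]
    have h1 : ContDiff ℝ m (fun z => Q m s t z) :=
      ((hQ m).of_le (by exact_mod_cast Nat.le_succ m)).comp
        (contDiff_const.prodMk (contDiff_const.prodMk contDiff_id))
    have h2 : ContMDiff 𝓘(ℝ, E) 𝓘(ℝ, Fin N → E × ℝ) m (fun x => Q m s t (ι x)) :=
      h1.contMDiff.comp (hι.of_le (by exact_mod_cast le_top))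
    exact (h2 x).congr_of_eventuallyEq (Filter.Eventually.of_forall fun x => hPQ m s hs t ht x)
  have hjoint : ContMDiffOn (𝓘(ℝ, ℝ).prod 𝓘(ℝ, E)) 𝓘(ℝ, E) ∞
      (fun p : ℝ × M => P 0 p.1 p.2) (Icc (0 : ℝ) 1 ×ˢ univ) := by
    rw [contMDiffOn_infty]
    intro m p hp
    refine contMDiffWithinAt_of_comp_embedding hemb hchart ?_
    have h1 : ContDiff ℝ m (fun q : ℝ × (Fin N → E × ℝ) => Q m 0 q.1 q.2) :=
      ((hQ m).of_le (by exact_mod_cast Nat.le_succ m)).comp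
        (contDiff_const.prodMk (contDiff_fst.prodMk contDiff_snd))
    have h2 : ContMDiff (𝓘(ℝ, ℝ).prod 𝓘(ℝ, E)) 𝓘(ℝ, Fin N → E × ℝ) m
        (fun p : ℝ × M => Q m 0 p.1 (ι p.2)) :=
      h1.contMDiff.comp (contMDiff_fst.prodMk_space
        ((hι.of_le (by exact_mod_cast le_top)).comp contMDiff_snd))
    exact (h2 p).contMDiffWithinAt.congr (fun q hq => hPQ m 0 h01 q.1 hq.1 q.2)
      (hPQ m 0 h01 p.1 hp.1 p.2)
  classical
  let φ : ℝ → (M ≃ₘ^∞⟮𝓘(ℝ, E), 𝓘(ℝ, E)⟯ M) := fun t =>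
    if ht : t ∈ Icc (0 : ℝ) 1 then
      { toFun := P 0 t
        invFun := P t 0
        left_inv := hinv 0 h01 t ht
        right_inv := hinv t ht 0 h01
        contMDiff_toFun := hsmooth 0 h01 t ht
        contMDiff_invFun := hsmooth t ht 0 h01 }
    -- Times outside [0, 1] are irrelevant to `IsIsotopy`; the identity is a filler.
    else Diffeomorph.refl 𝓘(ℝ, E) M ∞
  have hφ : ∀ t ∈ Icc (0 : ℝ) 1, ∀ x, φ t x = P 0 t x := fun t ht x => by
    simp only [φ, dif_pos ht]; rfl
  refine ⟨φ, ⟨hjoint.congr fun p hp => hφ p.1 hp.1 p.2, fun x => ?_⟩, fun c x t ht hsrc => ?_⟩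
  · rw [hφ 0 h01, hP0 0 h01]
  · rw [hφ t ht] at hsrc ⊢
    obtain ⟨κ, hκ, hκι⟩ := hchart c _ hsrc
    have hd := hPd 0 h01 x t ht
    have hcont : ContinuousWithinAt (fun t => P 0 t x) (Icc (0 : ℝ) 1) t :=
      hemb.isInducing.continuousWithinAt_iff.2 hd.continuousWithinAt
    have hκd : HasFDerivAt κ (fderiv ℝ κ (ι (P 0 t x))) (ι (P 0 t x)) :=
      (hκ.differentiableAt (by simp)).hasFDerivAt
    have h1 := hκd.comp_hasDerivWithinAt t hd
    -- κ ∘ ι is the chart near the point, so dκ ∘ dι is its derivative and turns the ambient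
    -- velocity into `chartVec`.
    have h2 : fderiv ℝ κ (ι (P 0 t x)) ∘L dFun ι (P 0 t x) = chartD c (P 0 t x) := by
      have h3 : HasMFDerivAt 𝓘(ℝ, E) 𝓘(ℝ, E) (κ ∘ ι) (P 0 t x)
          (fderiv ℝ κ (ι (P 0 t x)) ∘L dFun (E := E) ι (P 0 t x)) :=
        hκd.hasMFDerivAt.comp _ (hι.mdifferentiable (by simp) _).hasMFDerivAt
      exact hasMFDerivAt_unique h3 ((hasMFDerivAt_chart hsrc).congr_of_eventuallyEq hκι)
    have h4 : chartVec c X (t, extChartAt 𝓘(ℝ, E) c (P 0 t x)) =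
        fderiv ℝ κ (ι (P 0 t x)) (dFun ι (P 0 t x) (X t (P 0 t x))) := by
      rw [← ContinuousLinearMap.comp_apply, h2, chartVec]
      simp only [(extChartAt 𝓘(ℝ, E) c).left_inv hsrc]
    rw [h4]
    refine h1.congr_of_eventuallyEq ?_ ?_
    · filter_upwards [hcont.eventually hκι, self_mem_nhdsWithin] with s hs hs'
      rw [hφ s hs', Function.comp_apply, hs]
    · rw [hφ t ht, Function.comp_apply, hκι.self_of_nhds]

end Isotopies

end LCS

namespace LCS

/-! ### Forms of degree 1 and 2 as linear and bilinear maps. -/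

section LinearForms

variable {E : Type*} [NormedAddCommGroup E] [NormedSpace ℝ E]

variable (E) in
/-- Alternating `1`-forms as linear forms. -/
noncomputable def lin : (E [⋀^Fin 1]→L[ℝ] ℝ) →L[ℝ] E →L[ℝ] ℝ :=
  (ContinuousAlternatingMap.ofSubsingletonLIE (𝕜 := ℝ) (E := E) (F := ℝ) (0 : Fin 1)).symm.toContinuousLinearEquiv

variable (E) in
/-- Alternating `2`-forms as bilinear forms. -/
noncomputable def bil : (E [⋀^Fin 2]→L[ℝ] ℝ) →L[ℝ] E →L[ℝ] E →L[ℝ] ℝ :=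
  (ContinuousLinearMap.compL ℝ E (E [⋀^Fin 1]→L[ℝ] ℝ) (E →L[ℝ] ℝ) (lin E)) ∘L
    ContinuousAlternatingMap.curryLeftLI.toContinuousLinearMap

theorem lin_apply (a : E [⋀^Fin 1]→L[ℝ] ℝ) (v : E) : lin E a v = a ![v] := by
  have h : (fun _ : Fin 1 => v) = ![v] := by funext j; fin_cases j; rfl
  rw [← h]; rfl

theorem bil_apply (b : E [⋀^Fin 2]→L[ℝ] ℝ) (u v : E) : bil E b u v = b ![u, v] := by
  change lin E (ContinuousAlternatingMap.curryLeft b u) v = _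
  rw [lin_apply]; rfl

theorem bil_swap (b : E [⋀^Fin 2]→L[ℝ] ℝ) (u v : E) : bil E b u v = -bil E b v u := by
  have h := b.toAlternatingMap.map_swap ![v, u] (show (0 : Fin 2) ≠ 1 by decide)
  have h' : (![v, u] ∘ Equiv.swap (0 : Fin 2) 1) = ![u, v] := by
    funext j; fin_cases j <;> rfl
  rw [h'] at h
  rw [bil_apply, bil_apply]
  exact h

theorem wedgeOne_one_apply (θ α : E [⋀^Fin 1]→L[ℝ] ℝ) (u v : E) :
    wedgeOne θ α ![u, v] = lin E θ u * lin E α v - lin E θ v * lin E α u := by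
  rw [wedgeOne_apply, Fin.sum_univ_two]
  have h0 : (0 : Fin 2).removeNth ![u, v] = ![v] := by funext j; fin_cases j; rfl
  have h1 : (1 : Fin 2).removeNth ![u, v] = ![u] := by funext j; fin_cases j; rfl
  rw [h0, h1]
  simp only [lin_apply]
  simp
  ring

theorem wedgeOne_two_apply (θ : E [⋀^Fin 1]→L[ℝ] ℝ) (β : E [⋀^Fin 2]→L[ℝ] ℝ) (u v z : E) :
    wedgeOne θ β ![u, v, z] = lin E θ u * bil E β v z - lin E θ v * bil E β u z
      + lin E θ z * bil E β u v := by
  rw [wedgeOne_apply, Fin.sum_univ_three]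
  have h0 : (0 : Fin 3).removeNth ![u, v, z] = ![v, z] := by funext j; fin_cases j <;> rfl
  have h1 : (1 : Fin 3).removeNth ![u, v, z] = ![u, z] := by funext j; fin_cases j <;> rfl
  have h2 : (2 : Fin 3).removeNth ![u, v, z] = ![u, v] := by funext j; fin_cases j <;> rfl
  rw [h0, h1, h2]
  simp only [lin_apply, bil_apply]
  simp
  ring

theorem extDeriv_one_apply {a : E → E [⋀^Fin 1]→L[ℝ] ℝ} {x : E} (ha : DifferentiableAt ℝ a x)
    (u v : E) : extDeriv a x ![u, v] = fderiv ℝ (fun y => lin E (a y)) x u v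
      - fderiv ℝ (fun y => lin E (a y)) x v u := by
  have hd : HasFDerivAt (fun y => lin E (a y)) (lin E ∘L fderiv ℝ a x) x :=
    (lin E).hasFDerivAt.comp x ha.hasFDerivAt
  rw [extDeriv, ContinuousAlternatingMap.alternatizeUncurryFin_apply, Fin.sum_univ_two, hd.fderiv]
  have h0 : (0 : Fin 2).removeNth ![u, v] = ![v] := by funext j; fin_cases j; rfl
  have h1 : (1 : Fin 2).removeNth ![u, v] = ![u] := by funext j; fin_cases j; rfl
  rw [h0, h1]
  simp only [ContinuousLinearMap.comp_apply, lin_apply]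
  simp
  ring

theorem extDeriv_two_apply {b : E → E [⋀^Fin 2]→L[ℝ] ℝ} {x : E} (hb : DifferentiableAt ℝ b x)
    (u v z : E) : extDeriv b x ![u, v, z] = fderiv ℝ (fun y => bil E (b y)) x u v z
      - fderiv ℝ (fun y => bil E (b y)) x v u z + fderiv ℝ (fun y => bil E (b y)) x z u v := by
  have h := ContinuousLinearMap.hasFDerivAt (𝕜 := ℝ) (E := E [⋀^Fin 2]→L[ℝ] ℝ)
    (F := E →L[ℝ] E →L[ℝ] ℝ) (bil E) (x := b x)
  have hd : HasFDerivAt (fun y => bil E (b y)) (bil E ∘L fderiv ℝ b x) x :=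
    HasFDerivAt.comp (𝕜 := ℝ) (G := E →L[ℝ] E →L[ℝ] ℝ) x h hb.hasFDerivAt
  rw [extDeriv, ContinuousAlternatingMap.alternatizeUncurryFin_apply, Fin.sum_univ_three, hd.fderiv]
  have h0 : (0 : Fin 3).removeNth ![u, v, z] = ![v, z] := by funext j; fin_cases j <;> rfl
  have h1 : (1 : Fin 3).removeNth ![u, v, z] = ![u, z] := by funext j; fin_cases j <;> rfl
  have h2 : (2 : Fin 3).removeNth ![u, v, z] = ![u, v] := by funext j; fin_cases j <;> rfl
  rw [h0, h1, h2]
  simp only [ContinuousLinearMap.comp_apply, bil_apply]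
  simp
  ring

end LinearForms

/-! ### Differential forms in charts. -/

section FormsInCharts

universe u

variable {E : Type u} [NormedAddCommGroup E] [NormedSpace ℝ E]
variable {M : Type*} [TopologicalSpace M] [ChartedSpace E M]

/-- The value of a form at a point, read in the model space. -/
noncomputable def formAt {k : ℕ} (w : Form E M k) (x : M) : E [⋀^Fin k]→L[ℝ] ℝ := w x

theorem inChart_apply {k : ℕ} (c : M) (w : Form E M k) (y : E) (v : Fin k → E) :
    inChart c w y v = formAt w ((extChartAt 𝓘(ℝ, E) c).symm y) (fun i => chartSymmD c y (v i)) := rfl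

theorem inChart_wedge {k : ℕ} (c : M) (θ : Form E M 1) (β : Form E M k) (y : E) :
    inChart c (wedge θ β) y = wedgeOne (inChart c θ y) (inChart c β y) := by
  ext v
  rw [inChart_apply, wedgeOne_apply]
  refine (wedgeOne_apply (E := E) _ _ _).trans (Finset.sum_congr rfl fun i _ => ?_)
  rw [inChart_apply, inChart_apply]
  congr 3
  funext j; fin_cases j; rfl

theorem inChart_sub {k : ℕ} (c : M) (w w' : Form E M k) (y : E) :
    inChart c (fun x => w x - w' x) y = inChart c w y - inChart c w' y := rfl

/-- The coordinate expression of a family of `1`-forms, as a family of linear forms. -/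
noncomputable def linChart (c : M) (α : ℝ → Form E M 1) (p : ℝ × E) : E →L[ℝ] ℝ :=
  lin E (inChart c (α p.1) p.2)

/-- The coordinate expression of a family of `2`-forms, as a family of bilinear forms. -/
noncomputable def bilChart (c : M) (w : ℝ → Form E M 2) (p : ℝ × E) : E →L[ℝ] E →L[ℝ] ℝ :=
  bil E (inChart c (w p.1) p.2)

theorem linChart_apply (c : M) (α : ℝ → Form E M 1) (p : ℝ × E) (v : E) :
    linChart c α p v = lin E (formAt (α p.1) ((extChartAt 𝓘(ℝ, E) c).symm p.2)) (chartSymmD c p.2 v) := by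
  rw [linChart, lin_apply, lin_apply, inChart_apply]
  congr 1
  funext j; fin_cases j; rfl

theorem bilChart_apply (c : M) (w : ℝ → Form E M 2) (p : ℝ × E) (u v : E) :
    bilChart c w p u v = bil E (formAt (w p.1) ((extChartAt 𝓘(ℝ, E) c).symm p.2))
      (chartSymmD c p.2 u) (chartSymmD c p.2 v) := by
  rw [bilChart, bil_apply, bil_apply, inChart_apply]
  congr 1
  funext j; fin_cases j <;> rfl

variable [IsManifold 𝓘(ℝ, E) ∞ M]

/-- At each point x, `extD` uses the preferred chart at x, which varies with x. Naturality of the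
exterior derivative under the transition map `τ` brings all these computations into the one chart at
c. -/
theorem inChart_extD {k : ℕ} {c : M} {w : Form E M k}
    (hw : ContDiffOn ℝ ∞ (inChart c w) (extChartAt 𝓘(ℝ, E) c).target) {y : E}
    (hy : y ∈ (extChartAt 𝓘(ℝ, E) c).target) :
    inChart c (extD w) y = extDeriv (inChart c w) y := by
  set x := (extChartAt 𝓘(ℝ, E) c).symm y with hx
  have hxc : x ∈ (extChartAt 𝓘(ℝ, E) c).source := (extChartAt 𝓘(ℝ, E) c).map_target hy
  have hxx := mem_extChartAt_source (I := 𝓘(ℝ, E)) x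
  let τ : E → E := fun z => extChartAt 𝓘(ℝ, E) c ((extChartAt 𝓘(ℝ, E) x).symm z)
  have hev : ∀ᶠ z in 𝓝 (extChartAt 𝓘(ℝ, E) x x), z ∈ (extChartAt 𝓘(ℝ, E) x).target ∧
      (extChartAt 𝓘(ℝ, E) x).symm z ∈ (extChartAt 𝓘(ℝ, E) c).source := by
    refine Filter.Eventually.and
      ((isOpen_extChartAt_target x).mem_nhds (mem_extChartAt_target x)) ?_
    refine (contMDiffAt_chart_symm (mem_extChartAt_target x)).continuousAt.eventually ?_
    rw [extChartAt_to_inv]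
    exact (isOpen_extChartAt_source c).mem_nhds hxc
  have hτd : ∀ z, z ∈ (extChartAt 𝓘(ℝ, E) x).target →
      (extChartAt 𝓘(ℝ, E) x).symm z ∈ (extChartAt 𝓘(ℝ, E) c).source →
      HasFDerivAt τ (chartD c ((extChartAt 𝓘(ℝ, E) x).symm z) ∘L chartSymmD x z) z :=
    fun z h1 h2 => ((hasMFDerivAt_chart h2).comp z (hasMFDerivAt_chart_symm h1)).hasFDerivAt
  have hτ : ContDiffAt ℝ ∞ τ (extChartAt 𝓘(ℝ, E) x x) := by
    rw [← contMDiffAt_iff_contDiffAt]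
    refine ContMDiffAt.comp (g := extChartAt 𝓘(ℝ, E) c) _ ?_
      (contMDiffAt_chart_symm (mem_extChartAt_target x))
    rw [extChartAt_to_inv]
    exact contMDiffAt_chart hxc
  have hτx : τ (extChartAt 𝓘(ℝ, E) x x) = y := by
    simp only [τ]
    rw [extChartAt_to_inv, hx, (extChartAt 𝓘(ℝ, E) c).right_inv hy]
  have hpull : inChart x w =ᶠ[𝓝 (extChartAt 𝓘(ℝ, E) x x)]
      fun z => (inChart c w (τ z)).compContinuousLinearMap (fderiv ℝ τ z) := by
    filter_upwards [hev] with z hz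
    ext v
    rw [inChart_apply, ContinuousAlternatingMap.compContinuousLinearMap_apply, inChart_apply,
      (hτd z hz.1 hz.2).fderiv]
    simp only [τ, Function.comp_def, ContinuousLinearMap.comp_apply]
    have h2 : ∀ i, chartSymmD c (extChartAt 𝓘(ℝ, E) c ((extChartAt 𝓘(ℝ, E) x).symm z))
        (chartD c ((extChartAt 𝓘(ℝ, E) x).symm z) (chartSymmD x z (v i))) = chartSymmD x z (v i) :=
      fun i => chartSymmD_chartD hz.2 _
    simp only [h2]
    rw [(extChartAt 𝓘(ℝ, E) c).left_inv hz.2]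
  have hdw : DifferentiableAt ℝ (inChart c w) (τ (extChartAt 𝓘(ℝ, E) x x)) := by
    rw [hτx]
    exact (hw.contDiffAt ((isOpen_extChartAt_target c).mem_nhds hy)).differentiableAt (by simp)
  have hext : extDeriv (inChart x w) (extChartAt 𝓘(ℝ, E) x x) =
      (extDeriv (inChart c w) y).compContinuousLinearMap (chartD c x ∘L
        chartSymmD x (extChartAt 𝓘(ℝ, E) x x)) := by
    have hd := hτd _ (mem_extChartAt_target x) (by rwa [extChartAt_to_inv])
    rw [hpull.extDeriv_eq, extDeriv_pullback hdw (hτ.of_le (m := 2) (by norm_cast))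
      (by simp), hτx, hd.fderiv, extChartAt_to_inv]
  ext v
  rw [inChart_apply]
  change (extDeriv (inChart x w) (extChartAt 𝓘(ℝ, E) x x)) (fun i => chartD x x (chartSymmD c y (v i)))
    = _
  rw [hext, ContinuousAlternatingMap.compContinuousLinearMap_apply]
  congr 1
  funext i
  simp only [Function.comp_def, ContinuousLinearMap.comp_apply]
  rw [chartSymmD_chartD hxx, hx, chartD_chartSymmD hy]

end FormsInCharts

end LCS

namespace LCS

/-! ### Partial derivatives on [0, 1] × O. -/

section SlabCalculus

theorem slab_mem_nhds {X : Type*} [TopologicalSpace X] {O : Set X} (hO : IsOpen O) {p : ℝ × X} (hp : p ∈ Ioo (0 : ℝ) 1 ×ˢ O) :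
    Icc (0 : ℝ) 1 ×ˢ O ∈ 𝓝 p :=
  Filter.mem_of_superset ((isOpen_Ioo.prod hO).mem_nhds hp)
    (prod_mono Ioo_subset_Icc_self subset_rfl)

variable {E : Type*} [NormedAddCommGroup E] [NormedSpace ℝ E]
variable {W : Type*} [NormedAddCommGroup W] [NormedSpace ℝ W]

theorem uniqueDiffOn_slab {O : Set E} (hO : IsOpen O) : UniqueDiffOn ℝ (Icc (0 : ℝ) 1 ×ˢ O) :=
  (uniqueDiffOn_Icc zero_lt_one).prod hO.uniqueDiffOn

/-- Even at times 0 and 1 the space derivative is two-sided, because O is open. -/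
theorem hasFDerivAt_slab_snd {O : Set E} (hO : IsOpen O) {F : ℝ × E → W}
    {p : ℝ × E} (hF : DifferentiableWithinAt ℝ F (Icc (0 : ℝ) 1 ×ˢ O) p)
    (hp : p ∈ Icc (0 : ℝ) 1 ×ˢ O) :
    HasFDerivAt (fun z => F (p.1, z))
      (fderivWithin ℝ F (Icc (0 : ℝ) 1 ×ˢ O) p ∘L ContinuousLinearMap.inr ℝ ℝ E) p.2 := by
  have h1 : HasFDerivWithinAt F (fderivWithin ℝ F (Icc (0 : ℝ) 1 ×ˢ O) p) (Icc (0 : ℝ) 1 ×ˢ O)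
      (p.1, p.2) := hF.hasFDerivWithinAt
  have h2 : HasFDerivWithinAt (fun z : E => (p.1, z)) (ContinuousLinearMap.inr ℝ ℝ E) O p.2 :=
    (hasFDerivAt_prodMk_right p.1 p.2).hasFDerivWithinAt
  exact (h1.comp p.2 h2 fun z hz => ⟨hp.1, hz⟩).hasFDerivAt (hO.mem_nhds hp.2)

theorem hasDerivWithinAt_slab_fst {O : Set E} {F : ℝ × E → W}
    (hF : ContDiffOn ℝ ∞ F (Icc (0 : ℝ) 1 ×ˢ O)) {p : ℝ × E} (hp : p ∈ Icc (0 : ℝ) 1 ×ˢ O) :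
    HasDerivWithinAt (fun s => F (s, p.2))
      (fderivWithin ℝ F (Icc (0 : ℝ) 1 ×ˢ O) p (1, 0)) (Icc 0 1) p.1 := by
  have h1 : HasFDerivWithinAt F (fderivWithin ℝ F (Icc (0 : ℝ) 1 ×ˢ O) p) (Icc (0 : ℝ) 1 ×ˢ O)
      (p.1, p.2) := (hF.differentiableOn (by simp) p hp).hasFDerivWithinAt
  have h2 : HasDerivWithinAt (fun s : ℝ => (s, p.2)) ((1, 0) : ℝ × E) (Icc 0 1) p.1 :=
    (hasDerivWithinAt_id _ _).prodMk (hasDerivWithinAt_const _ _ _)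
  exact h1.comp_hasDerivWithinAt p.1 h2 (fun s hs => (⟨hs, hp.2⟩ : (s, p.2) ∈ Icc (0 : ℝ) 1 ×ˢ O))

theorem contDiffOn_slab_fderivWithin {O : Set E} (hO : IsOpen O) {F : ℝ × E → W}
    (hF : ContDiffOn ℝ ∞ F (Icc (0 : ℝ) 1 ×ˢ O)) (v : ℝ × E) :
    ContDiffOn ℝ ∞ (fun p => fderivWithin ℝ F (Icc (0 : ℝ) 1 ×ˢ O) p v)
      (Icc (0 : ℝ) 1 ×ˢ O) :=
  (hF.fderivWithin (m := ∞) (uniqueDiffOn_slab hO) (by simp)).clm_apply contDiffOn_const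

/-- The derivative in the space directions of a smooth function is smooth. -/
theorem contDiffOn_slab_fderiv_snd {O : Set E} (hO : IsOpen O) {F : ℝ × E → W}
    (hF : ContDiffOn ℝ ∞ F (Icc (0 : ℝ) 1 ×ˢ O)) (v : E) :
    ContDiffOn ℝ ∞ (fun p : ℝ × E => fderiv ℝ (fun z => F (p.1, z)) p.2 v)
      (Icc (0 : ℝ) 1 ×ˢ O) :=
  (contDiffOn_slab_fderivWithin hO hF (0, v)).congr fun p hp => by
    rw [(hasFDerivAt_slab_snd hO (hF.differentiableOn (by simp) p hp) hp).fderiv]; simp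

/-- The time derivative of a smooth function is smooth. -/
theorem contDiffOn_slab_derivWithin_fst {O : Set E} (hO : IsOpen O) {F : ℝ × E → W}
    (hF : ContDiffOn ℝ ∞ F (Icc (0 : ℝ) 1 ×ˢ O)) :
    ContDiffOn ℝ ∞ (fun p : ℝ × E => derivWithin (fun s => F (s, p.2)) (Icc 0 1) p.1)
      (Icc (0 : ℝ) 1 ×ˢ O) :=
  (contDiffOn_slab_fderivWithin hO hF (1, 0)).congr fun p hp =>
    (hasDerivWithinAt_slab_fst hF hp).derivWithin (uniqueDiffOn_Icc zero_lt_one p.1 hp.1)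

end SlabCalculus

/-! ### The hypotheses on ω, θ and α in coordinates. -/

section FamiliesInCharts

universe u

variable {E : Type u} [NormedAddCommGroup E] [NormedSpace ℝ E]
variable {M : Type*} [TopologicalSpace M] [ChartedSpace E M]

theorem contDiffOn_linChart {α : ℝ → Form E M 1} (hα : SmoothFamily α) (c : M) :
    ContDiffOn ℝ ∞ (linChart c α) (Icc (0 : ℝ) 1 ×ˢ (extChartAt 𝓘(ℝ, E) c).target) :=
  (lin E).contDiff.comp_contDiffOn (hα c)

theorem contDiff_bil : ContDiff ℝ ∞ (bil E) :=
  ContinuousLinearMap.contDiff (𝕜 := ℝ) (E := E [⋀^Fin 2]→L[ℝ] ℝ) (F := E →L[ℝ] E →L[ℝ] ℝ) (bil E)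

theorem contDiffOn_bilChart {w : ℝ → Form E M 2} (hw : SmoothFamily w) (c : M) :
    ContDiffOn ℝ ∞ (bilChart c w) (Icc (0 : ℝ) 1 ×ˢ (extChartAt 𝓘(ℝ, E) c).target) :=
  contDiff_bil.comp_contDiffOn (hw c)

theorem SmoothFamily.contDiffOn_inChart {k : ℕ} {w : ℝ → Form E M k} (hw : SmoothFamily w) (c : M)
    {t : ℝ} (ht : t ∈ Icc (0 : ℝ) 1) :
    ContDiffOn ℝ ∞ (inChart c (w t)) (extChartAt 𝓘(ℝ, E) c).target :=
  (hw c).comp (contDiff_const.prodMk contDiff_id).contDiffOn fun _ hy => ⟨ht, hy⟩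

theorem bilChart_swap (c : M) (w : ℝ → Form E M 2) (p : ℝ × E) (u v : E) :
    bilChart c w p u v = -bilChart c w p v u := bil_swap _ _ _

variable [IsManifold 𝓘(ℝ, E) ∞ M]

theorem bilChart_nondegenerate {w : ℝ → Form E M 2} {c : M} {p : ℝ × E}
    (hp : p.2 ∈ (extChartAt 𝓘(ℝ, E) c).target)
    (hw : NondegenerateAt (w p.1) ((extChartAt 𝓘(ℝ, E) c).symm p.2)) {u : E}
    (hu : ∀ v, bilChart c w p u v = 0) : u = 0 := by
  have h : chartSymmD c p.2 u = 0 := by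
    refine hw _ fun v => ?_
    have h1 : ∀ v : E, bil E (formAt (w p.1) ((extChartAt 𝓘(ℝ, E) c).symm p.2))
        (chartSymmD c p.2 u) v = 0 := fun v => by
      have h2 := chartSymmD_chartD ((extChartAt 𝓘(ℝ, E) c).map_target hp) v
      rw [(extChartAt 𝓘(ℝ, E) c).right_inv hp] at h2
      rw [← h2, ← bilChart_apply, hu]
    simp only [bil_apply] at h1
    exact h1 v
  rw [← chartD_chartSymmD hp u, h, map_zero]

theorem bilChart_eq_of_primitive {w : ℝ → Form E M 2} {θ α : ℝ → Form E M 1} (hα : SmoothFamily α)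
    (hprim : ∀ t ∈ Icc (0 : ℝ) 1, ∀ x, w t x = extD (α t) x - wedge (θ t) (α t) x) {c : M}
    {p : ℝ × E} (hp : p ∈ Icc (0 : ℝ) 1 ×ˢ (extChartAt 𝓘(ℝ, E) c).target) (u v : E) :
    bilChart c w p u v = fderiv ℝ (fun z => linChart c α (p.1, z)) p.2 u v
      - fderiv ℝ (fun z => linChart c α (p.1, z)) p.2 v u
      - (linChart c θ p u * linChart c α p v - linChart c θ p v * linChart c α p u) := by
  have hs := hα.contDiffOn_inChart c hp.1
  have h : inChart c (w p.1) p.2 = extDeriv (inChart c (α p.1)) p.2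
      - wedgeOne (inChart c (θ p.1) p.2) (inChart c (α p.1) p.2) := by
    rw [← inChart_extD hs hp.2, ← inChart_wedge, ← inChart_sub]
    congr 1
    exact funext (hprim p.1 hp.1)
  have hd : DifferentiableAt ℝ (inChart c (α p.1)) p.2 :=
    (hs.contDiffAt ((isOpen_extChartAt_target c).mem_nhds hp.2)).differentiableAt (by simp)
  rw [bilChart, bil_apply, h, ContinuousAlternatingMap.sub_apply, extDeriv_one_apply hd,
    wedgeOne_one_apply]
  rfl

theorem bilChart_lee {w : ℝ → Form E M 2} {θ : ℝ → Form E M 1} (hw : SmoothFamily w)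
    (hθ : ∀ t ∈ Icc (0 : ℝ) 1, ∀ x, extD (w t) x = wedge (θ t) (w t) x) {c : M}
    {p : ℝ × E} (hp : p ∈ Icc (0 : ℝ) 1 ×ˢ (extChartAt 𝓘(ℝ, E) c).target) (u v z : E) :
    fderiv ℝ (fun z => bilChart c w (p.1, z)) p.2 u v z
      - fderiv ℝ (fun z => bilChart c w (p.1, z)) p.2 v u z
      + fderiv ℝ (fun z => bilChart c w (p.1, z)) p.2 z u v =
    linChart c θ p u * bilChart c w p v z - linChart c θ p v * bilChart c w p u z
      + linChart c θ p z * bilChart c w p u v := by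
  have hs := hw.contDiffOn_inChart c hp.1
  have h : extDeriv (inChart c (w p.1)) p.2 =
      wedgeOne (inChart c (θ p.1) p.2) (inChart c (w p.1) p.2) := by
    rw [← inChart_extD hs hp.2, ← inChart_wedge]
    congr 1
    exact funext (hθ p.1 hp.1)
  have hd : DifferentiableAt ℝ (inChart c (w p.1)) p.2 :=
    (hs.contDiffAt ((isOpen_extChartAt_target c).mem_nhds hp.2)).differentiableAt (by simp)
  have h' := extDeriv_two_apply hd u v z
  rw [h, wedgeOne_two_apply] at h'
  exact h'.symm

end FamiliesInCharts

/-! ### Recovering a covector ϑ from ϑ ∧ B. -/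

section LeeFormRegularity

variable {E : Type*} [NormedAddCommGroup E] [NormedSpace ℝ E] [FiniteDimensional ℝ E]

/-- Let H be the kernel of B e. If B vanished on H × H, non-degeneracy would force H into the line
of e, and the dimension would be at most 2. -/
theorem exists_orthogonal_pair (hdim : 4 ≤ Module.finrank ℝ E) {B : E →L[ℝ] E →L[ℝ] ℝ}
    (hB : ∀ u, (∀ v, B u v = 0) → u = 0) {e : E} (he : e ≠ 0) :
    ∃ b c, B e b = 0 ∧ B e c = 0 ∧ B b c = 1 := by
  by_contra! hcon
  have hvan : ∀ b c, B e b = 0 → B e c = 0 → B b c = 0 := by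
    intro b c hb hc
    by_contra h
    refine hcon b ((B b c)⁻¹ • c) hb (by simp [hc]) ?_
    rw [map_smul, smul_eq_mul, inv_mul_cancel₀ h]
  obtain ⟨z, hz⟩ : ∃ z, B e z = 1 := by
    obtain ⟨z, hz⟩ : ∃ z, B e z ≠ 0 := by
      by_contra! h
      exact he (hB e h)
    exact ⟨(B e z)⁻¹ • z, by rw [map_smul, smul_eq_mul, inv_mul_cancel₀ hz]⟩
  have hker : LinearMap.ker (B e).toLinearMap ≤ Submodule.span ℝ {e} := by
    intro b hb
    have hb' : B e b = 0 := hb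
    -- For each u the vector u - B e u • z is in the kernel of B e, so B b u = B b z * B e u, and
    -- non-degeneracy applies.
    have h : b - B b z • e = 0 := by
      refine hB _ fun u => ?_
      have h1 : B b (u - B e u • z) = 0 := hvan _ _ hb' (by simp [hz])
      simp only [map_sub, map_smul, smul_eq_mul, sub_apply, smul_apply] at h1 ⊢
      linarith
    rw [Submodule.mem_span_singleton]
    exact ⟨B b z, (sub_eq_zero.1 h).symm⟩
  have h1 := Submodule.finrank_mono hker
  have h2 := finrank_span_singleton (K := ℝ) he
  have h3 := LinearMap.finrank_range_add_finrank_ker (B e).toLinearMap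
  have h4 := Submodule.finrank_le (LinearMap.range (B e).toLinearMap)
  rw [Module.finrank_self] at h4
  omega

/-- A linear system A(p) ϑ(p) = r(p) with smooth A and r and A(p₀) = 1 has a smooth solution near
p₀, as inversion of operators is smooth. Having A equal to the identity at p₀ spares any choice of
inverse. -/
theorem contDiffWithinAt_of_sum_apply {P D ι : Type*} [NormedAddCommGroup P] [NormedSpace ℝ P]
    [NormedAddCommGroup D] [NormedSpace ℝ D] [CompleteSpace D] [Fintype ι] {s : Set P} {p₀ : P}
    {f : ι → P → ℝ} {T : ι → D →L[ℝ] D} {ϑ : P → D}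
    (hf : ∀ i, ContDiffWithinAt ℝ ∞ (f i) s p₀) (h₀ : ∀ d, ∑ i, f i p₀ • T i d = d)
    (h : ContDiffWithinAt ℝ ∞ (fun p => ∑ i, f i p • T i (ϑ p)) s p₀) :
    ContDiffWithinAt ℝ ∞ ϑ s p₀ := by
  let A : P → D →L[ℝ] D := fun p => ∑ i, f i p • T i
  have hAd : ∀ p d, A p d = ∑ i, f i p • T i d := fun p d => by
    simp only [A, sum_apply, smul_apply]
  have hA : ContDiffWithinAt ℝ ∞ A s p₀ := ContDiffWithinAt.sum fun i _ =>
    (hf i).smul contDiffWithinAt_const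
  have hA0 : A p₀ = 1 := by
    ext d
    rw [hAd, h₀, one_apply_eq_self]
  have hinv : ContDiffWithinAt ℝ ∞ (fun p => Ring.inverse (A p)) s p₀ := by
    have h1 := contDiffAt_ringInverse (n := ∞) ℝ (1 : (D →L[ℝ] D)ˣ)
    rw [Units.val_one, ← hA0] at h1
    exact h1.comp_contDiffWithinAt p₀ hA
  have hunit : ∀ᶠ p in 𝓝[s] p₀, IsUnit (A p) :=
    hA.continuousWithinAt.eventually_mem (Units.isOpen.mem_nhds (by rw [hA0]; exact isUnit_one))
  have hev : ∀ p, IsUnit (A p) → ϑ p = Ring.inverse (A p) (∑ i, f i p • T i (ϑ p)) := by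
    intro p hu
    rw [← hAd, ← mul_apply_eq_comp, Ring.inverse_mul_cancel _ hu, one_apply_eq_self]
  refine (hinv.clm_apply h).congr_of_eventuallyEq ?_ (hev p₀ (hA0 ▸ isUnit_one))
  filter_upwards [hunit] with p hp using hev p hp

/-- A family of covectors `ϑ` is determined by `ϑ ∧ B` for a non-degenerate `B`, smoothly. -/
theorem contDiffWithinAt_of_wedge (hdim : 4 ≤ Module.finrank ℝ E) {P : Type*}
    [NormedAddCommGroup P] [NormedSpace ℝ P] {s : Set P} {p₀ : P} (hp₀ : p₀ ∈ s)
    {B : P → E →L[ℝ] E →L[ℝ] ℝ} {ϑ : P → E →L[ℝ] ℝ} {R : P → E → E → E → ℝ}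
    (hB : ContDiffWithinAt ℝ ∞ B s p₀) (hnd : ∀ u, (∀ v, B p₀ u v = 0) → u = 0)
    (hR : ∀ u v z, ContDiffWithinAt ℝ ∞ (fun p => R p u v z) s p₀)
    (h : ∀ p ∈ s, ∀ u v z, R p u v z = ϑ p u * B p v z - ϑ p v * B p u z + ϑ p z * B p u v) :
    ContDiffWithinAt ℝ ∞ ϑ s p₀ := by
  let e := Module.finBasis ℝ E
  choose b c hb hc hbc using fun i => exists_orthogonal_pair hdim hnd (e.ne_zero i)
  let coord : ∀ i, E →L[ℝ] ℝ := fun i => LinearMap.toContinuousLinearMap (e.coord i)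
  let T : E → ∀ i, (E →L[ℝ] ℝ) →L[ℝ] (E →L[ℝ] ℝ) := fun u i =>
    (ContinuousLinearMap.apply ℝ ℝ u).smulRight (coord i)
  have hT : ∀ u i (ℓ : E →L[ℝ] ℝ), T u i ℓ = ℓ u • coord i := fun u i ℓ => rfl
  have hBuv : ∀ u v, ContDiffWithinAt ℝ ∞ (fun p => B p u v) s p₀ := fun u v =>
    (hB.clm_apply contDiffWithinAt_const).clm_apply contDiffWithinAt_const
  let I := Fin (Module.finrank ℝ E)
  -- The system is ∑ (ϑ ∧ B)(e_i, b_i, c_i) e_i^*, and the three blocks are the three terms of the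
  -- wedge product. At p₀ the relations between e_i, b_i and c_i leave only ϑ(e_i), so the sum is ϑ.
  refine contDiffWithinAt_of_sum_apply (ι := I ⊕ I ⊕ I)
    (f := Sum.elim (fun i p => B p (b i) (c i))
      (Sum.elim (fun i p => -B p (e i) (c i)) fun i p => B p (e i) (b i)))
    (T := Sum.elim (fun i => T (e i) i) (Sum.elim (fun i => T (b i) i) fun i => T (c i) i))
    ?_ (fun ℓ => ?_) ?_
  · rintro (i | i | i)
    exacts [hBuv _ _, (hBuv _ _).neg, hBuv _ _]
  · simp only [Fintype.sum_sum_type, Sum.elim_inl, Sum.elim_inr, hb, hc, hbc, hT, one_smul, neg_zero,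
      zero_smul, Finset.sum_const_zero, add_zero]
    ext x
    conv_rhs => rw [← e.sum_repr x, map_sum]
    rw [sum_apply]
    refine Finset.sum_congr rfl fun i _ => ?_
    rw [map_smul, smul_eq_mul, smul_apply, smul_eq_mul, mul_comm]
    rfl
  · have hrhs : ContDiffWithinAt ℝ ∞ (fun p => ∑ i, R p (e i) (b i) (c i) • coord i) s p₀ :=
      ContDiffWithinAt.sum fun i _ => (hR _ _ _).smul contDiffWithinAt_const
    refine hrhs.congr_of_mem (fun p hp => ?_) hp₀
    simp only [Fintype.sum_sum_type, Sum.elim_inl, Sum.elim_inr, hT, ← Finset.sum_add_distrib]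
    refine Finset.sum_congr rfl fun i _ => ?_
    rw [h p hp, smul_smul, smul_smul, smul_smul, ← add_smul, ← add_smul]
    congr 1
    ring

end LeeFormRegularity

/-! ### Joint smoothness of the Lee forms. -/

section LeeFamilies

universe u

variable {E : Type u} [NormedAddCommGroup E] [NormedSpace ℝ E] [FiniteDimensional ℝ E]
variable {M : Type*} [TopologicalSpace M] [ChartedSpace E M] [IsManifold 𝓘(ℝ, E) ∞ M]

/-- In coordinates dω = θ ∧ ω, with ω and hence dω smooth in (t, y), so θ is smooth too. -/
theorem contDiffOn_linChart_lee (hdim : 4 ≤ Module.finrank ℝ E) {w : ℝ → Form E M 2}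
    {θ : ℝ → Form E M 1} (hw : SmoothFamily w)
    (hnd : ∀ t ∈ Icc (0 : ℝ) 1, ∀ x, NondegenerateAt (w t) x)
    (hθ : ∀ t ∈ Icc (0 : ℝ) 1, ∀ x, extD (w t) x = wedge (θ t) (w t) x) (c : M) :
    ContDiffOn ℝ ∞ (linChart c θ) (Icc (0 : ℝ) 1 ×ˢ (extChartAt 𝓘(ℝ, E) c).target) := by
  have hB := contDiffOn_bilChart hw c
  have hD := contDiffOn_slab_fderiv_snd (isOpen_extChartAt_target c) hB
  have hD' : ∀ u v z, ContDiffOn ℝ ∞ (fun p : ℝ × E =>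
      fderiv ℝ (fun z => bilChart c w (p.1, z)) p.2 u v z)
      (Icc (0 : ℝ) 1 ×ˢ (extChartAt 𝓘(ℝ, E) c).target) := fun u v z =>
    ((hD u).clm_apply contDiffOn_const).clm_apply contDiffOn_const
  intro p hp
  exact contDiffWithinAt_of_wedge hdim hp (hB p hp)
    (fun u => bilChart_nondegenerate hp.2 (hnd _ hp.1 _))
    (fun u v z => (((hD' u v z).sub (hD' v u z)).add (hD' z u v)) p hp)
    (fun q hq u v z => bilChart_lee hw hθ hq u v z)

end LeeFamilies

end LCS

namespace LCS

/-! ### Smooth families of primitives. -/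

section SmoothPrimitives

universe u

variable {E : Type u} [NormedAddCommGroup E] [NormedSpace ℝ E] [FiniteDimensional ℝ E]

/-- Primitives, vanishing at the centre of a ball, of a smooth family of `1`-forms are a smooth
family. -/
theorem contDiffOn_sub_of_hasFDerivAt {O : Set E} (hO : IsOpen O) {β : ℝ × E → E →L[ℝ] ℝ}
    (hβ : ContDiffOn ℝ ∞ β (Icc (0 : ℝ) 1 ×ˢ O)) {H : ℝ → E → ℝ}
    (hH : ∀ t ∈ Icc (0 : ℝ) 1, ∀ y ∈ O, HasFDerivAt (H t) (β (t, y)) y) {y₀ : E} {r : ℝ}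
    (hr : Metric.closedBall y₀ r ⊆ O) :
    ContDiffOn ℝ ∞ (fun p : ℝ × E => H p.1 p.2 - H p.1 y₀)
      (Icc (0 : ℝ) 1 ×ˢ Metric.ball y₀ r) := by
  rw [contDiffOn_infty]
  intro m
  -- Postcomposition requires a globally defined C^m map; agreement with β is needed only on the
  -- closed ball, which contains the rays from y₀.
  obtain ⟨G, hG, hGβ⟩ := exists_contDiff_extension hO Metric.isClosed_closedBall hr hβ m
  let L : ℝ × E →ₗ[ℝ] C(Icc (0 : ℝ) 1, ℝ × E) :=
    { toFun := fun p => ⟨fun s => (p.1, (s : ℝ) • p.2), by fun_prop⟩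
      map_add' := fun p q => by ext s <;> simp
      map_smul' := fun a p => by
        ext s
        · simp
        · simp [smul_comm a (s : ℝ) p.2] }
  -- The curve s ↦ (t, y₀ + s • (y - y₀)) depends affinely on (t, y), so integrating `G` along it is
  -- a C^m operation.
  let ray : ℝ × E → C(Icc (0 : ℝ) 1, ℝ × E) := fun p =>
    ContinuousMap.const _ (0, y₀) + LinearMap.toContinuousLinearMap L (p - (0, y₀))
  have hray : ContDiff ℝ m ray := contDiff_const.add
    ((LinearMap.toContinuousLinearMap L).contDiff.comp (contDiff_id.sub contDiff_const))
  let GC : C(ℝ × E, E →L[ℝ] ℝ) := ⟨G, hG.continuous⟩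
  have h1 : ContDiff ℝ m (fun p => volterra (E →L[ℝ] ℝ) (GC.comp (ray p))) :=
    (volterra (E →L[ℝ] ℝ)).contDiff.comp ((contDiff_postcomp m GC hG).comp hray)
  have h2 : ContDiff ℝ m (fun p : ℝ × E => volterra (E →L[ℝ] ℝ) (GC.comp (ray p)) 1 (p.2 - y₀)) :=
    ((ContinuousMap.evalCLM ℝ (1 : Icc (0 : ℝ) 1)).contDiff.comp h1).clm_apply
      (contDiff_snd.sub contDiff_const)
  refine h2.contDiffOn.congr fun p hp => ?_
  rw [volterra_apply]
  have hcont : Continuous fun x => GC.comp (ray p) (projIcc (0 : ℝ) 1 zero_le_one x) :=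
    (GC.comp (ray p)).continuous.comp continuous_projIcc
  rw [ContinuousLinearMap.intervalIntegral_apply (hcont.intervalIntegrable _ _)]
  have hball : ∀ s ∈ Icc (0 : ℝ) 1, y₀ + s • (p.2 - y₀) ∈ Metric.closedBall y₀ r := by
    intro s hs
    rw [mem_closedBall_iff_norm, add_sub_cancel_left, norm_smul, Real.norm_of_nonneg hs.1]
    have := mem_ball_iff_norm.1 hp.2
    nlinarith [norm_nonneg (p.2 - y₀), hs.2]
  have hder : ∀ s ∈ uIcc (0 : ℝ) 1, HasDerivAt (fun s : ℝ => H p.1 (y₀ + s • (p.2 - y₀)))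
      (GC.comp (ray p) (projIcc (0 : ℝ) 1 zero_le_one s) (p.2 - y₀)) s := by
    intro s hs
    rw [uIcc_of_le zero_le_one] at hs
    have hval : GC.comp (ray p) (projIcc (0 : ℝ) 1 zero_le_one s) =
        β (p.1, y₀ + s • (p.2 - y₀)) := by
      rw [← hGβ (p.1, y₀ + s • (p.2 - y₀)) ⟨hp.1, hball s hs⟩, projIcc_of_mem _ hs]
      simp [ray, GC, L]
    rw [hval]
    refine (hH p.1 hp.1 _ (hr (hball s hs))).comp_hasDerivAt s ?_
    simpa using ((hasDerivAt_id s).smul_const (p.2 - y₀)).const_add y₀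
  have := intervalIntegral.integral_eq_sub_of_hasDerivAt hder
    ((hcont.clm_apply continuous_const).intervalIntegrable _ _)
  simpa using this.symm

variable {M : Type*} [TopologicalSpace M] [ChartedSpace E M]

/-- A family of primitives of a smooth family of `1`-forms on a manifold becomes smooth after
subtraction of a function that is constant on connected components. -/
theorem exists_smooth_primitive {β : M → ℝ × E → E →L[ℝ] ℝ} {h : ℝ → M → ℝ}
    (hβ : ∀ c, ContDiffOn ℝ ∞ (β c) (Icc (0 : ℝ) 1 ×ˢ (extChartAt 𝓘(ℝ, E) c).target))
    (hh : ∀ c, ∀ t ∈ Icc (0 : ℝ) 1, ∀ y ∈ (extChartAt 𝓘(ℝ, E) c).target,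
      HasFDerivAt (fun z => h t ((extChartAt 𝓘(ℝ, E) c).symm z)) (β c (t, y)) y) :
    ∃ h' : ℝ → M → ℝ,
      (∀ c, ContDiffOn ℝ ∞ (fun p : ℝ × E => h' p.1 ((extChartAt 𝓘(ℝ, E) c).symm p.2))
        (Icc (0 : ℝ) 1 ×ˢ (extChartAt 𝓘(ℝ, E) c).target)) ∧
      ∀ c, ∀ t ∈ Icc (0 : ℝ) 1, ∀ y ∈ (extChartAt 𝓘(ℝ, E) c).target,
        HasFDerivAt (fun z => h' t ((extChartAt 𝓘(ℝ, E) c).symm z)) (β c (t, y)) y := by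
  have : LocallyConnectedSpace M := ChartedSpace.locallyConnectedSpace E M
  have hloc : ∀ c, ∀ y₀ ∈ (extChartAt 𝓘(ℝ, E) c).target, ∃ r > 0,
      Metric.ball y₀ r ⊆ (extChartAt 𝓘(ℝ, E) c).target ∧
      ContDiffOn ℝ ∞ (fun p : ℝ × E => h p.1 ((extChartAt 𝓘(ℝ, E) c).symm p.2)
        - h p.1 ((extChartAt 𝓘(ℝ, E) c).symm y₀)) (Icc (0 : ℝ) 1 ×ˢ Metric.ball y₀ r) := by
    intro c y₀ hy₀
    obtain ⟨r, hr, hrO⟩ := Metric.nhds_basis_closedBall.mem_iff.1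
      ((isOpen_extChartAt_target (I := 𝓘(ℝ, E)) c).mem_nhds hy₀)
    exact ⟨r, hr, Metric.ball_subset_closedBall.trans hrO,
      contDiffOn_sub_of_hasFDerivAt (isOpen_extChartAt_target c) (hβ c) (hh c) hrO⟩
  -- One base point in each connected component; M need not be connected.
  let b : M → M := fun x => Quotient.out (x : ConnectedComponents M)
  have hb : ∀ x, connectedComponent (b x) = connectedComponent x := fun x =>
    ConnectedComponents.coe_eq_coe.1 (Quotient.out_eq _)
  have hb' : ∀ x x', x' ∈ connectedComponent x → b x' = b x := fun x x' hx' => by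
    have : (x' : ConnectedComponents M) = x := ConnectedComponents.coe_eq_coe'.2 hx'
    simp only [b, this]
  have hpath : ∀ x, ContDiffOn ℝ ∞ (fun t => h t x - h t (b x)) (Icc (0 : ℝ) 1) := by
    intro x
    -- Differences of h between nearby points are smooth in t by the local result, so smoothness of
    -- h(x') - h(b x) spreads over the whole component of `b x`.
    let S : Set M := {x' | ContDiffOn ℝ ∞ (fun t => h t x' - h t (b x)) (Icc (0 : ℝ) 1)}
    have hS : ∀ x₀, ∀ᶠ x' in 𝓝 x₀, x' ∈ S ↔ x₀ ∈ S := by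
      intro x₀
      obtain ⟨r, hr, hrO, hsm⟩ := hloc x₀ _ (mem_extChartAt_target x₀)
      filter_upwards [(isOpen_extChartAt_source (I := 𝓘(ℝ, E)) x₀).mem_nhds
          (mem_extChartAt_source x₀),
        (continuousAt_extChartAt (I := 𝓘(ℝ, E)) x₀).preimage_mem_nhds (Metric.ball_mem_nhds _ hr)]
        with x' hx' hx'r
      have h1 : ContDiffOn ℝ ∞ (fun t => h t x' - h t x₀) (Icc (0 : ℝ) 1) := by
        have h2 := hsm.comp (f := fun t : ℝ => (t, extChartAt 𝓘(ℝ, E) x₀ x'))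
          (contDiff_id.prodMk contDiff_const).contDiffOn fun t ht => ⟨ht, hx'r⟩
        refine h2.congr fun t _ => ?_
        simp only [Function.comp_apply, extChartAt_to_inv, (extChartAt 𝓘(ℝ, E) x₀).left_inv hx']
      constructor
      · intro h3
        refine (ContDiffOn.sub h3 h1).congr fun t _ => ?_
        ring
      · intro h3
        refine (ContDiffOn.add h3 h1).congr fun t _ => ?_
        ring
    have hclopen : IsClopen S := by
      refine ⟨⟨isOpen_iff_mem_nhds.2 fun x₀ hx₀ => ?_⟩, isOpen_iff_mem_nhds.2 fun x₀ hx₀ => ?_⟩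
      · filter_upwards [hS x₀] with x' hx' using fun h' => hx₀ (hx'.1 h')
      · filter_upwards [hS x₀] with x' hx' using hx'.2 hx₀
    have hbS : b x ∈ S := by
      change ContDiffOn ℝ ∞ (fun t => h t (b x) - h t (b x)) (Icc (0 : ℝ) 1)
      simp only [sub_self]
      exact contDiffOn_const
    have hsub := hclopen.connectedComponent_subset hbS
    rw [hb x] at hsub
    exact hsub mem_connectedComponent
  have hconst : ∀ c, ∀ y₀ ∈ (extChartAt 𝓘(ℝ, E) c).target, ∀ᶠ y in 𝓝 y₀,
      b ((extChartAt 𝓘(ℝ, E) c).symm y) = b ((extChartAt 𝓘(ℝ, E) c).symm y₀) := by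
    intro c y₀ hy₀
    filter_upwards [(continuousAt_extChartAt_symm'' hy₀).preimage_mem_nhds
      (isOpen_connectedComponent.mem_nhds mem_connectedComponent)] with y hy using hb' _ _ hy
  refine ⟨fun t x => h t x - h t (b x), fun c p hp => ?_, fun c t ht y hy => ?_⟩
  · obtain ⟨r, hr, hrO, hsm⟩ := hloc c p.2 hp.2
    have h1 : ContDiffWithinAt ℝ ∞ (fun q : ℝ × E => h q.1 ((extChartAt 𝓘(ℝ, E) c).symm q.2)
        - h q.1 ((extChartAt 𝓘(ℝ, E) c).symm p.2))
        (Icc (0 : ℝ) 1 ×ˢ (extChartAt 𝓘(ℝ, E) c).target) p := by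
      refine (hsm p ⟨hp.1, Metric.mem_ball_self hr⟩).mono_of_mem_nhdsWithin ?_
      have h2 : univ ×ˢ Metric.ball p.2 r ∈ 𝓝 p := prod_mem_nhds Filter.univ_mem
        (Metric.ball_mem_nhds _ hr)
      filter_upwards [self_mem_nhdsWithin, mem_nhdsWithin_of_mem_nhds h2] with q hq hq2
      exact ⟨hq.1, hq2.2⟩
    have h3 : ContDiffWithinAt ℝ ∞ (fun q : ℝ × E => h q.1 ((extChartAt 𝓘(ℝ, E) c).symm p.2)
        - h q.1 (b ((extChartAt 𝓘(ℝ, E) c).symm p.2)))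
        (Icc (0 : ℝ) 1 ×ˢ (extChartAt 𝓘(ℝ, E) c).target) p :=
      ((hpath ((extChartAt 𝓘(ℝ, E) c).symm p.2)).comp contDiff_fst.contDiffOn
        fun q hq => hq.1) p hp
    refine (h1.add h3).congr_of_eventuallyEq ?_ (by simp)
    filter_upwards [mem_nhdsWithin_of_mem_nhds
      (continuous_snd.continuousAt.eventually (hconst c p.2 hp.2))] with q hq
    have hq' : b ((extChartAt 𝓘(ℝ, E) c).symm q.2) = b ((extChartAt 𝓘(ℝ, E) c).symm p.2) := hq
    rw [hq']
    ring
  · refine ((hh c t ht y hy).sub_const (h t (b ((extChartAt 𝓘(ℝ, E) c).symm y)))).congr_of_eventuallyEq ?_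
    filter_upwards [hconst c y hy] with z hz
    rw [hz]

end SmoothPrimitives

end LCS

namespace LCS

/-! ### Vectors dual to covectors under a non-degenerate form. -/

section DualVectors

variable {E : Type*} [NormedAddCommGroup E] [NormedSpace ℝ E] [FiniteDimensional ℝ E]

theorem exists_eq_of_nondegenerate {B : E →L[ℝ] E →L[ℝ] ℝ} (hB : ∀ u, (∀ v, B u v = 0) → u = 0)
    (ℓ : E →L[ℝ] ℝ) : ∃ u, ∀ v, B u v = ℓ v := by
  let T : E →ₗ[ℝ] Module.Dual ℝ E := ContinuousLinearMap.coeLM ℝ ∘ₗ B.toLinearMap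
  have hT : ∀ u v, T u v = B u v := fun u v => rfl
  have hinj : Function.Injective T := by
    rw [injective_iff_map_eq_zero]
    intro u hu
    exact hB u fun v => by rw [← hT, hu]; rfl
  obtain ⟨u, hu⟩ := (LinearMap.injective_iff_surjective_of_finrank_eq_finrank
    (Subspace.dual_finrank_eq (K := ℝ) (V := E)).symm).1 hinj ℓ.toLinearMap
  exact ⟨u, fun v => by rw [← hT, hu]; rfl⟩

/-- Vectors dual to a smooth family of covectors, with respect to a smooth family of non-degenerate
skew-symmetric bilinear forms, depend smoothly on the parameter. -/
theorem contDiffWithinAt_of_contraction {P : Type*} [NormedAddCommGroup P] [NormedSpace ℝ P]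
    {s : Set P} {p₀ : P} (hp₀ : p₀ ∈ s) {B : P → E →L[ℝ] E →L[ℝ] ℝ} {η : P → E →L[ℝ] ℝ} {Y : P → E}
    (hB : ContDiffWithinAt ℝ ∞ B s p₀) (hnd : ∀ u, (∀ v, B p₀ u v = 0) → u = 0)
    (hswap : ∀ u v, B p₀ u v = -B p₀ v u) (hη : ContDiffWithinAt ℝ ∞ η s p₀)
    (hY : ∀ p ∈ s, ∀ v, B p (Y p) v = η p v) : ContDiffWithinAt ℝ ∞ Y s p₀ := by
  let e := Module.finBasis ℝ E
  let coord : ∀ i, E →L[ℝ] ℝ := fun i => LinearMap.toContinuousLinearMap (e.coord i)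
  have hcoord : ∀ i x, coord i x = e.repr x i := fun i x => rfl
  choose u hu using fun i => exists_eq_of_nondegenerate hnd (coord i)
  have hsum : ∀ (b : E →L[ℝ] E →L[ℝ] ℝ) (d v : E), b d v = ∑ i, b (e i) v * coord i d := by
    intro b d v
    conv_lhs => rw [← e.sum_repr d, map_sum, sum_apply]
    refine Finset.sum_congr rfl fun i _ => ?_
    rw [map_smul, smul_apply, smul_eq_mul, mul_comm, hcoord]
  let I := Fin (Module.finrank ℝ E)
  -- With u_j dual to the j-th coordinate for B p₀, skew-symmetry at p₀ makes ∑ -B(d, u_j) e_j the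
  -- identity in d. At other p its value on `Y p` is ∑ -η(u_j) e_j, which is smooth.
  have key : ∀ (b : E →L[ℝ] E →L[ℝ] ℝ) (d : E), ∑ k : I × I, (-b (e k.1) (u k.2)) •
      (coord k.1).smulRight (e k.2) d = ∑ j, (-b d (u j)) • e j := by
    intro b d
    rw [Fintype.sum_prod_type_right]
    refine Finset.sum_congr rfl fun j _ => ?_
    simp only [ContinuousLinearMap.smulRight_apply, smul_smul]
    rw [← Finset.sum_smul, hsum b d (u j), ← Finset.sum_neg_distrib]
    simp only [neg_mul]
    rfl
  refine contDiffWithinAt_of_sum_apply (ι := I × I)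
    (f := fun k p => -B p (e k.1) (u k.2)) (T := fun k => (coord k.1).smulRight (e k.2))
    (fun k => ((hB.clm_apply contDiffWithinAt_const).clm_apply contDiffWithinAt_const).neg)
    (fun d => ?_) ?_
  · rw [key]
    conv_rhs => rw [← e.sum_repr d]
    refine Finset.sum_congr rfl fun j _ => ?_
    rw [hswap, hu, hcoord, neg_neg]
  · have h : ContDiffWithinAt ℝ ∞ (fun p => ∑ j, (-η p (u j)) • e j) s p₀ :=
      ContDiffWithinAt.sum fun j _ =>
        (hη.clm_apply contDiffWithinAt_const).neg.smul contDiffWithinAt_const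
    refine h.congr_of_mem (fun p hp => ?_) hp₀
    rw [key]
    simp only [hY p hp]

end DualVectors

/-! ### The vector field X with i_X ω = g α - ∂ₜα. -/

section MoserField

universe u

variable {E : Type u} [NormedAddCommGroup E] [NormedSpace ℝ E] [FiniteDimensional ℝ E]
variable {M : Type*} [TopologicalSpace M] [ChartedSpace E M] [IsManifold 𝓘(ℝ, E) ∞ M]

/-- X is chosen pointwise from a condition free of charts, so that its expressions in all charts
belong to one field; their smoothness follows from the dual equation in each chart. -/
theorem exists_moser_vectorField {w : ℝ → Form E M 2} {α : ℝ → Form E M 1} {g : ℝ → M → ℝ}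
    (hw : SmoothFamily w) (hnd : ∀ t ∈ Icc (0 : ℝ) 1, ∀ x, NondegenerateAt (w t) x)
    (hα : SmoothFamily α)
    (hg : ∀ c, ContDiffOn ℝ ∞ (fun p : ℝ × E => g p.1 ((extChartAt 𝓘(ℝ, E) c).symm p.2))
      (Icc (0 : ℝ) 1 ×ˢ (extChartAt 𝓘(ℝ, E) c).target)) :
    ∃ X : ℝ → M → E,
      (∀ c, ContDiffOn ℝ ∞ (chartVec c X) (Icc (0 : ℝ) 1 ×ˢ (extChartAt 𝓘(ℝ, E) c).target)) ∧
      ∀ c, ∀ p ∈ Icc (0 : ℝ) 1 ×ˢ (extChartAt 𝓘(ℝ, E) c).target, ∀ v,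
        bilChart c w p (chartVec c X p) v =
          g p.1 ((extChartAt 𝓘(ℝ, E) c).symm p.2) * linChart c α p v
          - fderivWithin ℝ (linChart c α) (Icc (0 : ℝ) 1 ×ˢ (extChartAt 𝓘(ℝ, E) c).target)
              p (1, 0) v := by
  classical
  let Q : ℝ → M → E → Prop := fun t x u => ∀ v : E, bil E (formAt (w t) x) u v =
    g t x * lin E (formAt (α t) x) v - derivWithin (fun s => lin E (formAt (α s) x) v) (Icc 0 1) t
  let η : M → ℝ × E → E →L[ℝ] ℝ := fun c p =>
    g p.1 ((extChartAt 𝓘(ℝ, E) c).symm p.2) • linChart c α p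
      - fderivWithin ℝ (linChart c α) (Icc (0 : ℝ) 1 ×ˢ (extChartAt 𝓘(ℝ, E) c).target) p (1, 0)
  have hη : ∀ c, ContDiffOn ℝ ∞ (η c) (Icc (0 : ℝ) 1 ×ˢ (extChartAt 𝓘(ℝ, E) c).target) := fun c =>
    ((hg c).smul (contDiffOn_linChart hα c)).sub
      (contDiffOn_slab_fderivWithin (isOpen_extChartAt_target c) (contDiffOn_linChart hα c) _)
  have hdw : ∀ c, ∀ p ∈ Icc (0 : ℝ) 1 ×ˢ (extChartAt 𝓘(ℝ, E) c).target, ∀ v,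
      derivWithin (fun s => lin E (formAt (α s) ((extChartAt 𝓘(ℝ, E) c).symm p.2))
        (chartSymmD c p.2 v)) (Icc 0 1) p.1 = fderivWithin ℝ (linChart c α)
          (Icc (0 : ℝ) 1 ×ˢ (extChartAt 𝓘(ℝ, E) c).target) p (1, 0) v := by
    intro c p hp v
    have h1 := (hasDerivWithinAt_slab_fst (contDiffOn_linChart hα c) hp).clm_apply
      (hasDerivWithinAt_const p.1 (Icc (0 : ℝ) 1) v)
    rw [map_zero, add_zero] at h1
    rw [← h1.derivWithin (uniqueDiffOn_Icc zero_lt_one p.1 hp.1)]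
    refine congrArg (fun f => derivWithin f (Icc (0 : ℝ) 1) p.1) (funext fun s => ?_)
    exact (linChart_apply c α (s, p.2) v).symm
  have hQ : ∀ c, ∀ p ∈ Icc (0 : ℝ) 1 ×ˢ (extChartAt 𝓘(ℝ, E) c).target, ∀ u,
      Q p.1 ((extChartAt 𝓘(ℝ, E) c).symm p.2) (chartSymmD c p.2 u) ↔
        ∀ v, bilChart c w p u v = η c p v := by
    intro c p hp u
    have h1 : ∀ v : E, chartSymmD c p.2 (chartD c ((extChartAt 𝓘(ℝ, E) c).symm p.2) v) = v := by
      intro v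
      have := chartSymmD_chartD ((extChartAt 𝓘(ℝ, E) c).map_target hp.2) v
      rwa [(extChartAt 𝓘(ℝ, E) c).right_inv hp.2] at this
    constructor
    · intro h v
      rw [bilChart_apply, h, hdw c p hp, sub_apply, smul_apply, smul_eq_mul, linChart_apply]
    · intro h v
      rw [← h1 v, ← bilChart_apply, h, hdw c p hp, sub_apply, smul_apply, smul_eq_mul,
        linChart_apply]
  have hex : ∀ t ∈ Icc (0 : ℝ) 1, ∀ x, ∃ u, Q t x u := by
    intro t ht x
    have hp : (t, extChartAt 𝓘(ℝ, E) x x) ∈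
        Icc (0 : ℝ) 1 ×ˢ (extChartAt 𝓘(ℝ, E) x).target := ⟨ht, mem_extChartAt_target x⟩
    obtain ⟨u, hu⟩ := exists_eq_of_nondegenerate (B := bilChart x w (t, extChartAt 𝓘(ℝ, E) x x))
      (fun u => bilChart_nondegenerate hp.2 (hnd t ht _)) (η x (t, extChartAt 𝓘(ℝ, E) x x))
    have := (hQ x _ hp u).2 hu
    simp only [extChartAt_to_inv] at this
    exact ⟨_, this⟩
  let X : ℝ → M → E := fun t x => if h : ∃ u, Q t x u then h.choose else 0
  have hX : ∀ t ∈ Icc (0 : ℝ) 1, ∀ x, Q t x (X t x) := by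
    intro t ht x
    have h := hex t ht x
    simp only [X, dif_pos h]
    exact h.choose_spec
  have heq : ∀ c, ∀ p ∈ Icc (0 : ℝ) 1 ×ˢ (extChartAt 𝓘(ℝ, E) c).target, ∀ v,
      bilChart c w p (chartVec c X p) v = η c p v := by
    intro c p hp
    rw [← hQ c p hp, chartSymmD_chartVec X hp.2]
    exact hX p.1 hp.1 _
  exact ⟨X, fun c p hp => contDiffWithinAt_of_contraction hp (contDiffOn_bilChart hw c p hp)
    (fun u => bilChart_nondegenerate hp.2 (hnd _ hp.1 _)) (bilChart_swap c w p) (hη c p hp) (heq c),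
    fun c p hp v => heq c p hp v⟩

end MoserField

end LCS

namespace LCS

/-! ### The infinitesimal Moser identity in coordinates. -/

section MoserIdentity

variable {E : Type*} [NormedAddCommGroup E] [NormedSpace ℝ E]

theorem hasDerivAt_comp_line {P W : Type*} [NormedAddCommGroup P] [NormedSpace ℝ P]
    [NormedAddCommGroup W] [NormedSpace ℝ W] {f : P → W} {p : P} (hf : DifferentiableAt ℝ f p)
    (k : P) : HasDerivAt (fun s : ℝ => f (p + s • k)) (fderiv ℝ f p k) 0 := by
  have h1 : HasDerivAt (fun s : ℝ => p + s • k) k 0 := by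
    simpa using ((hasDerivAt_id (0 : ℝ)).smul_const k).const_add p
  have h2 : HasFDerivAt f (fderiv ℝ f p) (p + (0 : ℝ) • k) := by
    simpa using hf.hasFDerivAt
  exact h2.comp_hasDerivAt 0 h1

theorem eventually_line {P : Type*} [NormedAddCommGroup P] [NormedSpace ℝ P] {Q : P → Prop} {p : P}
    (h : ∀ᶠ q in 𝓝 p, Q q) (k : P) : ∀ᶠ s : ℝ in 𝓝 0, Q (p + s • k) := by
  have hc : Continuous fun s : ℝ => p + s • k := by fun_prop
  refine hc.continuousAt.eventually ?_
  simpa using h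

theorem _root_.HasDerivAt.clm_const {V W : Type*} [NormedAddCommGroup V] [NormedSpace ℝ V]
    [NormedAddCommGroup W] [NormedSpace ℝ W] {f : ℝ → V →L[ℝ] W} {f' : V →L[ℝ] W} {x : ℝ}
    (hf : HasDerivAt f f' x) (v : V) : HasDerivAt (fun t => f t v) (f' v) x := by
  simpa using hf.clm_apply (hasDerivAt_const x v)

theorem hasDerivAt_fderiv_line {P W : Type*} [NormedAddCommGroup P] [NormedSpace ℝ P]
    [NormedAddCommGroup W] [NormedSpace ℝ W] {f : P → W} {p : P}
    (hf : DifferentiableAt ℝ (fderiv ℝ f) p) (k l : P) :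
    HasDerivAt (fun s : ℝ => fderiv ℝ f (p + s • k) l) (fderiv ℝ (fderiv ℝ f) p k l) 0 :=
  (hasDerivAt_comp_line hf k).clm_const l

theorem _root_.HasDerivAt.bilin {f : ℝ → E →L[ℝ] E →L[ℝ] ℝ} {f' : E →L[ℝ] E →L[ℝ] ℝ} {u v : ℝ → E}
    {u' v' : E} {x : ℝ} (hf : HasDerivAt f f' x) (hu : HasDerivAt u u' x)
    (hv : HasDerivAt v v' x) : HasDerivAt (fun t => f t (u t) (v t))
      (f' (u x) (v x) + f x u' (v x) + f x (u x) v') x :=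
  (hf.clm_apply hu).clm_apply hv

theorem hasDerivAt_covector_line {P : Type*} [NormedAddCommGroup P] [NormedSpace ℝ P]
    {f : P → E →L[ℝ] ℝ} {p : P} (hf : DifferentiableAt ℝ f p) (k : P) (v : E) :
    HasDerivAt (fun s : ℝ => f (p + s • k) v) (fderiv ℝ f p k v) 0 :=
  (hasDerivAt_comp_line hf k).clm_const v

theorem hasDerivAt_fderiv_covector_line {P : Type*} [NormedAddCommGroup P] [NormedSpace ℝ P]
    {f : P → E →L[ℝ] ℝ} {p : P} (hf : DifferentiableAt ℝ (fderiv ℝ f) p) (k l : P) (v : E) :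
    HasDerivAt (fun s : ℝ => fderiv ℝ f (p + s • k) l v) (fderiv ℝ (fderiv ℝ f) p k l v) 0 :=
  (hasDerivAt_fderiv_line (W := E →L[ℝ] ℝ) hf k l).clm_const v

theorem hasDerivAt_bilin_line {P : Type*} [NormedAddCommGroup P] [NormedSpace ℝ P]
    {f : P → E →L[ℝ] E →L[ℝ] ℝ} {p : P} (hf : DifferentiableAt ℝ f p) (k : P) {U : ℝ → E} {U' : E}
    (hU : HasDerivAt U U' 0) (v : E) : HasDerivAt (fun s : ℝ => f (p + s • k) (U s) v)
      (fderiv ℝ f p k (U 0) v + f (p + (0 : ℝ) • k) U' v) 0 := by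
  have h := (hasDerivAt_comp_line (W := E →L[ℝ] E →L[ℝ] ℝ) hf k).bilin hU (hasDerivAt_const (0 : ℝ) v)
  rwa [map_zero, add_zero] at h

/-- The infinitesimal form of Moser's argument: if `B = d a - ϑ ∧ a`, `d B = ϑ ∧ B` and `X` is
determined by `i_X B = g a - ∂ₜ a`, where `d g = ∂ₜ ϑ`, then `∂ₜ B + L_X B = (g + ϑ X) B`. -/
theorem moser_identity {B : ℝ × E → E →L[ℝ] E →L[ℝ] ℝ} {a ϑ : ℝ × E → E →L[ℝ] ℝ}
    {X : ℝ × E → E} {g : ℝ × E → ℝ} {p : ℝ × E} (hB : DifferentiableAt ℝ B p)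
    (ha : ContDiffAt ℝ ∞ a p) (hϑ : DifferentiableAt ℝ ϑ p) (hX : DifferentiableAt ℝ X p)
    (hg : DifferentiableAt ℝ g p)
    (hBa : ∀ᶠ q in 𝓝 p, ∀ u v, B q u v = fderiv ℝ a q (0, u) v - fderiv ℝ a q (0, v) u
      - (ϑ q u * a q v - ϑ q v * a q u))
    (hBX : ∀ᶠ q in 𝓝 p, ∀ v, B q (X q) v = g q * a q v - fderiv ℝ a q (1, 0) v)
    (hdB : ∀ u v z, fderiv ℝ B p (0, u) v z - fderiv ℝ B p (0, v) u z + fderiv ℝ B p (0, z) u v =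
      ϑ p u * B p v z - ϑ p v * B p u z + ϑ p z * B p u v)
    (hgϑ : ∀ v, fderiv ℝ g p (0, v) = fderiv ℝ ϑ p (1, 0) v)
    (hswap : ∀ u v, B p u v = -B p v u) (u v : E) :
    fderiv ℝ B p (1, X p) u v + B p (fderiv ℝ X p (0, u)) v + B p u (fderiv ℝ X p (0, v)) =
      (g p + ϑ p (X p)) * B p u v := by
  have hda : DifferentiableAt ℝ (fderiv ℝ a) p :=
    (ha.fderiv_right (m := 1) (by norm_cast)).differentiableAt (by simp)
  have hda0 : DifferentiableAt ℝ a p := ha.differentiableAt (by simp)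
  have hsymm : ∀ k l, fderiv ℝ (fderiv ℝ a) p k l = fderiv ℝ (fderiv ℝ a) p l k :=
    fun k l => (ha.isSymmSndFDerivAt (by simp; norm_cast)).eq k l
  -- The time derivative of B = da - ϑ ∧ a.
  have ht : fderiv ℝ B p (1, 0) u v = fderiv ℝ (fderiv ℝ a) p (1, 0) (0, u) v
      - fderiv ℝ (fderiv ℝ a) p (1, 0) (0, v) u
      - (fderiv ℝ ϑ p (1, 0) u * a p v + ϑ p u * fderiv ℝ a p (1, 0) v
        - (fderiv ℝ ϑ p (1, 0) v * a p u + ϑ p v * fderiv ℝ a p (1, 0) u)) := by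
    have h1 := hasDerivAt_bilin_line hB (1, 0) (hasDerivAt_const 0 u) v
    have h2 := ((hasDerivAt_fderiv_covector_line hda (1, 0) (0, u) v).sub (hasDerivAt_fderiv_covector_line hda (1, 0) (0, v) u)).sub
      (((hasDerivAt_covector_line hϑ (1, 0) u).mul (hasDerivAt_covector_line hda0 (1, 0) v)).sub
        ((hasDerivAt_covector_line hϑ (1, 0) v).mul (hasDerivAt_covector_line hda0 (1, 0) u)))
    have h3 := h1.unique (h2.congr_of_eventuallyEq ?_)
    · simpa only [zero_smul, add_zero, map_zero, zero_apply] using h3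
    · filter_upwards [eventually_line hBa (1, 0)] with s hs using hs u v
  -- The space derivative of i_X B = g a - ∂ₜa in the direction u.
  have hx : ∀ u v : E, fderiv ℝ B p (0, u) (X p) v + B p (fderiv ℝ X p (0, u)) v =
      fderiv ℝ g p (0, u) * a p v + g p * fderiv ℝ a p (0, u) v
        - fderiv ℝ (fderiv ℝ a) p (0, u) (1, 0) v := by
    intro u v
    have h1 := hasDerivAt_bilin_line hB (0, u) (hasDerivAt_comp_line hX (0, u)) v
    have h2 := ((hasDerivAt_comp_line hg (0, u)).mul (hasDerivAt_covector_line hda0 (0, u) v)).sub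
      (hasDerivAt_fderiv_covector_line hda (0, u) (1, 0) v)
    have h3 := h1.unique (h2.congr_of_eventuallyEq ?_)
    · simpa only [zero_smul, add_zero] using h3
    · filter_upwards [eventually_line hBX (0, u)] with s hs using hs v
  have hsplit : fderiv ℝ B p (1, X p) u v =
      fderiv ℝ B p (1, 0) u v + fderiv ℝ B p (0, X p) u v := by
    have h1 : ((1, X p) : ℝ × E) = (1, 0) + (0, X p) := by simp
    rw [h1, map_add]
    rfl
  have hBp := hBa.self_of_nhds u v
  have hXu := hBX.self_of_nhds u
  have hXv := hBX.self_of_nhds v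
  have e1 := hx u v
  have e2 := hx v u
  -- The left sides of `e1 - e2` and `e3` are d(i_X B)(u, v) and (i_X dB)(u, v): their sum is L_X B
  -- by Cartan's formula.
  have e3 := hdB (X p) u v
  rw [hgϑ] at e1 e2
  rw [hsymm (0, u) (1, 0)] at e1
  rw [hsymm (0, v) (1, 0)] at e2
  rw [hsplit, hswap u (fderiv ℝ X p (0, v)), ht]
  have e4 : g p * B p u v = g p * (fderiv ℝ a p (0, u) v - fderiv ℝ a p (0, v) u
      - (ϑ p u * a p v - ϑ p v * a p u)) := by rw [← hBp]
  have e5 : ϑ p u * B p (X p) v = ϑ p u * (g p * a p v - fderiv ℝ a p (1, 0) v) := by rw [hXv]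
  have e6 : ϑ p v * B p (X p) u = ϑ p v * (g p * a p u - fderiv ℝ a p (1, 0) u) := by rw [hXu]
  linear_combination e1 - e2 + e3 - e4 - e5 + e6

end MoserIdentity

end LCS

namespace LCS

/-! ### Derivative of a pullback along a flow, and the scalar equation. -/

section FlowDerivative

variable {E : Type*} [NormedAddCommGroup E] [NormedSpace ℝ E]

/-- The derivative along a flow of the pullback of a family of bilinear forms whose Lie derivative
is proportional to itself. -/
theorem hasDerivAt_pullback_flow {F Y : ℝ × E → E} {B : ℝ × E → E →L[ℝ] E →L[ℝ] ℝ} {p : ℝ × E}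
    {μ : ℝ} (hF : ContDiffAt ℝ ∞ F p) (hB : DifferentiableAt ℝ B (p.1, F p))
    (hY : DifferentiableAt ℝ Y (p.1, F p))
    (hflow : ∀ᶠ q in 𝓝 p, fderiv ℝ F q (1, 0) = Y (q.1, F q))
    (hLie : ∀ u v, fderiv ℝ B (p.1, F p) (1, Y (p.1, F p)) u v
      + B (p.1, F p) (fderiv ℝ Y (p.1, F p) (0, u)) v
      + B (p.1, F p) u (fderiv ℝ Y (p.1, F p) (0, v)) = μ * B (p.1, F p) u v) (u v : E) :
    HasDerivAt (fun s => B (s, F (s, p.2)) (fderiv ℝ F (s, p.2) (0, u)) (fderiv ℝ F (s, p.2) (0, v)))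
      (μ * B (p.1, F p) (fderiv ℝ F p (0, u)) (fderiv ℝ F p (0, v))) p.1 := by
  have hdF : DifferentiableAt ℝ (fderiv ℝ F) p :=
    (hF.fderiv_right (m := 1) (by norm_cast)).differentiableAt (by simp)
  have hF0 : DifferentiableAt ℝ F p := hF.differentiableAt (by simp)
  have hsymm : ∀ k l, fderiv ℝ (fderiv ℝ F) p k l = fderiv ℝ (fderiv ℝ F) p l k :=
    fun k l => (hF.isSymmSndFDerivAt (by simp; norm_cast)).eq k l
  have hline : HasDerivAt (fun s : ℝ => (s, p.2)) ((1, 0) : ℝ × E) p.1 :=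
    (hasDerivAt_id _).prodMk (hasDerivAt_const _ _)
  have hFt : HasDerivAt (fun s => F (s, p.2)) (Y (p.1, F p)) p.1 := by
    rw [← hflow.self_of_nhds]
    exact HasFDerivAt.comp_hasDerivAt (l := F) (f := fun s => (s, p.2)) p.1 hF0.hasFDerivAt hline
  have hBt : HasDerivAt (fun s => B (s, F (s, p.2))) (fderiv ℝ B (p.1, F p) (1, Y (p.1, F p))) p.1 :=
    HasFDerivAt.comp_hasDerivAt (l := B) (f := fun s => (s, F (s, p.2))) p.1 hB.hasFDerivAt
      ((hasDerivAt_id _).prodMk hFt)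
  have hU : ∀ u : E, HasDerivAt (fun s => fderiv ℝ F (s, p.2) (0, u))
      (fderiv ℝ Y (p.1, F p) (0, fderiv ℝ F p (0, u))) p.1 := by
    intro u
    have h1 : HasDerivAt (fun s => fderiv ℝ F (s, p.2)) (fderiv ℝ (fderiv ℝ F) p (1, 0)) p.1 :=
      HasFDerivAt.comp_hasDerivAt (l := fderiv ℝ F) (f := fun s => (s, p.2)) p.1
        hdF.hasFDerivAt hline
    have h2 := hasDerivAt_fderiv_line hdF (0, u) ((1, 0) : ℝ × E)
    have h3 : HasFDerivAt (fun q : ℝ × E => Y (q.1, F q)) (fderiv ℝ Y (p.1, F p) ∘L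
        ((ContinuousLinearMap.fst ℝ ℝ E).prod (fderiv ℝ F p))) p :=
      HasFDerivAt.comp (g := Y) (f := fun q : ℝ × E => (q.1, F q)) p hY.hasFDerivAt
        (hasFDerivAt_fst.prodMk hF0.hasFDerivAt)
    have h4 := hasDerivAt_comp_line h3.differentiableAt ((0, u) : ℝ × E)
    -- Symmetry of second derivatives: the time derivative of DF is the space derivative of ∂ₜF =
    -- Y(t, F).
    have h5 := h2.unique (h4.congr_of_eventuallyEq (eventually_line hflow (0, u)))
    rw [hsymm, h3.fderiv] at h5
    have h6 := h1.clm_const ((0, u) : ℝ × E)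
    rw [h5] at h6
    exact h6
  have h := hBt.bilin (hU u) (hU v)
  rw [← hLie]
  exact h

/-- Integrating factor. The equation is asked only at interior times, where two-sided derivatives
exist; continuity covers the end points. -/
theorem eq_exp_mul_of_hasDerivAt {G μ : ℝ → ℝ} (hG : ContinuousOn G (Icc 0 1))
    (hμ : ContinuousOn μ (Icc 0 1)) (hd : ∀ t ∈ Ioo (0 : ℝ) 1, HasDerivAt G (μ t * G t) t) {t : ℝ}
    (ht : t ∈ Icc (0 : ℝ) 1) : G t = Real.exp (∫ s in (0 : ℝ)..t, μ s) * G 0 := by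
  -- Constant extension beyond [0, 1] makes the primitive differentiable at every time.
  let μ' : ℝ → ℝ := IccExtend zero_le_one ((Icc (0 : ℝ) 1).domRestrict μ)
  have hμ' : Continuous μ' := (continuousOn_iff_continuous_domRestrict.1 hμ).Icc_extend'
  have hμeq : ∀ s ∈ Icc (0 : ℝ) 1, μ' s = μ s := fun s hs => by
    simp only [μ', IccExtend_of_mem _ _ hs, domRestrict_apply]
  have hint : ∫ s in (0 : ℝ)..t, μ s = ∫ s in (0 : ℝ)..t, μ' s := by
    refine intervalIntegral.integral_congr fun s hs => (hμeq s ?_).symm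
    rw [uIcc_of_le ht.1] at hs
    exact ⟨hs.1, hs.2.trans ht.2⟩
  let K : ℝ → ℝ := fun t => Real.exp (-∫ s in (0 : ℝ)..t, μ' s) * G t
  have hΛ : ∀ t, HasDerivAt (fun t => ∫ s in (0 : ℝ)..t, μ' s) (μ' t) t := fun t =>
    hμ'.integral_hasStrictDerivAt 0 t |>.hasDerivAt
  have hΛc : Continuous fun t => ∫ s in (0 : ℝ)..t, μ' s :=
    continuous_iff_continuousAt.2 fun t => (hΛ t).continuousAt
  have hK : ContinuousOn K (Icc 0 1) := (Real.continuous_exp.comp hΛc.neg).continuousOn.mul hG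
  have hKd : ∀ s ∈ Ioo (0 : ℝ) 1, HasDerivAt K 0 s := by
    intro s hs
    have h := ((hΛ s).neg.exp).mul (hd s hs)
    rw [← hμeq s (Ioo_subset_Icc_self hs)] at h
    exact h.congr_deriv (by ring)
  have hKt : K t = K 0 := by
    rcases ht.1.eq_or_lt with h0 | h0
    · rw [← h0]
    · obtain ⟨s, hs, hs'⟩ := exists_hasDerivAt_eq_slope K (fun _ => 0) h0
        (hK.mono (Icc_subset_Icc_right ht.2)) fun s hs => hKd s ⟨hs.1, hs.2.trans_le ht.2⟩
      have := (div_eq_zero_iff.1 hs'.symm).resolve_right (by linarith)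
      linarith
  have hK0 : K 0 = G 0 := by simp [K]
  rw [hint, ← hK0, ← hKt]
  simp only [K]
  rw [← mul_assoc, ← Real.exp_add, add_neg_cancel, Real.exp_zero, one_mul]

end FlowDerivative

/-! ### Isotopies and pullbacks in charts. -/

section PullbackInCharts

universe u

variable {E : Type u} [NormedAddCommGroup E] [NormedSpace ℝ E]
variable {M : Type*} [TopologicalSpace M] [ChartedSpace E M]

/-- The derivative of a self-map of a manifold, read as an operator of the model space. -/
noncomputable def dMap (φ : M → M) (x : M) : E →L[ℝ] E := mfderiv 𝓘(ℝ, E) 𝓘(ℝ, E) φ x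

/-- The coordinate expression of an isotopy. -/
noncomputable def isotopyChart (c c' : M) (φ : ℝ → (M ≃ₘ^∞⟮𝓘(ℝ, E), 𝓘(ℝ, E)⟯ M)) (p : ℝ × E) : E :=
  extChartAt 𝓘(ℝ, E) c' (φ p.1 ((extChartAt 𝓘(ℝ, E) c).symm p.2))

theorem continuousOn_isotopy {φ : ℝ → (M ≃ₘ^∞⟮𝓘(ℝ, E), 𝓘(ℝ, E)⟯ M)} (hφ : IsIsotopy φ) (x : M) :
    ContinuousOn (fun s => φ s x) (Icc (0 : ℝ) 1) :=
  hφ.smooth.continuousOn.comp (f := fun s : ℝ => (s, x)) (by fun_prop) fun s hs => ⟨hs, mem_univ _⟩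

variable [IsManifold 𝓘(ℝ, E) ∞ M]

theorem contMDiffWithinAt_isotopy_comp_symm {φ : ℝ → (M ≃ₘ^∞⟮𝓘(ℝ, E), 𝓘(ℝ, E)⟯ M)}
    (hφ : IsIsotopy φ) {c : M} {p : ℝ × E}
    (hp : p ∈ Icc (0 : ℝ) 1 ×ˢ (extChartAt 𝓘(ℝ, E) c).target) :
    ContMDiffWithinAt 𝓘(ℝ, ℝ × E) 𝓘(ℝ, E) ∞
      (fun q : ℝ × E => φ q.1 ((extChartAt 𝓘(ℝ, E) c).symm q.2))
      (Icc (0 : ℝ) 1 ×ˢ (extChartAt 𝓘(ℝ, E) c).target) p := by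
  have h1 : ContMDiffWithinAt 𝓘(ℝ, ℝ × E) (𝓘(ℝ, ℝ).prod 𝓘(ℝ, E)) ∞
      (fun q : ℝ × E => (q.1, (extChartAt 𝓘(ℝ, E) c).symm q.2))
      (Icc (0 : ℝ) 1 ×ˢ (extChartAt 𝓘(ℝ, E) c).target) p :=
    (contDiff_fst.contMDiff.contMDiffAt.contMDiffWithinAt).prodMk
      ((contMDiffAt_chart_symm hp.2).comp p contDiff_snd.contMDiff.contMDiffAt).contMDiffWithinAt
  exact ContMDiffWithinAt.comp (g := fun q : ℝ × M => φ q.1 q.2)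
    (f := fun q : ℝ × E => (q.1, (extChartAt 𝓘(ℝ, E) c).symm q.2)) (t := Icc (0 : ℝ) 1 ×ˢ univ) p
    (hφ.smooth (p.1, (extChartAt 𝓘(ℝ, E) c).symm p.2) ⟨hp.1, mem_univ _⟩) h1
    fun q hq => ⟨hq.1, mem_univ _⟩

theorem contDiffWithinAt_isotopyChart {φ : ℝ → (M ≃ₘ^∞⟮𝓘(ℝ, E), 𝓘(ℝ, E)⟯ M)} (hφ : IsIsotopy φ)
    {c c' : M} {p : ℝ × E} (hp : p ∈ Icc (0 : ℝ) 1 ×ˢ (extChartAt 𝓘(ℝ, E) c).target)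
    (hp' : φ p.1 ((extChartAt 𝓘(ℝ, E) c).symm p.2) ∈ (extChartAt 𝓘(ℝ, E) c').source) :
    ContDiffWithinAt ℝ ∞ (isotopyChart c c' φ)
      (Icc (0 : ℝ) 1 ×ˢ (extChartAt 𝓘(ℝ, E) c).target) p := by
  rw [← contMDiffWithinAt_iff_contDiffWithinAt]
  exact ContMDiffAt.comp_contMDiffWithinAt (g := extChartAt 𝓘(ℝ, E) c') p (contMDiffAt_chart hp')
    (contMDiffWithinAt_isotopy_comp_symm hφ hp)

theorem hasFDerivAt_isotopyChart (φ : ℝ → (M ≃ₘ^∞⟮𝓘(ℝ, E), 𝓘(ℝ, E)⟯ M)) {c c' : M} {p : ℝ × E}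
    (hp : p.2 ∈ (extChartAt 𝓘(ℝ, E) c).target)
    (hp' : φ p.1 ((extChartAt 𝓘(ℝ, E) c).symm p.2) ∈ (extChartAt 𝓘(ℝ, E) c').source) :
    HasFDerivAt (fun z => isotopyChart c c' φ (p.1, z))
      (chartD c' (φ p.1 ((extChartAt 𝓘(ℝ, E) c).symm p.2)) ∘L
        dMap (φ p.1) ((extChartAt 𝓘(ℝ, E) c).symm p.2) ∘L chartSymmD c p.2) p.2 := by
  have h1 : HasMFDerivAt 𝓘(ℝ, E) 𝓘(ℝ, E) (φ p.1) ((extChartAt 𝓘(ℝ, E) c).symm p.2)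
      (dMap (E := E) (φ p.1) ((extChartAt 𝓘(ℝ, E) c).symm p.2)) :=
    ((φ p.1).contMDiff.mdifferentiable (by simp) _).hasMFDerivAt
  exact ((hasMFDerivAt_chart hp').comp p.2 (h1.comp p.2 (hasMFDerivAt_chart_symm hp))).hasFDerivAt

theorem bilChart_isotopyChart (w : ℝ → Form E M 2) (φ : ℝ → (M ≃ₘ^∞⟮𝓘(ℝ, E), 𝓘(ℝ, E)⟯ M))
    {c c' : M} {p : ℝ × E} (hp : p.2 ∈ (extChartAt 𝓘(ℝ, E) c).target)
    (hp' : φ p.1 ((extChartAt 𝓘(ℝ, E) c).symm p.2) ∈ (extChartAt 𝓘(ℝ, E) c').source) (u v : E) :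
    bilChart c' w (p.1, isotopyChart c c' φ p)
      (fderiv ℝ (fun z => isotopyChart c c' φ (p.1, z)) p.2 u)
      (fderiv ℝ (fun z => isotopyChart c c' φ (p.1, z)) p.2 v) =
    bilChart c (fun t => pullback (φ t) (w t)) p u v := by
  rw [(hasFDerivAt_isotopyChart φ hp hp').fderiv, bilChart_apply, bilChart_apply]
  simp only [isotopyChart, (extChartAt 𝓘(ℝ, E) c').left_inv hp', ContinuousLinearMap.comp_apply]
  rw [chartSymmD_chartD hp', chartSymmD_chartD hp', bil_apply, bil_apply]
  change _ = formAt (w p.1) (φ p.1 ((extChartAt 𝓘(ℝ, E) c).symm p.2))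
    (fun i => dMap (φ p.1) ((extChartAt 𝓘(ℝ, E) c).symm p.2) (![chartSymmD c p.2 u, chartSymmD c p.2 v] i))
  congr 1
  funext j; fin_cases j <;> rfl

end PullbackInCharts

end LCS

namespace LCS

/-! ### From proportional Lie derivatives to conformal equivalence. -/

section ConformalFlow

universe u

variable {E : Type u} [NormedAddCommGroup E] [NormedSpace ℝ E]

theorem bil_ext {b b' : E [⋀^Fin 2]→L[ℝ] ℝ} (h : ∀ u v, bil E b u v = bil E b' u v) : b = b' := by
  ext z
  have hz : z = ![z 0, z 1] := by funext j; fin_cases j <;> rfl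
  rw [hz, ← bil_apply, ← bil_apply, h]

variable {M : Type*} [TopologicalSpace M] [ChartedSpace E M] 

theorem continuousOn_along_isotopy {φ : ℝ → (M ≃ₘ^∞⟮𝓘(ℝ, E), 𝓘(ℝ, E)⟯ M)} (hφ : IsIsotopy φ)
    {μ : ℝ → M → ℝ}
    (hμ : ∀ c, ContinuousOn (fun p : ℝ × E => μ p.1 ((extChartAt 𝓘(ℝ, E) c).symm p.2))
      (Icc (0 : ℝ) 1 ×ˢ (extChartAt 𝓘(ℝ, E) c).target)) (x : M) :
    ContinuousOn (fun s => μ s (φ s x)) (Icc (0 : ℝ) 1) := by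
  intro s hs
  have hc := continuousOn_isotopy hφ x s hs
  have hsrc : ∀ᶠ r in 𝓝[Icc (0 : ℝ) 1] s, φ r x ∈ (extChartAt 𝓘(ℝ, E) (φ s x)).source :=
    hc.eventually_mem ((isOpen_extChartAt_source _).mem_nhds (mem_extChartAt_source _))
  have h0 : ContinuousWithinAt (fun r => extChartAt 𝓘(ℝ, E) (φ s x) (φ r x)) (Icc (0 : ℝ) 1) s :=
    ContinuousAt.comp_continuousWithinAt (g := extChartAt 𝓘(ℝ, E) (φ s x)) (f := fun r => φ r x)
      (continuousAt_extChartAt (I := 𝓘(ℝ, E)) (φ s x)) hc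
  have h1 : ContinuousWithinAt (fun r => (r, extChartAt 𝓘(ℝ, E) (φ s x) (φ r x))) (Icc (0 : ℝ) 1) s :=
    continuousWithinAt_id.prodMk h0
  have h3 : ContinuousWithinAt (fun r => μ r ((extChartAt 𝓘(ℝ, E) (φ s x)).symm
      (extChartAt 𝓘(ℝ, E) (φ s x) (φ r x)))) (Icc (0 : ℝ) 1) s := by
    refine ContinuousWithinAt.comp_of_preimage_mem_nhdsWithin
      (g := fun p : ℝ × E => μ p.1 ((extChartAt 𝓘(ℝ, E) (φ s x)).symm p.2))
      (f := fun r => (r, extChartAt 𝓘(ℝ, E) (φ s x) (φ r x)))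
      (hμ (φ s x) _ ⟨hs, mem_extChartAt_target _⟩) h1 ?_
    filter_upwards [hsrc, self_mem_nhdsWithin] with r hr hr'
    exact ⟨hr', (extChartAt 𝓘(ℝ, E) (φ s x)).map_source hr⟩
  refine h3.congr_of_eventuallyEq ?_ (by rw [extChartAt_to_inv])
  filter_upwards [hsrc] with r hr
  rw [(extChartAt 𝓘(ℝ, E) (φ s x)).left_inv hr]

theorem pullback_isotopy_zero {φ : ℝ → (M ≃ₘ^∞⟮𝓘(ℝ, E), 𝓘(ℝ, E)⟯ M)} (hφ : IsIsotopy φ) {k : ℕ}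
    (w : Form E M k) : pullback (φ 0) w = w := by
  have h : (φ 0 : M → M) = id := funext hφ.map_zero
  rw [h]
  funext x
  rw [pullback, mfderiv_id]
  rfl

variable [IsManifold 𝓘(ℝ, E) ∞ M]

/-- If the Lie derivative of a smooth family of `2`-forms along the vector field of an isotopy is
proportional to the family, then so is the family pulled back by the isotopy to the initial form. -/
theorem bilChart_pullback_eq_exp {w : ℝ → Form E M 2} (hw : SmoothFamily w) {X : ℝ → M → E}
    (hX : ∀ c, ContDiffOn ℝ ∞ (chartVec c X) (Icc (0 : ℝ) 1 ×ˢ (extChartAt 𝓘(ℝ, E) c).target))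
    {φ : ℝ → (M ≃ₘ^∞⟮𝓘(ℝ, E), 𝓘(ℝ, E)⟯ M)} (hφ : IsIsotopy φ)
    (hflow : ∀ c x t, t ∈ Icc (0 : ℝ) 1 → φ t x ∈ (extChartAt 𝓘(ℝ, E) c).source →
      HasDerivWithinAt (fun s => extChartAt 𝓘(ℝ, E) c (φ s x))
        (chartVec c X (t, extChartAt 𝓘(ℝ, E) c (φ t x))) (Icc 0 1) t)
    {μ : ℝ → M → ℝ}
    (hμ : ∀ c, ContinuousOn (fun p : ℝ × E => μ p.1 ((extChartAt 𝓘(ℝ, E) c).symm p.2))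
      (Icc (0 : ℝ) 1 ×ˢ (extChartAt 𝓘(ℝ, E) c).target))
    (hLie : ∀ c, ∀ p ∈ Ioo (0 : ℝ) 1 ×ˢ (extChartAt 𝓘(ℝ, E) c).target, ∀ u v,
      fderiv ℝ (bilChart c w) p (1, chartVec c X p) u v
        + bilChart c w p (fderiv ℝ (chartVec c X) p (0, u)) v
        + bilChart c w p u (fderiv ℝ (chartVec c X) p (0, v)) =
      μ p.1 ((extChartAt 𝓘(ℝ, E) c).symm p.2) * bilChart c w p u v)
    {c : M} {y : E} (hy : y ∈ (extChartAt 𝓘(ℝ, E) c).target) {t : ℝ} (ht : t ∈ Icc (0 : ℝ) 1)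
    (u v : E) :
    bilChart c (fun t => pullback (φ t) (w t)) (t, y) u v =
      Real.exp (∫ s in (0 : ℝ)..t, μ s (φ s ((extChartAt 𝓘(ℝ, E) c).symm y)))
        * bilChart c w (0, y) u v := by
  set x := (extChartAt 𝓘(ℝ, E) c).symm y with hx
  set S : Set (ℝ × E) := Icc (0 : ℝ) 1 ×ˢ (extChartAt 𝓘(ℝ, E) c).target with hS
  have hz : bilChart c (fun t => pullback (φ t) (w t)) (0, y) u v = bilChart c w (0, y) u v := by
    simp only [bilChart, pullback_isotopy_zero hφ]
  rw [← hz]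
  refine eq_exp_mul_of_hasDerivAt (G := fun t => bilChart c (fun t => pullback (φ t) (w t)) (t, y) u v)
    ?_ (continuousOn_along_isotopy hφ hμ x) ?_ ht
  · intro r hr
    -- Continuity up to the end points. The chart at the image point is fixed near the time r, and
    -- `fderivWithin` on [0, 1] × target stands in for the space derivative because it is continuous
    -- at times 0 and 1.
    set c' := φ r x with hc'
    have hrS : (r, y) ∈ S := ⟨hr, hy⟩
    have hF : ContDiffWithinAt ℝ ∞ (isotopyChart c c' φ) S (r, y) :=
      contDiffWithinAt_isotopyChart hφ hrS (mem_extChartAt_source _)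
    have hline : ContinuousWithinAt (fun s : ℝ => (s, y)) (Icc (0 : ℝ) 1) r :=
      (by fun_prop : Continuous fun s : ℝ => (s, y)).continuousWithinAt
    have hmaps : MapsTo (fun s : ℝ => (s, y)) (Icc (0 : ℝ) 1) S := fun s hs => ⟨hs, hy⟩
    have hsrc : ∀ᶠ s in 𝓝[Icc (0 : ℝ) 1] r, φ s x ∈ (extChartAt 𝓘(ℝ, E) c').source :=
      (continuousOn_isotopy hφ x r hr).eventually_mem
        ((isOpen_extChartAt_source _).mem_nhds (mem_extChartAt_source _))
    have hFc : ContinuousWithinAt (fun s => isotopyChart c c' φ (s, y)) (Icc (0 : ℝ) 1) r :=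
      ContinuousWithinAt.comp (g := isotopyChart c c' φ) hF.continuousWithinAt hline hmaps
    have hDc : ∀ z : ℝ × E, ContinuousWithinAt
        (fun s => fderivWithin ℝ (isotopyChart c c' φ) S (s, y) z) (Icc (0 : ℝ) 1) r := by
      intro z
      have h1 := (hF.fderivWithin_right (m := ∞)
        (uniqueDiffOn_slab (isOpen_extChartAt_target c)) (by simp) hrS).continuousWithinAt
      exact (ContinuousWithinAt.comp (g := fderivWithin ℝ (isotopyChart c c' φ) S)
        (f := fun s : ℝ => (s, y)) h1 hline hmaps).clm_apply continuousWithinAt_const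
    have hBc : ContinuousWithinAt (fun s => bilChart c' w (s, isotopyChart c c' φ (s, y)))
        (Icc (0 : ℝ) 1) r := by
      have h1 : isotopyChart c c' φ (r, y) ∈ (extChartAt 𝓘(ℝ, E) c').target :=
        (extChartAt 𝓘(ℝ, E) c').map_source (mem_extChartAt_source _)
      refine ((contDiffOn_bilChart hw c').continuousOn (r, isotopyChart c c' φ (r, y))
        ⟨hr, h1⟩).tendsto.comp (tendsto_nhdsWithin_iff.2
          ⟨(continuousWithinAt_id.prodMk hFc).tendsto, ?_⟩)
      filter_upwards [hsrc, self_mem_nhdsWithin] with s hs hs'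
      exact ⟨hs', (extChartAt 𝓘(ℝ, E) c').map_source hs⟩
    have hval : ∀ s ∈ Icc (0 : ℝ) 1, φ s x ∈ (extChartAt 𝓘(ℝ, E) c').source →
        bilChart c (fun t => pullback (φ t) (w t)) (s, y) u v =
        bilChart c' w (s, isotopyChart c c' φ (s, y))
          (fderivWithin ℝ (isotopyChart c c' φ) S (s, y) (0, u))
          (fderivWithin ℝ (isotopyChart c c' φ) S (s, y) (0, v)) := by
      intro s hs hs'
      have h1 := hasFDerivAt_slab_snd (isOpen_extChartAt_target c)
        ((contDiffWithinAt_isotopyChart (c' := c') hφ (p := (s, y)) ⟨hs, hy⟩ hs').differentiableWithinAt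
          (by simp)) ⟨hs, hy⟩
      rw [← bilChart_isotopyChart (c' := c') w φ hy hs', h1.fderiv]
      simp [hS]
    refine ((hBc.clm_apply (hDc (0, u))).clm_apply (hDc (0, v))).congr_of_eventuallyEq ?_
      (hval r hr (mem_extChartAt_source _))
    filter_upwards [hsrc, self_mem_nhdsWithin] with s hs hs' using hval s hs' hs
  · intro r hr
    have hr' := Ioo_subset_Icc_self hr
    -- The orbit may leave any single chart, but the pullback lives at x: the scalar equation at
    -- time r can be checked in the chart around φ r x.
    set c' := φ r x with hc'
    have hrS : (r, y) ∈ S := ⟨hr', hy⟩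
    let Ω : Set (ℝ × E) := {q | q ∈ Ioo (0 : ℝ) 1 ×ˢ (extChartAt 𝓘(ℝ, E) c).target ∧
      φ q.1 ((extChartAt 𝓘(ℝ, E) c).symm q.2) ∈ (extChartAt 𝓘(ℝ, E) c').source}
    have hSn : S ∈ 𝓝 (r, y) := slab_mem_nhds (isOpen_extChartAt_target c) ⟨hr, hy⟩
    have hΩ : ∀ᶠ q in 𝓝 (r, y), q ∈ Ω := by
      have h1 := ((contMDiffWithinAt_isotopy_comp_symm hφ hrS).continuousWithinAt.continuousAt hSn)
      filter_upwards [(isOpen_Ioo.prod (isOpen_extChartAt_target c)).mem_nhds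
        (show (r, y) ∈ Ioo (0 : ℝ) 1 ×ˢ (extChartAt 𝓘(ℝ, E) c).target from ⟨hr, hy⟩),
        h1.preimage_mem_nhds ((isOpen_extChartAt_source _).mem_nhds
          (mem_extChartAt_source (I := 𝓘(ℝ, E)) c'))] with q hq hq' using ⟨hq, hq'⟩
    have hFq : ∀ q ∈ Ω, ContDiffAt ℝ ∞ (isotopyChart c c' φ) q := fun q hq =>
      (contDiffWithinAt_isotopyChart hφ ⟨Ioo_subset_Icc_self hq.1.1, hq.1.2⟩ hq.2).contDiffAt
        (slab_mem_nhds (isOpen_extChartAt_target c) hq.1)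
    have hpt : (r, isotopyChart c c' φ (r, y)) ∈
        Ioo (0 : ℝ) 1 ×ˢ (extChartAt 𝓘(ℝ, E) c').target :=
      ⟨hr, (extChartAt 𝓘(ℝ, E) c').map_source (mem_extChartAt_source _)⟩
    have hn := slab_mem_nhds (isOpen_extChartAt_target (I := 𝓘(ℝ, E)) c') hpt
    have hd := hasDerivAt_pullback_flow (F := isotopyChart c c' φ) (Y := chartVec c' X)
      (B := bilChart c' w) (p := (r, y)) (μ := μ r c') (hFq _ hΩ.self_of_nhds)
      (((contDiffOn_bilChart hw c').contDiffAt hn).differentiableAt (by simp))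
      (((hX c').contDiffAt hn).differentiableAt (by simp)) ?_ ?_ u v
    · have hval : ∀ q ∈ Ω, bilChart c (fun t => pullback (φ t) (w t)) q u v =
          bilChart c' w (q.1, isotopyChart c c' φ q) (fderiv ℝ (isotopyChart c c' φ) q (0, u))
            (fderiv ℝ (isotopyChart c c' φ) q (0, v)) := by
        intro q hq
        have hq' : q ∈ Icc (0 : ℝ) 1 ×ˢ (extChartAt 𝓘(ℝ, E) c).target :=
          ⟨Ioo_subset_Icc_self hq.1.1, hq.1.2⟩
        have h0 := (hFq q hq).differentiableAt (by simp)
        have h1 := hasFDerivAt_slab_snd (isOpen_extChartAt_target c)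
          h0.differentiableWithinAt hq'
        rw [← bilChart_isotopyChart (c' := c') w φ hq.1.2 hq.2, h1.fderiv,
          h0.fderivWithin (uniqueDiffOn_slab (isOpen_extChartAt_target c) q hq')]
        simp
      have hev : ∀ᶠ s in 𝓝 r, (s, y) ∈ Ω :=
        (by fun_prop : Continuous fun s : ℝ => (s, y)).continuousAt.eventually hΩ
      have h2 := hval (r, y) hΩ.self_of_nhds
      simp only at hd h2 ⊢
      rw [h2]
      refine hd.congr_of_eventuallyEq ?_
      filter_upwards [hev] with s hs using hval (s, y) hs
    · filter_upwards [hΩ] with q hq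
      have h1 := (hflow c' _ q.1 (Ioo_subset_Icc_self hq.1.1) hq.2).hasDerivAt
        (Icc_mem_nhds hq.1.1.1 hq.1.1.2)
      have h2 : HasDerivAt (fun s => isotopyChart c c' φ (s, q.2))
          (fderiv ℝ (isotopyChart c c' φ) q (1, 0)) q.1 :=
        HasFDerivAt.comp_hasDerivAt (l := isotopyChart c c' φ) (f := fun s => (s, q.2)) q.1
          ((hFq q hq).differentiableAt (by simp)).hasFDerivAt
          ((hasDerivAt_id _).prodMk (hasDerivAt_const _ _))
      exact h2.unique h1
    · intro u v
      rw [hLie c' _ hpt]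
      simp only [isotopyChart, ← hx, ← hc', extChartAt_to_inv]

/-- Needed for the smoothness of the conformal factor, which is obtained as a quotient of form
coefficients and not by differentiating the integral in the exponent. -/
theorem contDiffAt_bilChart_pullback {w : ℝ → Form E M 2} (hw : SmoothFamily w)
    {φ : ℝ → (M ≃ₘ^∞⟮𝓘(ℝ, E), 𝓘(ℝ, E)⟯ M)} (hφ : IsIsotopy φ) {c : M} {y : E}
    (hy : y ∈ (extChartAt 𝓘(ℝ, E) c).target) {t : ℝ} (ht : t ∈ Icc (0 : ℝ) 1) (u v : E) :
    ContDiffAt ℝ ∞ (fun z => bilChart c (fun t => pullback (φ t) (w t)) (t, z) u v) y := by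
  set c' := φ t ((extChartAt 𝓘(ℝ, E) c).symm y) with hc'
  have hO := (isOpen_extChartAt_target (I := 𝓘(ℝ, E)) c).mem_nhds hy
  have hF : ContDiffAt ℝ ∞ (fun z => isotopyChart c c' φ (t, z)) y := by
    refine ContDiffWithinAt.contDiffAt (s := (extChartAt 𝓘(ℝ, E) c).target) ?_ hO
    exact ContDiffWithinAt.comp (g := isotopyChart c c' φ) (f := fun z => (t, z)) y
      (contDiffWithinAt_isotopyChart hφ (p := (t, y)) ⟨ht, hy⟩ (mem_extChartAt_source _))
      (contDiff_const.prodMk contDiff_id).contDiffWithinAt fun z hz => ⟨ht, hz⟩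
  have hD : ∀ u : E, ContDiffAt ℝ ∞ (fun z => fderiv ℝ (fun z => isotopyChart c c' φ (t, z)) z u) y :=
    fun u => (hF.fderiv_right (m := ∞) (by simp)).clm_apply contDiffAt_const
  have hB : ContDiffAt ℝ ∞ (fun z => bilChart c' w (t, isotopyChart c c' φ (t, z))) y := by
    have h1 : ContDiffAt ℝ ∞ (fun z => bilChart c' w (t, z)) (isotopyChart c c' φ (t, y)) := by
      refine ContDiffOn.contDiffAt ((contDiffOn_bilChart hw c').comp
        (f := fun z => (t, z)) (contDiff_const.prodMk contDiff_id).contDiffOn fun z hz => ⟨ht, hz⟩)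
        ((isOpen_extChartAt_target (I := 𝓘(ℝ, E)) c').mem_nhds ?_)
      exact (extChartAt 𝓘(ℝ, E) c').map_source (mem_extChartAt_source _)
    exact ContDiffAt.comp (g := fun z => bilChart c' w (t, z)) y h1 hF
  refine ((hB.clm_apply (hD u)).clm_apply (hD v)).congr_of_eventuallyEq ?_
  have hcont : ContinuousAt (fun z => φ t ((extChartAt 𝓘(ℝ, E) c).symm z)) y :=
    (φ t).continuous.continuousAt.comp (continuousAt_extChartAt_symm'' hy)
  filter_upwards [hO, hcont.preimage_mem_nhds ((isOpen_extChartAt_source (I := 𝓘(ℝ, E)) c').mem_nhds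
    (mem_extChartAt_source _))] with z hz hz'
  exact (bilChart_isotopyChart (c' := c') w φ (p := (t, z)) hz hz' u v).symm

/-- A form which is pointwise proportional to another one, with a positive factor, is conformally
equivalent to it: the factor is automatically smooth. -/
theorem conformallyEquivalent_of_bilChart {w w' : Form E M 2} [Nontrivial E]
    (hw : ∀ c, ∀ y ∈ (extChartAt 𝓘(ℝ, E) c).target, ∀ u v,
      ContDiffAt ℝ ∞ (fun z => bilChart c (fun _ => w) (0, z) u v) y)
    (hw' : ∀ c, ∀ y ∈ (extChartAt 𝓘(ℝ, E) c).target, ∀ u v,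
      ContDiffAt ℝ ∞ (fun z => bilChart c (fun _ => w') (0, z) u v) y)
    (hnd : ∀ x, NondegenerateAt w' x) {f : M → ℝ} (hf : ∀ x, 0 < f x)
    (h : ∀ c, ∀ y ∈ (extChartAt 𝓘(ℝ, E) c).target, ∀ u v, bilChart c (fun _ => w) (0, y) u v =
      f ((extChartAt 𝓘(ℝ, E) c).symm y) * bilChart c (fun _ => w') (0, y) u v) :
    ConformallyEquivalent w w' := by
  refine ⟨f, fun x => ?_, hf, fun x => ?_⟩
  · have hy := mem_extChartAt_target (I := 𝓘(ℝ, E)) x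
    -- Near x, the factor is the quotient of the values of w and w' on two fixed coordinate vectors
    -- on which w' does not vanish.
    obtain ⟨u, hu⟩ := exists_ne (0 : E)
    obtain ⟨v, hv⟩ : ∃ v, bilChart x (fun _ => w') (0, extChartAt 𝓘(ℝ, E) x x) u v ≠ 0 := by
      by_contra! h0
      exact hu (bilChart_nondegenerate (w := fun _ => w') (p := (0, extChartAt 𝓘(ℝ, E) x x)) hy
        (hnd _) h0)
    have h1 := (hw x _ hy u v).div (hw' x _ hy u v) hv
    have h2 : ContMDiffAt 𝓘(ℝ, E) 𝓘(ℝ, ℝ) ∞ (fun x' =>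
        bilChart x (fun _ => w) (0, extChartAt 𝓘(ℝ, E) x x') u v /
          bilChart x (fun _ => w') (0, extChartAt 𝓘(ℝ, E) x x') u v) x :=
      ContMDiffAt.comp (g := fun z => bilChart x (fun _ => w) (0, z) u v /
        bilChart x (fun _ => w') (0, z) u v) x h1.contMDiffAt
        (contMDiffAt_chart (mem_extChartAt_source x))
    refine h2.congr_of_eventuallyEq ?_
    have hne : ∀ᶠ x' in 𝓝 x, bilChart x (fun _ => w') (0, extChartAt 𝓘(ℝ, E) x x') u v ≠ 0 :=
      (continuousAt_extChartAt (I := 𝓘(ℝ, E)) x).eventually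
        ((hw' x _ hy u v).continuousAt.eventually_ne hv)
    filter_upwards [hne, (isOpen_extChartAt_source (I := 𝓘(ℝ, E)) x).mem_nhds
      (mem_extChartAt_source x)] with x' hx' hx's
    rw [h x _ ((extChartAt 𝓘(ℝ, E) x).map_source hx's), (extChartAt 𝓘(ℝ, E) x).left_inv hx's,
      mul_div_cancel_right₀ _ hx']
  · have h1 : formAt w x = f x • formAt w' x := by
      refine bil_ext fun u v => ?_
      have h2 := h x _ (mem_extChartAt_target (I := 𝓘(ℝ, E)) x) (chartD x x u) (chartD x x v)
      rw [bilChart_apply, bilChart_apply] at h2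
      simp only [extChartAt_to_inv] at h2
      rw [chartSymmD_chartD (mem_extChartAt_source x), chartSymmD_chartD (mem_extChartAt_source x)]
        at h2
      rw [h2, map_smul]
      rfl
    exact h1

end ConformalFlow

end LCS

namespace LCS

/-! ### Exchange of time and space derivatives for primitives. -/

section Primitives

variable {E : Type*} [NormedAddCommGroup E] [NormedSpace ℝ E]

theorem fderiv_slab_snd_eq {W : Type*} [NormedAddCommGroup W] [NormedSpace ℝ W] {F : ℝ × E → W}
    {p : ℝ × E} (hF : DifferentiableAt ℝ F p) (v : E) :
    fderiv ℝ (fun z => F (p.1, z)) p.2 v = fderiv ℝ F p (0, v) := by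
  have h1 : HasFDerivAt (fun z => F (p.1, z)) (fderiv ℝ F p ∘L ContinuousLinearMap.inr ℝ ℝ E) p.2 :=
    HasFDerivAt.comp (g := F) (f := fun z => (p.1, z)) p.2 hF.hasFDerivAt
      (hasFDerivAt_prodMk_right p.1 p.2)
  rw [h1.fderiv]
  simp

/-- If `d K = ϑ - ϑ₀` in the space directions, with `ϑ₀` independent of time, then
`d (∂ₜ K) = ∂ₜ ϑ`. -/
theorem fderiv_timeDerivative {K g : ℝ × E → ℝ} {ϑ : ℝ × E → E →L[ℝ] ℝ} {ϑ₀ : E → E →L[ℝ] ℝ}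
    {p : ℝ × E} (hK : ContDiffAt ℝ ∞ K p) (hϑ : DifferentiableAt ℝ ϑ p)
    (hg : ∀ᶠ q in 𝓝 p, g q = fderiv ℝ K q (1, 0))
    (hd : ∀ᶠ q in 𝓝 p, ∀ v, fderiv ℝ K q (0, v) = ϑ q v - ϑ₀ q.2 v) (v : E) :
    fderiv ℝ g p (0, v) = fderiv ℝ ϑ p (1, 0) v := by
  have hdK : DifferentiableAt ℝ (fderiv ℝ K) p :=
    (hK.fderiv_right (m := 1) (by norm_cast)).differentiableAt (by simp)
  have hsymm : ∀ k l, fderiv ℝ (fderiv ℝ K) p k l = fderiv ℝ (fderiv ℝ K) p l k :=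
    fun k l => (hK.isSymmSndFDerivAt (by simp; norm_cast)).eq k l
  have hg' : DifferentiableAt ℝ g p :=
    (hdK.clm_apply (differentiableAt_const (1, 0))).congr_of_eventuallyEq hg
  have h1 := (hasDerivAt_comp_line hg' ((0, v) : ℝ × E)).unique
    ((hasDerivAt_fderiv_line hdK (0, v) (1, 0)).congr_of_eventuallyEq
      (eventually_line hg (0, v)))
  have h2 := (hasDerivAt_fderiv_line hdK (1, 0) (0, v)).unique
    (((hasDerivAt_covector_line hϑ (1, 0) v).sub_const (ϑ₀ p.2 v)).congr_of_eventuallyEq (by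
      filter_upwards [eventually_line hd (1, 0)] with s hs
      rw [hs v]
      simp))
  rw [h1, hsymm, h2]

end Primitives

/-! ### The Moser identity for the given families. -/

section MoserLie

universe u

variable {E : Type u} [NormedAddCommGroup E] [NormedSpace ℝ E]
variable {M : Type*} [TopologicalSpace M] [ChartedSpace E M] [IsManifold 𝓘(ℝ, E) ∞ M]

theorem lie_moser_vectorField {w : ℝ → Form E M 2} {θ α : ℝ → Form E M 1} (hw : SmoothFamily w)
    (hα : SmoothFamily α)
    (hϑ : ∀ c, ContDiffOn ℝ ∞ (linChart c θ) (Icc (0 : ℝ) 1 ×ˢ (extChartAt 𝓘(ℝ, E) c).target))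
    (hlee : ∀ t ∈ Icc (0 : ℝ) 1, ∀ x, extD (w t) x = wedge (θ t) (w t) x)
    (hprim : ∀ t ∈ Icc (0 : ℝ) 1, ∀ x, w t x = extD (α t) x - wedge (θ t) (α t) x)
    {g : ℝ → M → ℝ} {c : M}
    (hg : ContDiffOn ℝ ∞ (fun p : ℝ × E => g p.1 ((extChartAt 𝓘(ℝ, E) c).symm p.2))
      (Icc (0 : ℝ) 1 ×ˢ (extChartAt 𝓘(ℝ, E) c).target))
    (hgϑ : ∀ p ∈ Ioo (0 : ℝ) 1 ×ˢ (extChartAt 𝓘(ℝ, E) c).target, ∀ v,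
      fderiv ℝ (fun p : ℝ × E => g p.1 ((extChartAt 𝓘(ℝ, E) c).symm p.2)) p (0, v) =
        fderiv ℝ (linChart c θ) p (1, 0) v)
    {X : ℝ → M → E}
    (hX : ContDiffOn ℝ ∞ (chartVec c X) (Icc (0 : ℝ) 1 ×ˢ (extChartAt 𝓘(ℝ, E) c).target))
    (hXw : ∀ p ∈ Icc (0 : ℝ) 1 ×ˢ (extChartAt 𝓘(ℝ, E) c).target, ∀ v,
      bilChart c w p (chartVec c X p) v =
        g p.1 ((extChartAt 𝓘(ℝ, E) c).symm p.2) * linChart c α p v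
        - fderivWithin ℝ (linChart c α) (Icc (0 : ℝ) 1 ×ˢ (extChartAt 𝓘(ℝ, E) c).target)
            p (1, 0) v)
    {p : ℝ × E} (hp : p ∈ Ioo (0 : ℝ) 1 ×ˢ (extChartAt 𝓘(ℝ, E) c).target) (u v : E) :
    fderiv ℝ (bilChart c w) p (1, chartVec c X p) u v
      + bilChart c w p (fderiv ℝ (chartVec c X) p (0, u)) v
      + bilChart c w p u (fderiv ℝ (chartVec c X) p (0, v)) =
    (g p.1 ((extChartAt 𝓘(ℝ, E) c).symm p.2) + linChart c θ p (chartVec c X p))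
      * bilChart c w p u v := by
  have hev : ∀ᶠ q in 𝓝 p, q ∈ Ioo (0 : ℝ) 1 ×ˢ (extChartAt 𝓘(ℝ, E) c).target :=
    (isOpen_Ioo.prod (isOpen_extChartAt_target c)).mem_nhds hp
  have hIcc : ∀ q ∈ Ioo (0 : ℝ) 1 ×ˢ (extChartAt 𝓘(ℝ, E) c).target,
      q ∈ Icc (0 : ℝ) 1 ×ˢ (extChartAt 𝓘(ℝ, E) c).target := fun q hq =>
    ⟨Ioo_subset_Icc_self hq.1, hq.2⟩
  have hn := slab_mem_nhds (isOpen_extChartAt_target (I := 𝓘(ℝ, E)) c) hp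
  have ha : ∀ q ∈ Ioo (0 : ℝ) 1 ×ˢ (extChartAt 𝓘(ℝ, E) c).target,
      DifferentiableAt ℝ (linChart c α) q := fun q hq =>
    ((contDiffOn_linChart hα c).contDiffAt
      (slab_mem_nhds (isOpen_extChartAt_target c) hq)).differentiableAt (by simp)
  have hB : DifferentiableAt ℝ (bilChart c w) p :=
    ((contDiffOn_bilChart hw c).contDiffAt hn).differentiableAt (by simp)
  refine moser_identity (a := linChart c α) (X := chartVec c X)
    (g := fun p : ℝ × E => g p.1 ((extChartAt 𝓘(ℝ, E) c).symm p.2)) hB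
    ((contDiffOn_linChart hα c).contDiffAt hn) (((hϑ c).contDiffAt hn).differentiableAt (by simp))
    ((hX.contDiffAt hn).differentiableAt (by simp)) ((hg.contDiffAt hn).differentiableAt (by simp))
    ?_ ?_ ?_ (hgϑ p hp) (bilChart_swap c w p) u v
  · filter_upwards [hev] with q hq u v
    rw [bilChart_eq_of_primitive hα hprim (hIcc q hq), fderiv_slab_snd_eq (ha q hq),
      fderiv_slab_snd_eq (ha q hq)]
  · filter_upwards [hev] with q hq v
    rw [hXw q (hIcc q hq), (ha q hq).fderivWithin
      (uniqueDiffOn_slab (isOpen_extChartAt_target c) q (hIcc q hq))]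
  · intro u v z
    have hs : ∀ v, fderiv ℝ (fun z => bilChart c w (p.1, z)) p.2 v =
        fderiv ℝ (bilChart c w) p (0, v) :=
      fderiv_slab_snd_eq (W := E →L[ℝ] E →L[ℝ] ℝ) (F := bilChart c w) hB
    rw [← bilChart_lee hw hlee (hIcc p hp), hs, hs, hs]

end MoserLie

/-! ### The potential g of ∂ₜθ. -/

section LeePotentials

universe u

variable {E : Type u} [NormedAddCommGroup E] [NormedSpace ℝ E] [FiniteDimensional ℝ E]
variable {M : Type*} [TopologicalSpace M] [ChartedSpace E M] [IsManifold 𝓘(ℝ, E) ∞ M]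

/-- The time derivative of a smooth family of `1`-forms of constant cohomology class is the
differential of a smooth family of functions. -/
theorem exists_timeDerivative_potential {θ : ℝ → Form E M 1}
    (hϑ : ∀ c, ContDiffOn ℝ ∞ (linChart c θ) (Icc (0 : ℝ) 1 ×ˢ (extChartAt 𝓘(ℝ, E) c).target))
    (hclass : ∀ t ∈ Icc (0 : ℝ) 1, SameDeRhamClass (θ t) (θ 0)) :
    ∃ g : ℝ → M → ℝ,
      (∀ c, ContDiffOn ℝ ∞ (fun p : ℝ × E => g p.1 ((extChartAt 𝓘(ℝ, E) c).symm p.2))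
        (Icc (0 : ℝ) 1 ×ˢ (extChartAt 𝓘(ℝ, E) c).target)) ∧
      ∀ c, ∀ p ∈ Ioo (0 : ℝ) 1 ×ˢ (extChartAt 𝓘(ℝ, E) c).target, ∀ v,
        fderiv ℝ (fun p : ℝ × E => g p.1 ((extChartAt 𝓘(ℝ, E) c).symm p.2)) p (0, v) =
          fderiv ℝ (linChart c θ) p (1, 0) v := by
  have h01 : (0 : ℝ) ∈ Icc (0 : ℝ) 1 := ⟨le_rfl, zero_le_one⟩
  -- This choice has no regularity in t; `exists_smooth_primitive` repairs it without changing the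
  -- space differentials.
  choose! h hh hdh using hclass
  obtain ⟨h', hsm, hder⟩ := exists_smooth_primitive (h := h)
    (β := fun c p => linChart c θ p - linChart c θ (0, p.2))
    (fun c => (hϑ c).sub ((hϑ c).comp (contDiff_const.prodMk contDiff_snd).contDiffOn
      fun p hp => ⟨h01, hp.2⟩)) (fun c t ht y hy => by
    have h1 := hasFDerivAt_comp_chart_symm hy ((hh t ht).mdifferentiable (by simp) _)
    refine h1.congr_fderiv (ContinuousLinearMap.ext fun v => ?_)
    rw [sub_apply, linChart_apply, linChart_apply, ContinuousLinearMap.comp_apply]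
    have h2 : formAt (θ t) ((extChartAt 𝓘(ℝ, E) c).symm y)
        - formAt (θ 0) ((extChartAt 𝓘(ℝ, E) c).symm y)
        = formAt (differential (h t)) ((extChartAt 𝓘(ℝ, E) c).symm y) := hdh t ht _
    simp only
    rw [← sub_apply, ← map_sub, h2]
    rfl)
  have hK : ∀ c, ∀ q ∈ Ioo (0 : ℝ) 1 ×ˢ (extChartAt 𝓘(ℝ, E) c).target, ContDiffAt ℝ ∞
      (fun p : ℝ × E => h' p.1 ((extChartAt 𝓘(ℝ, E) c).symm p.2)) q := fun c q hq =>
    (hsm c).contDiffAt (slab_mem_nhds (isOpen_extChartAt_target c) hq)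
  refine ⟨fun t x => derivWithin (fun s => h' s x) (Icc 0 1) t,
    fun c => contDiffOn_slab_derivWithin_fst (isOpen_extChartAt_target c) (hsm c), fun c p hp v => ?_⟩
  have hev : ∀ᶠ q in 𝓝 p, q ∈ Ioo (0 : ℝ) 1 ×ˢ (extChartAt 𝓘(ℝ, E) c).target :=
    (isOpen_Ioo.prod (isOpen_extChartAt_target c)).mem_nhds hp
  refine fderiv_timeDerivative (K := fun p : ℝ × E => h' p.1 ((extChartAt 𝓘(ℝ, E) c).symm p.2))
    (ϑ₀ := fun y => linChart c θ (0, y)) (hK c p hp) (((hϑ c).contDiffAt (slab_mem_nhds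
      (isOpen_extChartAt_target c) hp)).differentiableAt (by simp)) ?_ ?_ v
  · filter_upwards [hev] with q hq
    have hq' : q ∈ Icc (0 : ℝ) 1 ×ˢ (extChartAt 𝓘(ℝ, E) c).target :=
      ⟨Ioo_subset_Icc_self hq.1, hq.2⟩
    have h1 := (hasDerivWithinAt_slab_fst (hsm c) hq').derivWithin
      (uniqueDiffOn_Icc zero_lt_one q.1 hq'.1)
    rw [((hK c q hq).differentiableAt (by simp)).fderivWithin
      (uniqueDiffOn_slab (isOpen_extChartAt_target c) q hq')] at h1
    exact h1
  · filter_upwards [hev] with q hq v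
    rw [← fderiv_slab_snd_eq ((hK c q hq).differentiableAt (by simp)) v,
      (hder c q.1 (Ioo_subset_Icc_self hq.1) q.2 hq.2).fderiv]
    rfl

end LeePotentials

end LCS

/-! ### Assembly of the argument. -/

theorem corollaryc2
    {E : Type*} [NormedAddCommGroup E] [NormedSpace ℝ E] [FiniteDimensional ℝ E]
    (hdim : 4 ≤ Module.finrank ℝ E)
    {M : Type*} [TopologicalSpace M] [T2Space M] [CompactSpace M]
    [ChartedSpace E M] [IsManifold 𝓘(ℝ, E) ∞ M]
    (w : ℝ → LCS.Form E M 2) (θ α : ℝ → LCS.Form E M 1)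
    (hw : LCS.SmoothFamily w) (hlcs : ∀ t ∈ Icc (0 : ℝ) 1, LCS.IsLCS (w t))
    (hθ : ∀ t ∈ Icc (0 : ℝ) 1, LCS.IsLeeForm (θ t) (w t))
    (hclass : ∀ s ∈ Icc (0 : ℝ) 1, ∀ t ∈ Icc (0 : ℝ) 1, LCS.SameDeRhamClass (θ s) (θ t))
    (hα : LCS.SmoothFamily α)
    (hprim : ∀ t ∈ Icc (0 : ℝ) 1, ∀ x : M,
      w t x = LCS.extD (α t) x - LCS.wedge (θ t) (α t) x) :
    ∃ φ : ℝ → (M ≃ₘ^∞⟮𝓘(ℝ, E), 𝓘(ℝ, E)⟯ M), LCS.IsIsotopy φ ∧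
      ∀ t ∈ Icc (0 : ℝ) 1, LCS.ConformallyEquivalent (LCS.pullback (φ t) (w t)) (w 0) := by
  open LCS in
  have h01 : (0 : ℝ) ∈ Icc (0 : ℝ) 1 := ⟨le_rfl, zero_le_one⟩
  have : Nontrivial E := Module.nontrivial_of_finrank_pos (R := ℝ) (by omega)
  have hnd : ∀ t ∈ Icc (0 : ℝ) 1, ∀ x, NondegenerateAt (w t) x :=
    fun t ht => (hlcs t ht).nondegenerate
  have hlee : ∀ t ∈ Icc (0 : ℝ) 1, ∀ x, extD (w t) x = wedge (θ t) (w t) x :=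
    fun t ht => (hθ t ht).extD_eq
  have hϑ := contDiffOn_linChart_lee hdim hw hnd hlee
  obtain ⟨g, hg, hgϑ⟩ := exists_timeDerivative_potential hϑ fun t ht => hclass t ht 0 h01
  obtain ⟨X, hX, hXw⟩ := exists_moser_vectorField hw hnd hα hg
  obtain ⟨φ, hφ, hflow⟩ := exists_isotopy_of_vectorField hX
  -- The rate g + θ(X) of the Moser identity, written without charts so that it can be integrated
  -- along orbits.
  let μ : ℝ → M → ℝ := fun t x => g t x + lin E (formAt (θ t) x) (X t x)
  have hμc : ∀ c, ∀ p ∈ Icc (0 : ℝ) 1 ×ˢ (extChartAt 𝓘(ℝ, E) c).target,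
      μ p.1 ((extChartAt 𝓘(ℝ, E) c).symm p.2) =
        g p.1 ((extChartAt 𝓘(ℝ, E) c).symm p.2) + linChart c θ p (chartVec c X p) := by
    intro c p hp
    rw [linChart_apply, chartSymmD_chartVec X hp.2]
  have hμ : ∀ c, ContinuousOn (fun p : ℝ × E => μ p.1 ((extChartAt 𝓘(ℝ, E) c).symm p.2))
      (Icc (0 : ℝ) 1 ×ˢ (extChartAt 𝓘(ℝ, E) c).target) := fun c =>
    ((hg c).continuousOn.add ((hϑ c).continuousOn.clm_apply (hX c).continuousOn)).congr (hμc c)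
  refine ⟨φ, hφ, fun t ht => ?_⟩
  refine conformallyEquivalent_of_bilChart
    (f := fun x => Real.exp (∫ s in (0 : ℝ)..t, μ s (φ s x)))
    (fun c y hy u v => contDiffAt_bilChart_pullback hw hφ hy ht u v) (fun c y hy u v => ?_)
    (hnd 0 h01) (fun x => Real.exp_pos _) fun c y hy u v => ?_
  · have h1 : ContDiffAt ℝ ∞ (fun z => bilChart c w (0, z)) y :=
      ContDiffOn.contDiffAt ((contDiffOn_bilChart hw c).comp (f := fun z => (0, z))
        (contDiff_const.prodMk contDiff_id).contDiffOn fun z hz => ⟨h01, hz⟩)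
        ((isOpen_extChartAt_target (I := 𝓘(ℝ, E)) c).mem_nhds hy)
    exact (h1.clm_apply contDiffAt_const).clm_apply contDiffAt_const
  · refine bilChart_pullback_eq_exp hw hX hφ hflow hμ (fun c p hp u v => ?_) hy ht u v
    rw [hμc c p ⟨Ioo_subset_Icc_self hp.1, hp.2⟩]
    exact lie_moser_vectorField hw hα hϑ hlee hprim (hg c) (hgϑ c) (hX c) (hXw c) hp u v
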